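/- **Conventions.** A punctured surface $F^2$ is a closed connected surface minus the interior of a disk. A triangulation $G$ of $F^2$ is a simple graph embedded in $F^2$ such that vertices, edges and faces form a simplicial complex with underlying space $F^2$; $\partial G$ is the subgraph triangulating $\partial F^2$, and vertices and edges not in $\partial G$ are called inner. $\mathcal F^2(4)$ is the set of triangulations of $F^2$ with all degrees $\ge 4$. An edge is *contractible* if identifying its ends (and the two edges on each side of a collapsed face) creates no further double edge and gives again a triangulation of $F^2$; $G$ is *irreducible* if it has no contractible edge. A *diagonal flip* replaces the common edge $ac$ of two faces $abc$, $acd$ ($b\neq d$) by $bd$, where $bd$ is not already an edge. Let $v_1v_2v_3$ be a 3-cycle of $4$-valent vertices and $a_1,a_2,a_3$ the three further vertices with $a_i$ adjacent to $v_j,v_k$ for $\{i,j,k\}=\{1,2,3\}$. The six vertices induce an *octahedron component* if $a_1a_2a_3$ is a cycle of $G$ and (up to the order of the indices) either no $v_i$ is in $\partial G$, or exactly $v_1$ is and $\partial G=v_1a_2a_3$, or exactly $v_1,v_2$ are and $\partial G=v_1v_2a_3$, or all are and $\partial G=v_1v_2v_3$. It is *external* if no $v_i$ is in $\partial G$ and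 $a_1a_3,a_2a_3\in\partial G$. They induce a *quasi-octahedron component* if either $a_1a_2a_3$ is a cycle that is not a face, $v_3$ is the only $v_i$ in $\partial G$, and $a_1a_2\notin\partial G$; or $a_1a_3,a_2a_3$ are edges and $a_1a_2$ is not, $v_3\in\partial G$, and all 3-cycles on the six vertices are faces. A *4-reduction* is one of the following operations, leading from a member of $\mathcal F^2(4)$ to a member of $\mathcal F^2(4)$ (for the same $F^2$): 1. contraction of a contractible edge; 2. deletion of $v_1,v_2,v_3$ of an octahedron component (the triangle $a_1a_2a_3$ becoming a face if no $v_i$ is in $\partial G$, and the boundary otherwise), or of $v_1,v_2,v_3,a_3$ of an external one; 3. for an external octahedron with $\deg a_3=4$ and $\deg a_1=6$ or $\deg a_2=6$: deletion of $v_1,v_2,v_3,a_3$ followed by the addition of an octahedron inside the other face $a_1a_2w$ at $a_1a_2$; 4. for a quasi-octahedron component: deletion of $v_1,v_2,v_3$; or deletion of $v_1,v_2$ followed by contraction of $a_1v_3$, so that $a_1a_2a_3$ becomes a face; 5. for an octahedron component whose only edge in $\partial G$ is $a_1a_2$, with $\deg a_2=5$ and $v$ the neighbour of $a_2$ outside the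 component: deletion of the edge $a_1a_2$ followed by contraction of $a_2v$ (which has to be contractible after the deletion); 6. for two faces $xzy$, $xzv$ ($y\ne v$) such that $xy$ and $zv$ are contractible, and either both lie in $\partial G$, or one of them does and some inner vertex among $x,y,z,v$ has degree $\ge5$: contraction of both $xy$ and $zv$. $G\in\mathcal F^2(4)$ is *4-minimal* if it admits no 4-reduction, and *4-minimal when flips are admissible* if no triangulation obtained from $G$ by a (possibly empty) sequence of diagonal flips within $\mathcal F^2(4)$ admits a 4-reduction. **Theorem.** Let $F^2$ be a punctured surface other than the disk and let $G\in\mathcal F^2(4)$. (i) If $G$ is 4-minimal when flips are admissible, then $G$ is irreducible. (ii) If $G$ is irreducible, then $G$ is 4-minimal, i.e. it admits no 4-reduction. (iii) $G$ (in particular, any 4-minimal $G$) can be transformed into an irreducible triangulation of $F^2$ in $\mathcal F^2(4)$ by a finite sequence of 4-reductions and diagonal flips, all within $\mathcal F^2(4)$. -/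

import Mathlib

namespace SurfTri

/-! ### Triangulated surfaces

Triangulations are considered up to equivalence, so a triangulation is a finite abstract simplicial
complex, all of whose maximal simplices are triangles; it is given by its set of faces `K`, a finite
set of 3-element sets of vertices. -/

/-- The vertices of the complex with face set `K`. -/
def verts {V : Type*} [DecidableEq V] (K : Finset (Finset V)) : Finset V :=
  K.biUnion id

/-- The edges of the complex with face set `K`. -/
def edges {V : Type*} [DecidableEq V] (K : Finset (Finset V)) : Finset (Finset V) :=
  K.biUnion (fun f => f.powersetCard 2)

/-- `u` and `v` are joined by an edge. -/
abbrev Adj {V : Type*} (K : Finset (Finset V)) (u v : V) : Prop :=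
  u ≠ v ∧ ∃ f ∈ K, u ∈ f ∧ v ∈ f

/-- The degree of the vertex `v` in the 1-skeleton. -/
def deg {V : Type*} [DecidableEq V] (K : Finset (Finset V)) (v : V) : ℕ :=
  ((verts K).filter (fun w => Adj K v w)).card

/-- The faces that contain both `u` and `v`. -/
def facesAt {V : Type*} [DecidableEq V] (K : Finset (Finset V)) (u v : V) : Finset (Finset V) :=
  K.filter (fun f => u ∈ f ∧ v ∈ f)

/-- `uv` is a boundary edge: it lies in exactly one face. -/
abbrev BdryEdge {V : Type*} [DecidableEq V] (K : Finset (Finset V)) (u v : V) : Prop :=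
  u ≠ v ∧ (facesAt K u v).card = 1

/-- `v` is a boundary vertex. -/
def BdryVertex {V : Type*} [DecidableEq V] (K : Finset (Finset V)) (v : V) : Prop :=
  ∃ w, BdryEdge K v w

/-- `pq` is an edge of the link of `v`. -/
abbrev LinkAdj {V : Type*} [DecidableEq V] (K : Finset (Finset V)) (v p q : V) : Prop :=
  {v, p, q} ∈ K

/-- `K` triangulates a compact connected surface, possibly with boundary: every edge is in at most
two faces and the link of every vertex is connected (so the link is a cycle or a path), and the
1-skeleton is connected. -/
structure IsSurface {V : Type*} [DecidableEq V] (K : Finset (Finset V)) : Prop where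
  nonempty : K.Nonempty
  card_face : ∀ f ∈ K, f.card = 3
  edge_le_two : ∀ u v, u ≠ v → (facesAt K u v).card ≤ 2
  link_connected : ∀ v p q, Adj K v p → Adj K v q → Relation.ReflTransGen (LinkAdj K v) p q
  connected : ∀ u ∈ verts K, ∀ v ∈ verts K, Relation.ReflTransGen (Adj K) u v

/-- `K` triangulates a punctured surface, that is a closed connected surface minus the interior of
a disk: the boundary is nonempty and connected. -/
structure IsPunctured {V : Type*} [DecidableEq V] (K : Finset (Finset V)) : Prop
    extends IsSurface K where
  bdry_nonempty : ∃ u v, BdryEdge K u v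
  bdry_connected : ∀ u v, BdryVertex K u → BdryVertex K v →
    Relation.ReflTransGen (BdryEdge K) u v

/-- The Euler characteristic. -/
def eulerChar {V : Type*} [DecidableEq V] (K : Finset (Finset V)) : ℤ :=
  ((verts K).card : ℤ) - ((edges K).card : ℤ) + (K.card : ℤ)

/-- Orientability: the faces can be oriented so that any two faces with a common edge induce
opposite directions on it. `o u v w` says that the cyclic order `u, v, w` is the chosen orientation
of the face `uvw`. -/
def Orientable {V : Type*} [DecidableEq V] (K : Finset (Finset V)) : Prop :=
  ∃ o : V → V → V → Prop,
    (∀ u v w, {u, v, w} ∈ K → (o u v w ↔ o v w u) ∧ (o u v w ↔ ¬ o v u w)) ∧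
    (∀ u v w w', w ≠ w' → {u, v, w} ∈ K → {u, v, w'} ∈ K → (o u v w ↔ ¬ o u v w'))

/-- `K` and `L` triangulate the same punctured surface. By the classification of surfaces, a
compact connected surface with connected nonempty boundary is determined up to homeomorphism by its
Euler characteristic and its orientability. -/
def SameSurface {V : Type*} [DecidableEq V] (K L : Finset (Finset V)) : Prop :=
  IsPunctured K ∧ IsPunctured L ∧ eulerChar K = eulerChar L ∧ (Orientable K ↔ Orientable L)

/-- `K` triangulates the disk, the only punctured surface of Euler characteristic `1`. -/
def IsDisk {V : Type*} [DecidableEq V] (K : Finset (Finset V)) : Prop :=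
  IsPunctured K ∧ eulerChar K = 1

/-- The family of all triangulations of punctured surfaces with minimum degree at least `4`. -/
def InF4 {V : Type*} [DecidableEq V] (K : Finset (Finset V)) : Prop :=
  IsPunctured K ∧ ∀ v ∈ verts K, 4 ≤ deg K v

/-! ### Edge contraction and irreducibility -/

/-- The result of identifying `b` with `a`; faces that contain both `a` and `b` collapse. -/
def contract {V : Type*} [DecidableEq V] (K : Finset (Finset V)) (a b : V) : Finset (Finset V) :=
  (K.image (fun f => f.image (fun v => if v = b then a else v))).filter (fun f => f.card = 3)

/-- The edge `ab` is contractible: identifying its ends gives a triangulation of the same surface.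
The second clause says that no double edge appears apart from the pairs of edges that bound the
collapsed faces, that is, `ab` lies on no critical 3-cycle. -/
def Contractible {V : Type*} [DecidableEq V] (K : Finset (Finset V)) (a b : V) : Prop :=
  Adj K a b ∧ (∀ c, Adj K a c → Adj K b c → {a, b, c} ∈ K) ∧ SameSurface K (contract K a b)

/-- No edge is contractible. -/
def IsIrreducible {V : Type*} [DecidableEq V] (K : Finset (Finset V)) : Prop :=
  ∀ a b, ¬ Contractible K a b

/-! ### Octahedron and quasi-octahedron components -/

/-- Delete the vertices in `S` together with all faces at them. -/
def deleteVerts {V : Type*} [DecidableEq V] (K : Finset (Finset V)) (S : Finset V) :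
    Finset (Finset V) :=
  K.filter (fun f => Disjoint f S)

/-- Six vertices such that `v₁v₂v₃` is a 3-cycle of 4-valent vertices and `aᵢ` is adjacent to `vⱼ`
and `vₖ` for `{i, j, k} = {1, 2, 3}`. (As `deg vᵢ = 4`, there is no other choice of the `aᵢ`.) -/
structure Hexad {V : Type*} [DecidableEq V] (K : Finset (Finset V))
    (v₁ v₂ v₃ a₁ a₂ a₃ : V) : Prop where
  nodup : [v₁, v₂, v₃, a₁, a₂, a₃].Nodup
  deg_v : deg K v₁ = 4 ∧ deg K v₂ = 4 ∧ deg K v₃ = 4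
  cycle_v : Adj K v₁ v₂ ∧ Adj K v₂ v₃ ∧ Adj K v₁ v₃
  adj_a₁ : Adj K a₁ v₂ ∧ Adj K a₁ v₃
  adj_a₂ : Adj K a₂ v₁ ∧ Adj K a₂ v₃
  adj_a₃ : Adj K a₃ v₁ ∧ Adj K a₃ v₂

/-- The whole boundary is the 3-cycle `xyz`. -/
def BdryIs {V : Type*} [DecidableEq V] (K : Finset (Finset V)) (x y z : V) : Prop :=
  ∀ u w, BdryEdge K u w ↔
    u ≠ w ∧ u ∈ ({x, y, z} : Finset V) ∧ w ∈ ({x, y, z} : Finset V)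

/-- None of the three vertices is on the boundary. -/
def AllInner {V : Type*} [DecidableEq V] (K : Finset (Finset V)) (x y z : V) : Prop :=
  ¬ BdryVertex K x ∧ ¬ BdryVertex K y ∧ ¬ BdryVertex K z

/-- An octahedron component centered at `v₁v₂v₃` with remaining vertices `a₁, a₂, a₃` (up to a
simultaneous permutation of the indices). -/
def IsOctahedron {V : Type*} [DecidableEq V] (K : Finset (Finset V))
    (v₁ v₂ v₃ a₁ a₂ a₃ : V) : Prop :=
  Hexad K v₁ v₂ v₃ a₁ a₂ a₃ ∧ (Adj K a₁ a₂ ∧ Adj K a₂ a₃ ∧ Adj K a₁ a₃) ∧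
  (AllInner K v₁ v₂ v₃ ∨
   (BdryVertex K v₁ ∧ ¬ BdryVertex K v₂ ∧ ¬ BdryVertex K v₃ ∧ BdryIs K v₁ a₂ a₃) ∨
   (BdryVertex K v₁ ∧ BdryVertex K v₂ ∧ ¬ BdryVertex K v₃ ∧ BdryIs K v₁ v₂ a₃) ∨
   (BdryVertex K v₁ ∧ BdryVertex K v₂ ∧ BdryVertex K v₃ ∧ BdryIs K v₁ v₂ v₃))

/-- An octahedron component is external, with free vertex `a₃`: the edges `a₁a₃` and `a₂a₃` are
boundary edges and the center has no boundary vertex. -/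
def IsExternalOctahedron {V : Type*} [DecidableEq V] (K : Finset (Finset V))
    (v₁ v₂ v₃ a₁ a₂ a₃ : V) : Prop :=
  IsOctahedron K v₁ v₂ v₃ a₁ a₂ a₃ ∧ AllInner K v₁ v₂ v₃ ∧ BdryEdge K a₁ a₃ ∧ BdryEdge K a₂ a₃

/-- A quasi-octahedron component centered at `v₁v₂v₃` with remaining vertices `a₁, a₂, a₃`, with
the indices ordered so that `v₃` is on the boundary. -/
def IsQuasiOctahedron {V : Type*} [DecidableEq V] (K : Finset (Finset V))
    (v₁ v₂ v₃ a₁ a₂ a₃ : V) : Prop :=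
  Hexad K v₁ v₂ v₃ a₁ a₂ a₃ ∧ BdryVertex K v₃ ∧ Adj K a₂ a₃ ∧ Adj K a₁ a₃ ∧
  ((Adj K a₁ a₂ ∧ {a₁, a₂, a₃} ∉ K ∧ ¬ BdryVertex K v₁ ∧ ¬ BdryVertex K v₂ ∧ ¬ BdryEdge K a₁ a₂) ∨
   (¬ Adj K a₁ a₂ ∧
    ∀ x ∈ ({v₁, v₂, v₃, a₁, a₂, a₃} : Finset V), ∀ y ∈ ({v₁, v₂, v₃, a₁, a₂, a₃} : Finset V),
      ∀ z ∈ ({v₁, v₂, v₃, a₁, a₂, a₃} : Finset V),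
        Adj K x y → Adj K y z → Adj K x z → {x, y, z} ∈ K))

/-! ### The six reductions -/

/-- Edge contraction. -/
def EdgeContraction {V : Type*} [DecidableEq V] (K L : Finset (Finset V)) : Prop :=
  ∃ a b, Contractible K a b ∧ L = contract K a b

/-- Removal of an octahedron. If the center has no boundary vertex, the triangle `a₁a₂a₃` becomes a
face; otherwise the boundary 3-cycle is moved to `a₁a₂a₃`. In the third case an external octahedron
is deleted together with its free vertex. -/
def OctahedronRemoval {V : Type*} [DecidableEq V] (K L : Finset (Finset V)) : Prop :=
  ∃ v₁ v₂ v₃ a₁ a₂ a₃,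
    (IsOctahedron K v₁ v₂ v₃ a₁ a₂ a₃ ∧ AllInner K v₁ v₂ v₃ ∧
      L = insert {a₁, a₂, a₃} (deleteVerts K {v₁, v₂, v₃})) ∨
    (IsOctahedron K v₁ v₂ v₃ a₁ a₂ a₃ ∧ ¬ AllInner K v₁ v₂ v₃ ∧
      L = deleteVerts K {v₁, v₂, v₃}) ∨
    (IsExternalOctahedron K v₁ v₂ v₃ a₁ a₂ a₃ ∧ L = deleteVerts K {a₃, v₁, v₂, v₃})

/-- The seven triangles that subdivide the triangle `a₁a₂a₃` when an octahedron centered at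
`v₁v₂v₃` is added to it. -/
def octaFaces {V : Type*} [DecidableEq V] (v₁ v₂ v₃ a₁ a₂ a₃ : V) : Finset (Finset V) :=
  {{v₁, v₂, v₃}, {v₁, v₂, a₃}, {v₂, v₃, a₁}, {v₁, v₃, a₂},
   {v₁, a₂, a₃}, {v₂, a₁, a₃}, {v₃, a₁, a₂}}

/-- Folding an external octahedron onto the face `a₁a₂w` outside of it: the octahedron is deleted
together with its free vertex and an octahedron is added to the face `a₁a₂w` (the names of the
deleted vertices `v₁, v₂, v₃` are used again). -/
def OctahedronFolding {V : Type*} [DecidableEq V] (K L : Finset (Finset V)) : Prop :=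
  ∃ v₁ v₂ v₃ a₁ a₂ a₃ w, IsExternalOctahedron K v₁ v₂ v₃ a₁ a₂ a₃ ∧ deg K a₃ = 4 ∧
    (deg K a₁ = 6 ∨ deg K a₂ = 6) ∧ w ≠ v₃ ∧ {a₁, a₂, w} ∈ K ∧
    L = (deleteVerts K {a₃, v₁, v₂, v₃}).erase {a₁, a₂, w} ∪ octaFaces v₁ v₂ v₃ a₁ a₂ w

/-- Removal of a quasi-octahedron: either its three central vertices are deleted, or the two central
vertices `v₁, v₂` are deleted and in the resulting quadrilateral `a₁v₃a₂a₃` the edge `a₁v₃` is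
contracted, so that the face `a₁a₂a₃` remains. -/
def QuasiOctahedronRemoval {V : Type*} [DecidableEq V] (K L : Finset (Finset V)) : Prop :=
  ∃ v₁ v₂ v₃ a₁ a₂ a₃, IsQuasiOctahedron K v₁ v₂ v₃ a₁ a₂ a₃ ∧
    (L = deleteVerts K {v₁, v₂, v₃} ∨ L = insert {a₁, a₂, a₃} (deleteVerts K {v₁, v₂, v₃}))

/-- Delete the edge `ab` together with the faces at it. -/
def deleteEdge {V : Type*} [DecidableEq V] (K : Finset (Finset V)) (a b : V) :
    Finset (Finset V) :=
  K.filter (fun f => ¬ (a ∈ f ∧ b ∈ f))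

/-- Replacement of a boundary octahedron: `a₁a₂` is the only edge of the octahedron on the boundary,
`a₂` has degree `5`, and `v` is its neighbour outside the octahedron; the edge `a₁a₂` is deleted and
then the edge `a₂v` is contracted. -/
def BoundaryOctahedronReplacement {V : Type*} [DecidableEq V] (K L : Finset (Finset V)) : Prop :=
  ∃ v₁ v₂ v₃ a₁ a₂ a₃ v, IsOctahedron K v₁ v₂ v₃ a₁ a₂ a₃ ∧ BdryEdge K a₁ a₂ ∧
    (∀ x ∈ ({v₁, v₂, v₃, a₁, a₂, a₃} : Finset V), ∀ y ∈ ({v₁, v₂, v₃, a₁, a₂, a₃} : Finset V),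
      BdryEdge K x y → ({x, y} : Finset V) = {a₁, a₂}) ∧
    deg K a₂ = 5 ∧ v ∉ ({v₁, v₂, v₃, a₁, a₂, a₃} : Finset V) ∧ Adj K a₂ v ∧
    Contractible (deleteEdge K a₁ a₂) a₂ v ∧ L = contract (deleteEdge K a₁ a₂) a₂ v

/-- Double contraction in a contractible N-component: the faces `xzy` and `xzv` share the edge `xz`,
the non-incident edges `xy` and `zv` are contractible, and either both of them are boundary edges, or
one of them is and some inner vertex among `x, y, z, v` has degree at least `5`; both are
contracted. -/
def DoubleContraction {V : Type*} [DecidableEq V] (K L : Finset (Finset V)) : Prop :=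
  ∃ x y z v, y ≠ v ∧ {x, z, y} ∈ K ∧ {x, z, v} ∈ K ∧ Contractible K x y ∧ Contractible K z v ∧
    (BdryEdge K x y ∨ BdryEdge K z v) ∧
    ((BdryEdge K x y ∧ BdryEdge K z v) ∨
      ∃ t ∈ ({x, y, z, v} : Finset V), ¬ BdryVertex K t ∧ 5 ≤ deg K t) ∧
    L = contract (contract K x y) z v

/-- `L` arises from `K` by a 4-reduction: one of the six reductions that leads from a triangulation
with minimum degree at least `4` to another one of the same surface. -/
def FourReduction {V : Type*} [DecidableEq V] (K L : Finset (Finset V)) : Prop :=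
  InF4 K ∧ InF4 L ∧ SameSurface K L ∧
  (EdgeContraction K L ∨ OctahedronRemoval K L ∨ OctahedronFolding K L ∨
   QuasiOctahedronRemoval K L ∨ BoundaryOctahedronReplacement K L ∨ DoubleContraction K L)

/-- `K` admits no 4-reduction. -/
def FourMinimal {V : Type*} [DecidableEq V] (K : Finset (Finset V)) : Prop :=
  ∀ L, ¬ FourReduction K L

/-! ### Diagonal flips -/

/-- `L` arises from `K` by a diagonal flip in the family: in the quadrilateral formed by the faces
`abc` and `acd` the diagonal `ac` is replaced by `bd`, which must not be an edge already. -/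
def DiagonalFlip {V : Type*} [DecidableEq V] (K L : Finset (Finset V)) : Prop :=
  InF4 K ∧ InF4 L ∧ SameSurface K L ∧
  ∃ a b c d, b ≠ d ∧ {a, b, c} ∈ K ∧ {a, c, d} ∈ K ∧ ¬ Adj K b d ∧
    L = (K.erase {a, b, c}).erase {a, c, d} ∪ {{a, b, d}, {b, c, d}}

/-- The admissible operations: 4-reductions and diagonal flips. -/
def AdmissibleOp {V : Type*} [DecidableEq V] (K L : Finset (Finset V)) : Prop :=
  FourReduction K L ∨ DiagonalFlip K L

/-- `K` is 4-minimal when flips are admissible: no 4-reduction becomes possible, neither at once nor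
after any sequence of diagonal flips. -/
def FourMinimalWithFlips {V : Type*} [DecidableEq V] (K : Finset (Finset V)) : Prop :=
  ∀ L, Relation.ReflTransGen DiagonalFlip K L → FourMinimal L

end SurfTri

/-! Everything rests on one claim, `reducible_of_contractible`: if a triangulation in the family is
not the disk and has a contractible edge, then suitable flips lead to a triangulation with a
4-reduction that lowers the number of vertices. The first assertion is its contrapositive. The third
follows by induction on the number of vertices, since the Euler characteristic is preserved and the
disk therefore never appears. The second assertion is separate and easier: every pattern on which a
4-reduction acts already contains a contractible edge.

Two tools have to be justified combinatorially. Contraction of an edge `ab` preserves the surface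
when the common neighbours of `a` and `b` all lie in faces at `ab` and an inner `ab` does not join
two boundary vertices (`LinkCond.sameSurface`); the latter is also necessary
(`LinkCond.bdry_of_isSurface`). A flip preserves the surface as well (`FlipCond.sameSurface`). In
both cases the surface axioms, the Euler characteristic and orientability are checked directly on
the faces.

Contraction lowers only the degrees of the one or two vertices opposite to the contracted edge, each
by one, and the merged vertex keeps degree at least 4. So a contractible edge `ac` fails to be a
4-reduction only because of a 4-valent vertex `b` in a face `acb`. The link of `b` is a 4-cycle
(`Cyc`) or a path on four vertices (`Pth`), so the common neighbours of `b` and any neighbour are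
visible, and one tries to contract an edge at `b` instead. Each failure produces either one more
adjacency or one more 4-valent vertex. What survives is a short list of rigid configurations: an
octahedron (`Oct`), its variant with one boundary vertex in the center (`OneB`), and two
configurations with a boundary 3-cycle (`reducible_of_two_bdry`, `reducible_of_three_bdry`). In
these, a flip of an outer edge of degree-5 ends typically raises a 4-valent vertex to degree 5 and
unlocks a contraction, unless the configuration closes up to a sphere, which has no boundary, or to
the disk, which is excluded.

The 4-reductions used for this are only edge contraction and, in `reducible_of_double`, the
simultaneous contraction of two boundary edges. -/

namespace SurfTri

/-! ### Faces as triples, adjacency, boundary edges. -/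

variable {V : Type*} [DecidableEq V] {K L : Finset (Finset V)}

/-- `a`, `b`, `c` span a face. -/
def Tri (K : Finset (Finset V)) (a b c : V) : Prop := ({a, b, c} : Finset V) ∈ K

theorem Tri.rot {a b c : V} (h : Tri K a b c) : Tri K b c a := by
  have : ({b, c, a} : Finset V) = {a, b, c} := by ext; simp; tauto
  unfold Tri; rwa [this]

theorem Tri.swap {a b c : V} (h : Tri K a b c) : Tri K b a c := by
  have : ({b, a, c} : Finset V) = {a, b, c} := by ext; simp; tauto
  unfold Tri; rwa [this]

theorem Tri.swap' {a b c : V} (h : Tri K a b c) : Tri K a c b := h.rot.rot.swap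

/-- The neighbours of `v`. -/
def nbrs (K : Finset (Finset V)) (v : V) : Finset V := (verts K).filter (fun w => Adj K v w)

theorem deg_eq_card_nbrs (v : V) : deg K v = (nbrs K v).card := rfl

theorem mem_verts {v : V} : v ∈ verts K ↔ ∃ f ∈ K, v ∈ f := by simp [verts]

theorem Adj.symm {V : Type*} {K : Finset (Finset V)} {u v : V} (h : Adj K u v) : Adj K v u :=
  ⟨h.1.symm, h.2.imp fun _ hf => ⟨hf.1, hf.2.2, hf.2.1⟩⟩

theorem adj_comm {V : Type*} {K : Finset (Finset V)} {u v : V} : Adj K u v ↔ Adj K v u :=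
  ⟨Adj.symm, Adj.symm⟩

theorem Adj.mem_verts_right {u v : V} (h : Adj K u v) : v ∈ verts K := by
  obtain ⟨f, hf, -, hv⟩ := h.2
  exact mem_verts.2 ⟨f, hf, hv⟩

theorem Adj.mem_verts_left {u v : V} (h : Adj K u v) : u ∈ verts K := h.symm.mem_verts_right

theorem mem_nbrs {v w : V} : w ∈ nbrs K v ↔ Adj K v w := by
  simp only [nbrs, Finset.mem_filter, and_iff_right_iff_imp]
  exact Adj.mem_verts_right

/-- All faces are triangles. -/
def Pure3 (K : Finset (Finset V)) : Prop := ∀ f ∈ K, f.card = 3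

theorem Tri.ne (hK : Pure3 K) {a b c : V} (h : Tri K a b c) : a ≠ b ∧ a ≠ c ∧ b ≠ c := by
  have h3 := hK _ h
  refine ⟨?_, ?_, ?_⟩ <;> rintro rfl
  · have := Finset.card_le_two (a := a) (b := c); simp at h3; omega
  · have := Finset.card_le_two (a := a) (b := b)
    rw [show ({a, b, a} : Finset V) = {a, b} by ext; simp; tauto] at h3; omega
  · have := Finset.card_le_two (a := a) (b := b); simp at h3; omega

theorem exists_third (hK : Pure3 K) {f : Finset V} (hf : f ∈ K) {u v : V} (huv : u ≠ v)
    (hu : u ∈ f) (hv : v ∈ f) : ∃ w, f = {u, v, w} := by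
  have h3 := hK f hf
  have h1 : ((f.erase u).erase v).card = 1 := by
    rw [Finset.card_erase_of_mem (by simp [huv.symm, hv]), Finset.card_erase_of_mem hu, h3]
  obtain ⟨w, hw⟩ := Finset.card_eq_one.1 h1
  refine ⟨w, ?_⟩
  rw [← hw, Finset.insert_erase (by simp [huv.symm, hv]), Finset.insert_erase hu]

theorem adj_iff (hK : Pure3 K) {u v : V} : Adj K u v ↔ ∃ w, Tri K u v w := by
  constructor
  · rintro ⟨hne, f, hf, hu, hv⟩
    obtain ⟨w, rfl⟩ := exists_third hK hf hne hu hv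
    exact ⟨w, hf⟩
  · rintro ⟨w, hw⟩
    exact ⟨(hw.ne hK).1, _, hw, by simp, by simp⟩

theorem Tri.adj (hK : Pure3 K) {a b c : V} (h : Tri K a b c) :
    Adj K a b ∧ Adj K a c ∧ Adj K b c :=
  ⟨(adj_iff hK).2 ⟨c, h⟩, (adj_iff hK).2 ⟨b, h.swap'⟩, (adj_iff hK).2 ⟨a, h.rot⟩⟩

theorem exists_tri_of_mem_verts (hK : Pure3 K) {v : V} (hv : v ∈ verts K) :
    ∃ p q, Tri K v p q := by
  obtain ⟨f, hf, hvf⟩ := mem_verts.1 hv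
  obtain ⟨x, y, z, h1, h2, h3, rfl⟩ := Finset.card_eq_three.1 (hK f hf)
  have h : Tri K x y z := hf
  simp only [Finset.mem_insert, Finset.mem_singleton] at hvf
  rcases hvf with rfl | rfl | rfl
  · exact ⟨_, _, h⟩
  · exact ⟨_, _, h.rot⟩
  · exact ⟨_, _, h.rot.rot⟩

/-- The third vertices of the faces at the edge `uv`. -/
def thirds (K : Finset (Finset V)) (u v : V) : Finset V :=
  (verts K).filter (fun w => ({u, v, w} : Finset V) ∈ K)

theorem mem_thirds {u v w : V} : w ∈ thirds K u v ↔ Tri K u v w := by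
  simp only [thirds, Finset.mem_filter]
  exact ⟨fun h => h.2, fun h => ⟨mem_verts.2 ⟨_, h, by simp⟩, h⟩⟩

theorem card_facesAt (hK : Pure3 K) {u v : V} (huv : u ≠ v) :
    (facesAt K u v).card = (thirds K u v).card := by
  symm
  refine Finset.card_bij (fun w _ => {u, v, w}) ?_ ?_ ?_
  · intro w hw
    simp only [facesAt, Finset.mem_filter]
    exact ⟨mem_thirds.1 hw, by simp, by simp⟩
  · intro w hw w' hw' h
    have h1 := (mem_thirds.1 hw).ne hK
    have : w ∈ ({u, v, w'} : Finset V) := by rw [← h]; simp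
    simp only [Finset.mem_insert, Finset.mem_singleton] at this
    rcases this with rfl | rfl | rfl
    · exact absurd rfl h1.2.1
    · exact absurd rfl h1.2.2
    · rfl
  · intro f hf
    simp only [facesAt, Finset.mem_filter] at hf
    obtain ⟨w, rfl⟩ := exists_third hK hf.1 huv hf.2.1 hf.2.2
    exact ⟨w, mem_thirds.2 hf.1, rfl⟩

theorem bdryEdge_iff (hK : Pure3 K) {u v : V} :
    BdryEdge K u v ↔ ∃ w, Tri K u v w ∧ ∀ w', Tri K u v w' → w' = w := by
  constructor
  · rintro ⟨hne, h⟩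
    rw [card_facesAt hK hne] at h
    obtain ⟨w, hw⟩ := Finset.card_eq_one.1 h
    refine ⟨w, mem_thirds.1 (by simp [hw]), fun w' h' => ?_⟩
    have := mem_thirds.2 h'
    rwa [hw, Finset.mem_singleton] at this
  · rintro ⟨w, hw, h⟩
    refine ⟨(hw.ne hK).1, ?_⟩
    rw [card_facesAt hK (hw.ne hK).1, Finset.card_eq_one]
    refine ⟨w, ?_⟩
    ext x
    rw [mem_thirds, Finset.mem_singleton]
    exact ⟨h x, fun h => h ▸ hw⟩

theorem facesAt_comm (u v : V) : facesAt K u v = facesAt K v u := by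
  ext; simp [facesAt]; tauto

theorem BdryEdge.symm {u v : V} (h : BdryEdge K u v) : BdryEdge K v u :=
  ⟨h.1.symm, by rw [facesAt_comm]; exact h.2⟩

theorem BdryEdge.adj {u v : V} (h : BdryEdge K u v) : Adj K u v := by
  obtain ⟨f, hf⟩ := Finset.card_pos.1 (show 0 < (facesAt K u v).card by rw [h.2]; norm_num)
  simp only [facesAt, Finset.mem_filter] at hf
  exact ⟨h.1, f, hf⟩

theorem BdryEdge.left {u v : V} (h : BdryEdge K u v) : BdryVertex K u := ⟨v, h⟩

theorem BdryEdge.right {u v : V} (h : BdryEdge K u v) : BdryVertex K v := ⟨u, h.symm⟩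

theorem BdryEdge.unique (hK : Pure3 K) {u v w w' : V} (h : BdryEdge K u v) (h1 : Tri K u v w)
    (h2 : Tri K u v w') : w = w' := by
  obtain ⟨x, -, hx⟩ := (bdryEdge_iff hK).1 h
  rw [hx w h1, hx w' h2]

theorem exists_other (hK : Pure3 K) {u v w : V} (h : Tri K u v w) (hb : ¬ BdryEdge K u v) :
    ∃ w', Tri K u v w' ∧ w' ≠ w := by
  by_contra! hc
  exact hb ((bdryEdge_iff hK).2 ⟨w, h, hc⟩)

theorem not_bdryEdge (hK : Pure3 K) {u v w w' : V} (h : Tri K u v w) (h' : Tri K u v w')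
    (hne : w ≠ w') : ¬ BdryEdge K u v := fun hb => hne (hb.unique hK h h')

theorem edge_le_two_iff (hK : Pure3 K) :
    (∀ u v, u ≠ v → (facesAt K u v).card ≤ 2) ↔
      ∀ u v x y z, Tri K u v x → Tri K u v y → Tri K u v z → x = y ∨ x = z ∨ y = z := by
  constructor
  · intro h u v x y z hx hy hz
    have := h u v (hx.ne hK).1
    rw [card_facesAt hK (hx.ne hK).1] at this
    by_contra! hc
    have : 2 < (thirds K u v).card := Finset.two_lt_card.2
      ⟨x, mem_thirds.2 hx, y, mem_thirds.2 hy, z, mem_thirds.2 hz, hc.1, hc.2.1, hc.2.2⟩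
    omega
  · intro h u v huv
    rw [card_facesAt hK huv]
    by_contra! hc
    obtain ⟨x, hx, y, hy, z, hz, h1, h2, h3⟩ := Finset.two_lt_card.1 hc
    rcases h u v x y z (mem_thirds.1 hx) (mem_thirds.1 hy) (mem_thirds.1 hz) with h | h | h
    exacts [h1 h, h2 h, h3 h]

/-! ### Links of vertices in a surface. -/

namespace IsSurface

theorem pure (h : IsSurface K) : Pure3 K := h.card_face

theorem two_thirds (h : IsSurface K) {u v x y z : V} (hx : Tri K u v x) (hy : Tri K u v y)
    (hz : Tri K u v z) : x = y ∨ x = z ∨ y = z :=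
  (edge_le_two_iff h.pure).1 h.edge_le_two u v x y z hx hy hz

/-- A nonempty set of neighbours that is closed under link adjacency contains all neighbours. -/
theorem nbrs_of_closed (h : IsSurface K) {v p₀ : V} {P : V → Prop} (hp₀ : Adj K v p₀) (h₀ : P p₀)
    (hP : ∀ p q, P p → Tri K v p q → P q) : ∀ q, Adj K v q → P q := by
  intro q hq
  have := h.link_connected v p₀ q hp₀ hq
  induction this with
  | refl => exact h₀
  | tail _ h2 ih =>
    exact hP _ _ (ih ((Tri.adj h.pure h2).1)) h2

/-- A nonempty set of vertices that is closed under adjacency contains all vertices. -/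
theorem verts_of_closed (h : IsSurface K) {v₀ : V} {P : V → Prop} (hv₀ : v₀ ∈ verts K) (h₀ : P v₀)
    (hP : ∀ u v, P u → Adj K u v → P v) : ∀ v ∈ verts K, P v := by
  intro v hv
  induction h.connected v₀ hv₀ v hv with
  | refl => exact h₀
  | tail _ h2 ih => exact hP _ _ (ih h2.mem_verts_left) h2

theorem deg_le_of_nbrs {v : V} {S : Finset V} (h : ∀ q, Adj K v q → q ∈ S) : deg K v ≤ S.card := by
  rw [deg_eq_card_nbrs]
  exact Finset.card_le_card fun q hq => h q (mem_nbrs.1 hq)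

/-- If both edges at `v` of a face are boundary edges, then `v` has degree `2`. -/
theorem deg_le_two (h : IsSurface K) {v p q : V} (hp : BdryEdge K v p) (hq : BdryEdge K v q)
    (ht : Tri K v p q) : deg K v ≤ 2 := by
  refine (deg_le_of_nbrs (S := {p, q}) ?_).trans Finset.card_le_two
  refine h.nbrs_of_closed (ht.adj h.pure).1 (by simp) ?_
  intro x y hx hxy
  simp only [Finset.mem_insert, Finset.mem_singleton] at hx ⊢
  rcases hx with rfl | rfl
  · exact Or.inr (hp.unique h.pure hxy ht)
  · exact Or.inl (hq.unique h.pure hxy ht.swap')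

/-- A triangle in the link of `v` is the whole link. -/
theorem deg_le_three (h : IsSurface K) {v p q r : V} (h1 : Tri K v p q) (h2 : Tri K v q r)
    (h3 : Tri K v p r) : deg K v ≤ 3 := by
  refine (deg_le_of_nbrs (S := {p, q, r}) ?_).trans Finset.card_le_three
  refine h.nbrs_of_closed (h1.adj h.pure).1 (by simp) ?_
  intro x y hx hxy
  have n1 := h1.ne h.pure
  have n2 := h2.ne h.pure
  have n3 := h3.ne h.pure
  simp only [Finset.mem_insert, Finset.mem_singleton] at hx ⊢
  rcases hx with rfl | rfl | rfl
  · rcases h.two_thirds h1 h3 hxy with h | h | h <;> simp_all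
  · rcases h.two_thirds h1.swap' h2 hxy with h | h | h <;> simp_all
  · rcases h.two_thirds h2.swap' h3.swap' hxy with h | h | h <;> simp_all

/-- If the link of `v` is a path with two edges, then `v` has degree `3`. -/
theorem deg_le_three_of_bdry (h : IsSurface K) {v p q r : V} (hp : BdryEdge K v p)
    (hr : BdryEdge K v r) (h1 : Tri K v p q) (h2 : Tri K v q r) (hpr : p ≠ r) : deg K v ≤ 3 := by
  refine (deg_le_of_nbrs (S := {p, q, r}) ?_).trans Finset.card_le_three
  refine h.nbrs_of_closed (h1.adj h.pure).1 (by simp) ?_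
  intro x y hx hxy
  simp only [Finset.mem_insert, Finset.mem_singleton] at hx ⊢
  rcases hx with rfl | rfl | rfl
  · exact Or.inr (Or.inl (hp.unique h.pure hxy h1))
  · rcases h.two_thirds h1.swap' h2 hxy with h | h | h <;> simp_all
  · exact Or.inr (Or.inl (hr.unique h.pure hxy h2.swap'))

end IsSurface

/-! ### Degree sums and the boundary edges at a vertex. -/

/-- Double counting of incident pairs. It lets the edge numbers before and after a contraction or
flip be compared through degrees, without matching up the edges. -/
theorem sum_deg : ∑ v ∈ verts K, deg K v = 2 * (edges K).card := by
  have mem_edges : ∀ e, e ∈ edges K ↔ ∃ u v, Adj K u v ∧ e = {u, v} := by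
    intro e
    simp only [edges, Finset.mem_biUnion, Finset.mem_powersetCard]
    constructor
    · rintro ⟨f, hf, he, h2⟩
      obtain ⟨u, v, huv, rfl⟩ := Finset.card_eq_two.1 h2
      exact ⟨u, v, ⟨huv, f, hf, he (by simp), he (by simp)⟩, rfl⟩
    · rintro ⟨u, v, ⟨huv, f, hf, hu, hv⟩, rfl⟩
      refine ⟨f, hf, ?_, Finset.card_pair huv⟩
      intro x hx
      simp only [Finset.mem_insert, Finset.mem_singleton] at hx
      rcases hx with rfl | rfl <;> assumption
  have h1 := Finset.sum_card_bipartiteAbove_eq_sum_card_bipartiteBelow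
    (s := verts K) (t := edges K) (fun v e => v ∈ e)
  have h2 : ∀ v ∈ verts K, ((edges K).bipartiteAbove (fun v e => v ∈ e) v).card = deg K v := by
    intro v _
    rw [deg_eq_card_nbrs]
    symm
    refine Finset.card_bij (fun w _ => {v, w}) ?_ ?_ ?_
    · intro w hw
      rw [Finset.mem_bipartiteAbove]
      exact ⟨(mem_edges _).2 ⟨v, w, mem_nbrs.1 hw, rfl⟩, by simp⟩
    · intro w hw w' hw' h
      have : w ∈ ({v, w'} : Finset V) := by rw [← h]; simp
      simp only [Finset.mem_insert, Finset.mem_singleton] at this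
      rcases this with rfl | rfl
      · exact absurd rfl (mem_nbrs.1 hw).1
      · rfl
    · intro e he
      rw [Finset.mem_bipartiteAbove] at he
      obtain ⟨u, w, hadj, rfl⟩ := (mem_edges _).1 he.1
      have := he.2
      simp only [Finset.mem_insert, Finset.mem_singleton] at this
      rcases this with rfl | rfl
      · exact ⟨w, mem_nbrs.2 hadj, rfl⟩
      · exact ⟨u, mem_nbrs.2 hadj.symm, Finset.pair_comm _ _⟩
  have h3 : ∀ e ∈ edges K, ((verts K).bipartiteBelow (fun v e => v ∈ e) e).card = 2 := by
    intro e he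
    obtain ⟨u, w, hadj, rfl⟩ := (mem_edges _).1 he
    rw [← Finset.card_pair hadj.1]
    congr 1
    ext x
    rw [Finset.mem_bipartiteBelow]
    refine ⟨fun h => h.2, fun h => ⟨?_, h⟩⟩
    simp only [Finset.mem_insert, Finset.mem_singleton] at h
    rcases h with rfl | rfl
    exacts [hadj.mem_verts_left, hadj.mem_verts_right]
  rw [← Finset.sum_congr rfl h2, h1, Finset.sum_congr rfl h3, Finset.sum_const, smul_eq_mul,
    mul_comm]

/-- The link of `v` as a graph on the neighbours of `v`. -/
def linkGraph (K : Finset (Finset V)) (hK : Pure3 K) (v : V) : SimpleGraph (nbrs K v) where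
  Adj p q := Tri K v p q
  symm := ⟨fun _ _ h => h.swap'⟩
  loopless := ⟨fun _ h => (h.ne hK).2.2 rfl⟩

namespace IsSurface

theorem linkGraph_connected (h : IsSurface K) {v p : V} (hp : Adj K v p) :
    (linkGraph K h.pure v).Connected := by
  have : Nonempty (nbrs K v) := ⟨⟨p, mem_nbrs.2 hp⟩⟩
  refine ⟨fun x y => ?_⟩
  have := h.nbrs_of_closed (P := fun q => ∃ hq : q ∈ nbrs K v,
    (linkGraph K h.pure v).Reachable x ⟨q, hq⟩) (mem_nbrs.1 x.2) ⟨x.2, SimpleGraph.Reachable.refl _⟩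
    (by
      rintro a b ⟨ha, hr⟩ hab
      refine ⟨mem_nbrs.2 (hab.adj h.pure).2.1, hr.trans (SimpleGraph.Adj.reachable ?_)⟩
      exact hab) y (mem_nbrs.1 y.2)
  exact this.2

theorem card_thirds (h : IsSurface K) {v p : V} (hp : Adj K v p) :
    (BdryEdge K v p → (thirds K v p).card = 1) ∧ (¬ BdryEdge K v p → (thirds K v p).card = 2) := by
  have h1 := card_facesAt h.pure hp.1
  have h2 := h.edge_le_two v p hp.1
  have h3 : 0 < (thirds K v p).card := by
    obtain ⟨w, hw⟩ := (adj_iff h.pure).1 hp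
    exact Finset.card_pos.2 ⟨w, mem_thirds.2 hw⟩
  refine ⟨fun hb => by rw [← h1]; exact hb.2, fun hb => ?_⟩
  have : (facesAt K v p).card ≠ 1 := fun h => hb ⟨hp.1, h⟩
  omega

open Classical in
/-- The number of boundary edges at a vertex is even and at most two. -/
theorem card_bdry (h : IsSurface K) (v : V) (hv : BdryVertex K v) :
    ((nbrs K v).filter (fun p => BdryEdge K v p)).card = 2 := by
  obtain ⟨p₀, hp₀⟩ := hv
  set G := linkGraph K h.pure v with hG
  have hconn := h.linkGraph_connected hp₀.adj
  -- Let the link have N vertices, E edges and B ends of boundary edges. Connectedness gives N ≤ E +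
  -- 1. A link vertex has degree 1 at a boundary edge and 2 otherwise, so 2E + B = 2N. Hence B is
  -- even and at most 2, and it is positive by assumption.
  have hE := hconn.card_vert_le_card_edgeSet_add_one
  have hdeg : ∀ p : nbrs K v, G.degree p = (thirds K v p).card := by
    intro p
    rw [← SimpleGraph.card_neighborFinset_eq_degree]
    refine Finset.card_bij (fun q _ => q.1) ?_ ?_ ?_
    · intro q hq
      rw [SimpleGraph.mem_neighborFinset] at hq
      exact mem_thirds.2 hq
    · intro q _ q' _ hqq
      exact Subtype.ext hqq
    · intro q hq
      have hq' := mem_thirds.1 hq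
      exact ⟨⟨q, mem_nbrs.2 (hq'.adj h.pure).2.1⟩, by
        rw [SimpleGraph.mem_neighborFinset]; exact hq', rfl⟩
  have hsum := G.sum_degrees_eq_twice_card_edges
  have h2 : ∑ p : nbrs K v, (G.degree p + if BdryEdge K v p then 1 else 0) = ∑ p : nbrs K v, 2 := by
    refine Finset.sum_congr rfl fun p _ => ?_
    rw [hdeg]
    have := h.card_thirds (mem_nbrs.1 p.2)
    split_ifs with hb
    · rw [this.1 hb]
    · rw [this.2 hb]
  rw [Finset.sum_add_distrib, hsum, Finset.sum_const, smul_eq_mul, Finset.card_univ] at h2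
  have h3 : ∑ p : nbrs K v, (if BdryEdge K v p then 1 else 0)
      = ((nbrs K v).filter (fun p => BdryEdge K v p)).card := by
    rw [Finset.card_filter]
    exact Finset.sum_coe_sort (nbrs K v) (fun p => if BdryEdge K v p then 1 else 0)
  rw [h3] at h2
  have h4 : 0 < ((nbrs K v).filter (fun p => BdryEdge K v p)).card :=
    Finset.card_pos.2 ⟨p₀, Finset.mem_filter.2 ⟨mem_nbrs.2 hp₀.adj, hp₀⟩⟩
  have h5 : Nat.card G.edgeSet = G.edgeFinset.card := by
    rw [Nat.card_eq_fintype_card, SimpleGraph.edgeFinset_card]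
  rw [h5, Nat.card_eq_fintype_card] at hE
  omega

theorem bdry_three (h : IsSurface K) {v p q r : V} (hp : BdryEdge K v p) (hq : BdryEdge K v q)
    (hr : BdryEdge K v r) : p = q ∨ p = r ∨ q = r := by
  classical
  by_contra! hc
  have : 2 < ((nbrs K v).filter (fun p => BdryEdge K v p)).card := by
    refine Finset.two_lt_card.2 ⟨p, ?_, q, ?_, r, ?_, hc.1, hc.2.1, hc.2.2⟩ <;>
      simp only [Finset.mem_filter, mem_nbrs]
    exacts [⟨hp.adj, hp⟩, ⟨hq.adj, hq⟩, ⟨hr.adj, hr⟩]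
  rw [h.card_bdry v hp.left] at this
  omega

theorem exists_bdry_ne (h : IsSurface K) {v : V} (hv : BdryVertex K v) (p : V) :
    ∃ q, BdryEdge K v q ∧ q ≠ p := by
  classical
  by_contra! hc
  have := h.card_bdry v hv
  have h2 : (nbrs K v).filter (fun p => BdryEdge K v p) ⊆ {p} := by
    intro q hq
    simp only [Finset.mem_filter] at hq
    simp [hc q hq.2]
  have := Finset.card_le_card h2
  simp at this
  omega

end IsSurface

/-- If the boundary contains a 3-cycle, it is that 3-cycle. -/
theorem IsPunctured.bdry_of_triangle (h : IsPunctured K) {a b c : V} (h1 : BdryEdge K a b)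
    (h2 : BdryEdge K b c) (h3 : BdryEdge K a c) {v : V} (hv : BdryVertex K v) :
    v = a ∨ v = b ∨ v = c := by
  have hs := h.toIsSurface
  -- At each of the three vertices both boundary edges already belong to the 3-cycle, so a walk
  -- along the boundary cannot leave it.
  have := h.bdry_connected a v h1.left hv
  induction this with
  | refl => simp
  | tail _ h5 ih =>
    have n1 := h1.1
    have n2 := h2.1
    have n3 := h3.1
    rcases ih h5.left with rfl | rfl | rfl
    · rcases hs.bdry_three h1 h3 h5 with h | h | h <;> simp_all
    · rcases hs.bdry_three h1.symm h2 h5 with h | h | h <;> simp_all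
    · rcases hs.bdry_three h2.symm h3.symm h5 with h | h | h <;> simp_all

/-! ### Contraction: faces, degrees and Euler characteristic. -/

theorem contract_pure (a b : V) : Pure3 (contract K a b) := by
  intro f hf
  simp only [contract, Finset.mem_filter] at hf
  exact hf.2

/-- A face of the contraction has three distinct vertices, hence so has its preimage, and only `b`
is renamed; so at most one of the three positions changes. Later arguments use this description
instead of images of finsets. -/
theorem tri_contract_iff (hK : Pure3 K) {a b : V} (hab : a ≠ b) {u v w : V} :
    Tri (contract K a b) u v w ↔ u ≠ b ∧ v ≠ b ∧ w ≠ b ∧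
      (Tri K u v w ∨ (u = a ∧ v ≠ a ∧ w ≠ a ∧ Tri K b v w) ∨
        (v = a ∧ u ≠ a ∧ w ≠ a ∧ Tri K u b w) ∨ (w = a ∧ u ≠ a ∧ v ≠ a ∧ Tri K u v b)) := by
  constructor
  · intro h
    have hne := h.ne (contract_pure a b)
    have hmem : ({u, v, w} : Finset V) ∈ contract K a b := h
    simp only [contract, Finset.mem_filter, Finset.mem_image] at hmem
    obtain ⟨⟨f, hf, hfi⟩, -⟩ := hmem
    have hb : ∀ x ∈ ({u, v, w} : Finset V), x ≠ b := by
      intro x hx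
      rw [← hfi, Finset.mem_image] at hx
      obtain ⟨y, -, rfl⟩ := hx
      split_ifs with h
      exacts [hab, h]
    have lift : ∀ x ∈ ({u, v, w} : Finset V), ∃ y ∈ f, (if y = b then a else y) = x := by
      intro x hx
      rw [← hfi, Finset.mem_image] at hx
      exact hx
    obtain ⟨u', hu', hu⟩ := lift u (by simp)
    obtain ⟨v', hv', hv⟩ := lift v (by simp)
    obtain ⟨w', hw', hw⟩ := lift w (by simp)
    have hfe : f = {u', v', w'} := by
      symm
      apply Finset.eq_of_subset_of_card_le
      · intro x hx
        simp only [Finset.mem_insert, Finset.mem_singleton] at hx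
        rcases hx with rfl | rfl | rfl <;> assumption
      · rw [hK f hf, Finset.card_eq_three.2 ⟨u', v', w', ?_, ?_, ?_, rfl⟩]
        · rintro rfl; exact hne.1 (hu.symm.trans hv)
        · rintro rfl; exact hne.2.1 (hu.symm.trans hw)
        · rintro rfl; exact hne.2.2 (hv.symm.trans hw)
    have ht : Tri K u' v' w' := by unfold Tri; rwa [← hfe]
    refine ⟨hb u (by simp), hb v (by simp), hb w (by simp), ?_⟩
    clear hfe hfi hu' hv' hw' hf lift h
    have hb1 := hb u (by simp)
    have hb2 := hb v (by simp)
    have hb3 := hb w (by simp)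
    split_ifs at hu hv hw <;> subst_vars <;> simp_all
    · exact Or.inr ⟨Ne.symm hne.1, Ne.symm hne.2.1⟩
    · exact Or.inr (Ne.symm hne.2.2)
  · rintro ⟨hu, hv, hw, h⟩
    have key : ∀ u' v' w', Tri K u' v' w' → u ≠ v → u ≠ w → v ≠ w →
        (if u' = b then a else u') = u → (if v' = b then a else v') = v →
        (if w' = b then a else w') = w → Tri (contract K a b) u v w := by
      intro u' v' w' ht h1 h2 h3 hu hv hw
      unfold Tri
      simp only [contract, Finset.mem_filter, Finset.mem_image]
      refine ⟨⟨{u', v', w'}, ht, ?_⟩, Finset.card_eq_three.2 ⟨u, v, w, h1, h2, h3, rfl⟩⟩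
      simp only [Finset.image_insert, Finset.image_singleton, hu, hv, hw]
    rcases h with h | ⟨rfl, h1, h2, h⟩ | ⟨rfl, h1, h2, h⟩ | ⟨rfl, h1, h2, h⟩ <;>
      have n := h.ne hK
    · exact key u v w h n.1 n.2.1 n.2.2 (by simp [hu]) (by simp [hv]) (by simp [hw])
    · exact key b v w h h1.symm h2.symm n.2.2 (by simp) (by simp [hv]) (by simp [hw])
    · exact key u b w h h1 n.2.1 h2.symm (by simp [hu]) (by simp) (by simp [hw])
    · exact key u v b h n.1 h1 h2 (by simp [hu]) (by simp [hv]) (by simp)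

/-- The edge `ab` satisfies the link condition for contraction, apart from the requirement that an
inner edge must not join two boundary vertices. -/
structure LinkCond (K : Finset (Finset V)) (a b : V) : Prop where
  punctured : IsPunctured K
  adj : Adj K a b
  common : ∀ c, Adj K a c → Adj K b c → Tri K a b c
  deg_ge : ∀ v ∈ verts K, 3 ≤ deg K v
  deg_end : 4 ≤ deg K a ∨ 4 ≤ deg K b

namespace LinkCond

variable {a b : V}

theorem surf (h : LinkCond K a b) : IsSurface K := h.punctured.toIsSurface

theorem pure (h : LinkCond K a b) : Pure3 K := h.surf.pure

theorem symm (h : LinkCond K a b) : LinkCond K b a :=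
  ⟨h.punctured, h.adj.symm, fun c h1 h2 => (h.common c h2 h1).swap, h.deg_ge, h.deg_end.symm⟩

/-- By the link condition `abp` and `abq` would be faces too. Then `b, p, q` form a triangle in the
link of `a` and `a, p, q` one in the link of `b`, so both ends have degree at most 3. This is where
`deg_end` is needed; the statement says that contraction identifies no two surviving faces. -/
theorem not_tri (h : LinkCond K a b) {p q : V} (h1 : Tri K a p q) (h2 : Tri K b p q) : False := by
  have a1 := h1.adj h.pure
  have a2 := h2.adj h.pure
  have t1 := h.common p a1.1 a2.1
  have t2 := h.common q a1.2.1 a2.2.1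
  have := h.surf.deg_le_three t1 h1 t2
  have := h.surf.deg_le_three t1.swap h2 t2.swap
  have := h.deg_end
  omega

theorem not_bdry_bdry (h : LinkCond K a b) {c : V} (ht : Tri K a b c) (h1 : BdryEdge K a c)
    (h2 : BdryEdge K b c) : False := by
  have := h.surf.deg_le_two h1.symm h2.symm ht.rot.rot
  have := h.deg_ge c h1.adj.mem_verts_right
  omega

/-- When `abc` collapses, the edge from the merged vertex to `c` survives because `ac` and `bc` are
not both boundary edges: otherwise `c` would have degree 2. -/
theorem exists_outer (h : LinkCond K a b) {c : V} (ht : Tri K a b c) :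
    ∃ d, d ≠ a ∧ d ≠ b ∧ (Tri K a c d ∨ Tri K b c d) := by
  by_cases h1 : BdryEdge K a c
  · have h2 : ¬ BdryEdge K b c := fun h2 => h.not_bdry_bdry ht h1 h2
    obtain ⟨d, hd, hda⟩ := exists_other h.pure ht.rot h2
    exact ⟨d, hda, (hd.ne h.pure).2.1.symm, Or.inr hd⟩
  · obtain ⟨d, hd, hdb⟩ := exists_other h.pure ht.swap' h1
    exact ⟨d, (hd.ne h.pure).2.1.symm, hdb, Or.inl hd⟩

theorem tri_left (h : LinkCond K a b) {v w : V} (hv : v ≠ a) (hv' : v ≠ b) (hw : w ≠ a)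
    (hw' : w ≠ b) : Tri (contract K a b) a v w ↔ Tri K a v w ∨ Tri K b v w := by
  rw [tri_contract_iff h.pure h.adj.1]
  have := h.adj.1
  simp [*]

theorem tri_old (h : LinkCond K a b) {u v w : V} (hu : u ≠ a) (hu' : u ≠ b) (hv : v ≠ a)
    (hv' : v ≠ b) (hw : w ≠ a) (hw' : w ≠ b) : Tri (contract K a b) u v w ↔ Tri K u v w := by
  rw [tri_contract_iff h.pure h.adj.1]
  simp [*]

theorem tri_ne (h : LinkCond K a b) {u v w : V} (ht : Tri (contract K a b) u v w) :
    u ≠ b ∧ v ≠ b ∧ w ≠ b := by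
  rw [tri_contract_iff h.pure h.adj.1] at ht
  tauto

theorem adj_old (h : LinkCond K a b) {u v : V} (hu : u ≠ a) (hu' : u ≠ b) (hv : v ≠ a)
    (hv' : v ≠ b) : Adj (contract K a b) u v ↔ Adj K u v := by
  rw [adj_iff h.pure, adj_iff (contract_pure a b)]
  constructor
  · rintro ⟨w, hw⟩
    by_cases hwa : w = a
    · subst hwa
      rcases (h.tri_left hu hu' hv hv').1 hw.rot.rot with h | h
      exacts [⟨_, h.rot⟩, ⟨_, h.rot⟩]
    · exact ⟨w, (h.tri_old hu hu' hv hv' hwa (h.tri_ne hw).2.2).1 hw⟩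
  · rintro ⟨w, hw⟩
    by_cases hwa : w = a
    · subst hwa
      exact ⟨w, ((h.tri_left hu hu' hv hv').2 (Or.inl hw.rot.rot)).rot⟩
    · by_cases hwb : w = b
      · subst hwb
        exact ⟨a, ((h.tri_left hu hu' hv hv').2 (Or.inr hw.rot.rot)).rot⟩
      · exact ⟨w, (h.tri_old hu hu' hv hv' hwa hwb).2 hw⟩

theorem adj_left (h : LinkCond K a b) {v : V} (hv : v ≠ a) (hv' : v ≠ b) :
    Adj (contract K a b) a v ↔ Adj K a v ∨ Adj K b v := by
  rw [adj_iff h.pure, adj_iff h.pure, adj_iff (contract_pure a b)]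
  constructor
  · rintro ⟨w, hw⟩
    have hwa : w ≠ a := (hw.ne (contract_pure a b)).2.1.symm
    rcases (h.tri_left hv hv' hwa (h.tri_ne hw).2.2).1 hw with h | h
    exacts [Or.inl ⟨_, h⟩, Or.inr ⟨_, h⟩]
  · have key : Tri K a b v → ∃ w, Tri (contract K a b) a v w := by
      intro ht
      obtain ⟨d, hda, hdb, hd⟩ := h.exists_outer ht
      exact ⟨d, (h.tri_left hv hv' hda hdb).2 hd⟩
    rintro (⟨w, hw⟩ | ⟨w, hw⟩)
    · by_cases hwb : w = b
      · subst hwb; exact key hw.swap'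
      · exact ⟨w, (h.tri_left hv hv' (hw.ne h.pure).2.1.symm hwb).2 (Or.inl hw)⟩
    · by_cases hwa : w = a
      · subst hwa; exact key hw.rot.rot
      · exact ⟨w, (h.tri_left hv hv' hwa (hw.ne h.pure).2.1.symm).2 (Or.inr hw)⟩

theorem adj_ne (h : LinkCond K a b) {u v : V} (ht : Adj (contract K a b) u v) : u ≠ b ∧ v ≠ b := by
  obtain ⟨w, hw⟩ := (adj_iff (contract_pure a b)).1 ht
  exact ⟨(h.tri_ne hw).1, (h.tri_ne hw).2.1⟩

/-- Renaming `b` to `a` is a bijection between the third vertices at `uv` before and after;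
injectivity is `not_tri`. -/
theorem bdryEdge_old (h : LinkCond K a b) {u v : V} (hu : u ≠ a) (hu' : u ≠ b) (hv : v ≠ a)
    (hv' : v ≠ b) : BdryEdge (contract K a b) u v ↔ BdryEdge K u v := by
  have tl := h.tri_left hu hu' hv hv'
  have key : ∀ w, Tri K u v w → Tri (contract K a b) u v (if w = b then a else w) := by
    intro w hw
    split_ifs with hwb
    · subst hwb; exact (tl.2 (Or.inr hw.rot.rot)).rot
    · by_cases hwa : w = a
      · subst hwa; exact (tl.2 (Or.inl hw.rot.rot)).rot
      · exact (h.tri_old hu hu' hv hv' hwa hwb).2 hw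
  have key' : ∀ w, Tri (contract K a b) u v w → ∃ w', Tri K u v w' ∧ (if w' = b then a else w') = w := by
    intro w hw
    by_cases hwa : w = a
    · subst hwa
      rcases tl.1 hw.rot.rot with h1 | h1
      exacts [⟨w, h1.rot, by simp [h.adj.1]⟩, ⟨b, h1.rot, by simp⟩]
    · have hwb := (h.tri_ne hw).2.2
      exact ⟨w, (h.tri_old hu hu' hv hv' hwa hwb).1 hw, by simp [hwb]⟩
  rw [bdryEdge_iff h.pure, bdryEdge_iff (contract_pure a b)]
  constructor
  · rintro ⟨w, hw, hu⟩
    obtain ⟨w', hw', rfl⟩ := key' w hw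
    refine ⟨w', hw', fun x hx => ?_⟩
    have := hu _ (key x hx)
    have nt := @not_tri _ _ _ _ _ h u v
    split_ifs at this <;> subst_vars
    · rfl
    · exact absurd hx.rot.rot (fun hb => nt hw'.rot.rot hb)
    · exact absurd hw'.rot.rot (fun hb => nt hx.rot.rot hb)
    · rfl
  · rintro ⟨w, hw, hu⟩
    refine ⟨_, key w hw, fun x hx => ?_⟩
    obtain ⟨x', hx', rfl⟩ := key' x hx
    rw [hu x' hx']

/-- If only one of `a`, `b` is adjacent to `v`, nothing changes at that edge. If both are, `abv` is
a face and collapses, and at most one face remains on each of `av` and `bv`; the merged edge is on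
the boundary exactly when one of these is missing. -/
theorem bdryEdge_left (h : LinkCond K a b) {v : V} (hv : v ≠ a) (hv' : v ≠ b) :
    BdryEdge (contract K a b) a v ↔ BdryEdge K a v ∨ BdryEdge K b v := by
  have tl : ∀ w, Tri (contract K a b) a v w ↔ w ≠ a ∧ w ≠ b ∧ (Tri K a v w ∨ Tri K b v w) := by
    intro w
    constructor
    · intro hw
      have h1 := (hw.ne (contract_pure a b)).2.1.symm
      have h2 := (h.tri_ne hw).2.2
      exact ⟨h1, h2, (h.tri_left hv hv' h1 h2).1 hw⟩
    · rintro ⟨h1, h2, h3⟩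
      exact (h.tri_left hv hv' h1 h2).2 h3
  have nt := fun w => @not_tri _ _ _ _ _ h v w
  have tw : ∀ w, Tri K a v w → w ≠ a := fun w hw => (hw.ne h.pure).2.1.symm
  have tw' : ∀ w, Tri K b v w → w ≠ b := fun w hw => (hw.ne h.pure).2.1.symm
  have tb : Tri K a v b ↔ Tri K b v a := ⟨fun h => h.rot.rot.swap', fun h => h.rot.rot.swap'⟩
  have hc : ∀ w w', Tri K a v w → Tri K b v w' → Tri K a v b := fun w w' h1 h2 =>
    (h.common v (h1.adj h.pure).1 (h2.adj h.pure).1).swap'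
  have r1 := fun x y z => @IsSurface.two_thirds _ _ _ h.surf a v x y z
  have r2 := fun x y z => @IsSurface.two_thirds _ _ _ h.surf b v x y z
  have ho : Tri K a v b → ∃ d, d ≠ a ∧ d ≠ b ∧ (Tri K a v d ∨ Tri K b v d) :=
    fun ht => h.exists_outer ht.swap'
  have nb : Tri K a v b → BdryEdge K a v → BdryEdge K b v → False :=
    fun ht => h.not_bdry_bdry ht.swap'
  rw [bdryEdge_iff h.pure, bdryEdge_iff h.pure] at *
  rw [bdryEdge_iff (contract_pure a b)]
  simp only [tl]
  have hab := h.adj.1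
  clear tl
  -- Only the two sets of third vertices at `av` and `bv` matter now, each of size at most two.
  generalize Tri K a v = A at *
  generalize Tri K b v = B at *
  constructor
  · rintro ⟨w, ⟨h1, h2, h3⟩, h4⟩
    grind
  · grind

end LinkCond

instance (u v w : V) : Decidable (Tri K u v w) := inferInstanceAs (Decidable (_ ∈ K))

theorem mem_verts_iff_adj (hK : Pure3 K) {v : V} : v ∈ verts K ↔ ∃ w, Adj K v w := by
  constructor
  · intro hv
    obtain ⟨p, q, h⟩ := exists_tri_of_mem_verts hK hv
    exact ⟨p, (h.adj hK).1⟩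
  · rintro ⟨w, hw⟩
    exact hw.mem_verts_left

namespace LinkCond

variable {a b : V}

theorem exists_adj_ne (h : LinkCond K a b) : ∃ v, v ≠ a ∧ v ≠ b ∧ Adj K a v := by
  obtain ⟨w, hw⟩ := (adj_iff h.pure).1 h.adj
  have := hw.ne h.pure
  exact ⟨w, this.2.1.symm, this.2.2.symm, (hw.adj h.pure).2.1⟩

theorem verts_contract (h : LinkCond K a b) : verts (contract K a b) = (verts K).erase b := by
  ext v
  rw [Finset.mem_erase, mem_verts_iff_adj (contract_pure a b), mem_verts_iff_adj h.pure]
  by_cases hvb : v = b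
  · subst hvb
    simp only [ne_eq, not_true_eq_false, false_and, iff_false, not_exists]
    intro w hw
    exact (h.adj_ne hw).1 rfl
  by_cases hva : v = a
  · subst hva
    obtain ⟨w, h1, h2, h3⟩ := h.exists_adj_ne
    exact ⟨fun _ => ⟨hvb, w, h3⟩, fun _ => ⟨w, (h.adj_left h1 h2).2 (Or.inl h3)⟩⟩
  constructor
  · rintro ⟨w, hw⟩
    refine ⟨hvb, ?_⟩
    by_cases hwa : w = a
    · subst hwa
      rcases (h.adj_left hva hvb).1 hw.symm with h | h
      exacts [⟨_, h.symm⟩, ⟨_, h.symm⟩]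
    · exact ⟨w, (h.adj_old hva hvb hwa (h.adj_ne hw).2).1 hw⟩
  · rintro ⟨-, w, hw⟩
    by_cases hwa : w = a
    · subst hwa
      exact ⟨w, ((h.adj_left hva hvb).2 (Or.inl hw.symm)).symm⟩
    by_cases hwb : w = b
    · subst hwb
      exact ⟨a, ((h.adj_left hva hvb).2 (Or.inr hw.symm)).symm⟩
    · exact ⟨w, (h.adj_old hva hvb hwa hwb).2 hw⟩

theorem card_verts (h : LinkCond K a b) :
    (verts (contract K a b)).card + 1 = (verts K).card := by
  rw [h.verts_contract, Finset.card_erase_add_one h.adj.mem_verts_right]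

theorem mem_nbrs_old (h : LinkCond K a b) {v w : V} (hv : v ≠ a) (hv' : v ≠ b) :
    w ∈ nbrs (contract K a b) v ↔
      w ≠ b ∧ (w ∈ nbrs K v ∨ (w = a ∧ b ∈ nbrs K v)) := by
  simp only [mem_nbrs]
  by_cases hwb : w = b
  · subst hwb
    simp only [ne_eq, not_true_eq_false, false_and, iff_false]
    exact fun hw => (h.adj_ne hw).2 rfl
  by_cases hwa : w = a
  · subst hwa
    rw [adj_comm, h.adj_left hv hv']
    have := h.adj.1
    simp only [adj_comm (u := v)]
    simp [this]
  · rw [h.adj_old hv hv' hwa hwb]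
    simp [hwa, hwb]

theorem deg_of_tri (h : LinkCond K a b) {v : V} (ht : Tri K a b v) :
    deg (contract K a b) v + 1 = deg K v := by
  have hn := ht.ne h.pure
  have ha := ht.adj h.pure
  have : nbrs (contract K a b) v = (nbrs K v).erase b := by
    ext w
    rw [h.mem_nbrs_old hn.2.1.symm hn.2.2.symm, Finset.mem_erase]
    have : a ∈ nbrs K v := mem_nbrs.2 ha.2.1.symm
    constructor
    · rintro ⟨h1, h2 | ⟨rfl, -⟩⟩
      exacts [⟨h1, h2⟩, ⟨h1, this⟩]
    · rintro ⟨h1, h2⟩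
      exact ⟨h1, Or.inl h2⟩
  rw [deg_eq_card_nbrs, deg_eq_card_nbrs, this,
    Finset.card_erase_add_one (mem_nbrs.2 ha.2.2.symm)]

/-- By the link condition `v` is not adjacent to both ends, so a neighbour `b` is merely replaced by
the new neighbour `a`. -/
theorem deg_of_not_tri (h : LinkCond K a b) {v : V} (hv : v ≠ a) (hv' : v ≠ b)
    (ht : ¬ Tri K a b v) : deg (contract K a b) v = deg K v := by
  rw [deg_eq_card_nbrs, deg_eq_card_nbrs]
  by_cases hb : b ∈ nbrs K v
  · have ha : a ∉ nbrs K v := fun ha =>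
      ht (h.common v (mem_nbrs.1 ha).symm (mem_nbrs.1 hb).symm)
    have : nbrs (contract K a b) v = insert a ((nbrs K v).erase b) := by
      ext w
      rw [h.mem_nbrs_old hv hv', Finset.mem_insert, Finset.mem_erase]
      have := h.adj.1
      constructor
      · tauto
      · rintro (rfl | h1) <;> tauto
    rw [this, Finset.card_insert_of_notMem (by simp [ha]), Finset.card_erase_add_one hb]
  · congr 1
    ext w
    rw [h.mem_nbrs_old hv hv']
    constructor
    · tauto
    · intro hw
      exact ⟨fun hwb => hb (hwb ▸ hw), Or.inl hw⟩

/-- Inclusion–exclusion for the two neighbourhoods without the opposite ends; by the link condition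
they overlap precisely in the third vertices at `ab`. -/
theorem deg_left (h : LinkCond K a b) :
    deg (contract K a b) a + 2 + (thirds K a b).card = deg K a + deg K b := by
  have h1 : nbrs (contract K a b) a = (nbrs K a).erase b ∪ (nbrs K b).erase a := by
    ext w
    simp only [Finset.mem_union, Finset.mem_erase, mem_nbrs]
    by_cases hwb : w = b
    · subst hwb
      constructor
      · exact fun hw => absurd rfl (h.adj_ne hw).2
      · rintro (h | h)
        · exact absurd rfl h.1
        · exact absurd rfl h.2.1
    by_cases hwa : w = a
    · subst hwa
      constructor
      · exact fun hw => absurd rfl hw.1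
      · rintro (h | h)
        · exact absurd rfl h.2.1
        · exact absurd rfl h.1
    rw [h.adj_left hwa hwb]
    simp [hwa, hwb]
  have h2 : (nbrs K a).erase b ∩ (nbrs K b).erase a = thirds K a b := by
    ext w
    simp only [Finset.mem_inter, Finset.mem_erase, mem_nbrs, mem_thirds]
    constructor
    · rintro ⟨⟨-, h1⟩, -, h2⟩
      exact h.common w h1 h2
    · intro ht
      have := ht.ne h.pure
      have h3 := ht.adj h.pure
      exact ⟨⟨this.2.2.symm, h3.2.1⟩, this.2.1.symm, h3.2.2⟩
  have h3 := Finset.card_union_add_card_inter ((nbrs K a).erase b) ((nbrs K b).erase a)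
  have h4 := Finset.card_erase_add_one (mem_nbrs.2 h.adj)
  have h5 := Finset.card_erase_add_one (mem_nbrs.2 h.adj.symm)
  rw [← h1, h2] at h3
  simp only [deg_eq_card_nbrs]
  omega

theorem card_thirds_le (h : LinkCond K a b) : (thirds K a b).card ≤ 2 := by
  rw [← card_facesAt h.pure h.adj.1]
  exact h.surf.edge_le_two a b h.adj.1

/-- Exactly the faces at `ab` disappear. Two other faces with the same image would have to be of the
form `apq` and `bpq`, which `not_tri` excludes. -/
theorem card_contract (h : LinkCond K a b) :
    (contract K a b).card + (thirds K a b).card = K.card := by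
  set r : V → V := fun v => if v = b then a else v with hr
  have hab := h.adj.1
  have h1 : contract K a b = (K.filter (fun f => ¬ (a ∈ f ∧ b ∈ f))).image (Finset.image r) := by
    ext g
    simp only [contract, Finset.mem_filter, Finset.mem_image]
    constructor
    · rintro ⟨⟨f, hf, rfl⟩, hg⟩
      refine ⟨f, ⟨hf, ?_⟩, rfl⟩
      rintro ⟨ha, hb⟩
      have hinj : Set.InjOn r f := by
        rw [← Finset.card_image_iff, h.pure f hf]
        exact hg
      exact hab (hinj ha hb (by simp [hr]))
    · rintro ⟨f, ⟨hf, hn⟩, rfl⟩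
      refine ⟨⟨f, hf, rfl⟩, ?_⟩
      rw [← h.pure f hf]
      refine Finset.card_image_of_injOn fun x hx y hy hxy => ?_
      simp only [hr] at hxy
      simp only [Finset.mem_coe] at hx hy
      split_ifs at hxy with h1 h2 h2 <;> subst_vars <;> tauto
  have h2 : Set.InjOn (Finset.image r) (K.filter (fun f => ¬ (a ∈ f ∧ b ∈ f)) : Finset _) := by
    have key : ∀ f ∈ K, ∀ g ∈ K, ¬ (a ∈ f ∧ b ∈ f) → ¬ (a ∈ g ∧ b ∈ g) →
        f.image r = g.image r → b ∈ f → b ∉ g → False := by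
      intro f hf g hg hf1 hg1 hfg hbf hbg
      have hag : a ∈ g := by
        have : a ∈ f.image r := Finset.mem_image.2 ⟨b, hbf, by simp [hr]⟩
        rw [hfg] at this
        obtain ⟨y, hy, hya⟩ := Finset.mem_image.1 this
        simp only [hr] at hya
        split_ifs at hya with hyb
        · exact absurd (hyb ▸ hy) hbg
        · rwa [hya] at hy
      have hgr : g.image r = g := by
        ext x
        rw [Finset.mem_image]
        constructor
        · rintro ⟨y, hy, rfl⟩
          have : y ≠ b := fun hyb => hbg (hyb ▸ hy)
          simpa [hr, this] using hy
        · intro hx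
          have : x ≠ b := fun hyb => hbg (hyb ▸ hx)
          exact ⟨x, hx, by simp [hr, this]⟩
      obtain ⟨p, q, hpq⟩ : ∃ p q, g = {a, p, q} := by
        obtain ⟨x, hx⟩ : ∃ x, x ∈ g.erase a := by
          rw [← Finset.Nonempty, ← Finset.card_pos, Finset.card_erase_of_mem hag, h.pure g hg]
          norm_num
        obtain ⟨hxa, hxg⟩ := Finset.mem_erase.1 hx
        obtain ⟨w, hw⟩ := exists_third h.pure hg (Ne.symm hxa) hag hxg
        exact ⟨x, w, hw⟩
      have ht : Tri K a p q := by unfold Tri; rwa [← hpq]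
      have hn := ht.ne h.pure
      have lift : ∀ x, x ∈ g → x ≠ a → x ∈ f := by
        intro x hx hxa
        rw [← hgr, ← hfg] at hx
        obtain ⟨y, hy, hyx⟩ := Finset.mem_image.1 hx
        simp only [hr] at hyx
        split_ifs at hyx with hyb
        · exact absurd hyx.symm hxa
        · rwa [← hyx]
      have hpf := lift p (by simp [hpq]) hn.1.symm
      have hqf := lift q (by simp [hpq]) hn.2.1.symm
      have hbp : b ≠ p := fun hbp => hbg (by simp [hpq, hbp])
      have hbq : b ≠ q := fun hbp => hbg (by simp [hpq, hbp])
      have : f = {b, p, q} := by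
        symm
        apply Finset.eq_of_subset_of_card_le
        · intro x hx
          simp only [Finset.mem_insert, Finset.mem_singleton] at hx
          rcases hx with rfl | rfl | rfl <;> assumption
        · rw [h.pure f hf, Finset.card_eq_three.2 ⟨b, p, q, hbp, hbq, hn.2.2, rfl⟩]
      exact h.not_tri ht (show ({b, p, q} : Finset V) ∈ K by rwa [← this])
    have same : ∀ f g : Finset V, f.image r = g.image r → (b ∈ f ↔ b ∈ g) →
        ¬ (a ∈ f ∧ b ∈ f) → ∀ x, x ∈ f → x ∈ g := by
      intro f g hfg hb hn x hx
      by_cases hxb : x = b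
      · subst hxb; exact hb.1 hx
      have : x ∈ g.image r := by
        rw [← hfg, Finset.mem_image]
        exact ⟨x, hx, by simp [hr, hxb]⟩
      obtain ⟨y, hy, hyx⟩ := Finset.mem_image.1 this
      simp only [hr] at hyx
      split_ifs at hyx with hyb
      · subst hyb; subst hyx; exact absurd ⟨hx, hb.2 hy⟩ hn
      · rwa [← hyx]
    intro f hf g hg hfg
    simp only [Finset.coe_filter, Set.mem_ofPred_eq] at hf hg
    have hb : b ∈ f ↔ b ∈ g := by
      constructor
      · intro hb; by_contra hb'
        exact key f hf.1 g hg.1 hf.2 hg.2 hfg hb hb'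
      · intro hb; by_contra hb'
        exact key g hg.1 f hf.1 hg.2 hf.2 hfg.symm hb hb'
    ext x
    exact ⟨same f g hfg hb hf.2 x, same g f hfg.symm hb.symm hg.2 x⟩
  rw [h1, Finset.card_image_of_injOn h2, ← card_facesAt h.pure hab, facesAt, add_comm]
  exact Finset.card_filter_add_card_filter_not _

/-- Let t be the number of faces at `ab`. One vertex and t faces are lost. The degree sum drops by t
at the opposite vertices and by 2 + t at the merged vertex, so 1 + t edges are lost, and the
alternating sum is unchanged. -/
theorem eulerChar_contract (h : LinkCond K a b) : eulerChar K = eulerChar (contract K a b) := by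
  have hV := h.card_verts
  have hF := h.card_contract
  have hE := sum_deg (K := K)
  have hE' := sum_deg (K := contract K a b)
  have hab := h.adj.1
  have ha : a ∈ (verts K).erase b := Finset.mem_erase.2 ⟨hab, h.adj.mem_verts_left⟩
  set S := ((verts K).erase b).erase a with hS
  have hS' : ∀ v ∈ S, v ≠ a ∧ v ≠ b := by
    intro v hv
    simp only [hS, Finset.mem_erase] at hv
    exact ⟨hv.1, hv.2.1⟩
  rw [h.verts_contract, ← Finset.add_sum_erase _ _ ha] at hE'
  rw [← Finset.add_sum_erase _ _ h.adj.mem_verts_right, ← Finset.add_sum_erase _ _ ha] at hE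
  have h1 : ∑ v ∈ S, (deg (contract K a b) v + if Tri K a b v then 1 else 0)
      = ∑ v ∈ S, deg K v := by
    refine Finset.sum_congr rfl fun v hv => ?_
    split_ifs with ht
    · exact h.deg_of_tri ht
    · exact h.deg_of_not_tri (hS' v hv).1 (hS' v hv).2 ht
  rw [Finset.sum_add_distrib, ← Finset.card_filter] at h1
  have h2 : S.filter (fun v => Tri K a b v) = thirds K a b := by
    ext v
    simp only [Finset.mem_filter, mem_thirds, hS, Finset.mem_erase, and_iff_right_iff_imp]
    intro ht
    have := ht.ne h.pure
    exact ⟨this.2.1.symm, this.2.2.symm, (ht.adj h.pure).2.1.mem_verts_right⟩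
  rw [h2] at h1
  have h3 := h.deg_left
  unfold eulerChar
  change _ + ∑ v ∈ S, _ = _ at hE'
  change _ + (_ + ∑ v ∈ S, _) = _ at hE
  omega

end LinkCond

/-! ### Contraction: the result is again a punctured surface. -/

/-- The parity form of the handshake lemma for the graph induced on a finite set. It is used to show
that a vertex of odd degree is not alone in its component. -/
theorem even_sum_card_filter {α : Type*} [DecidableEq α] (r : α → α → Prop) [DecidableRel r]
    (hs : ∀ x y, r x y → r y x) (hi : ∀ x, ¬ r x x) (C : Finset α) :
    Even (∑ p ∈ C, (C.filter (r p)).card) := by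
  induction C using Finset.induction_on with
  | empty => simp
  | insert x C hx ih =>
    rw [Finset.sum_insert hx]
    have h1 : ∀ p ∈ C, ((insert x C).filter (r p)).card
        = (C.filter (r p)).card + if r x p then 1 else 0 := by
      intro p hp
      rw [Finset.filter_insert]
      by_cases h : r p x
      · rw [if_pos h, if_pos (hs _ _ h), Finset.card_insert_of_notMem (by simp [hx])]
      · rw [if_neg h, if_neg fun h' => h (hs _ _ h'), add_zero]
    rw [Finset.sum_congr rfl h1, Finset.sum_add_distrib, ← Finset.card_filter,
      Finset.filter_insert, if_neg (hi x)]
    obtain ⟨k, hk⟩ := ih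
    have h2 : ∑ p ∈ C, (C.filter (r p)).card = k + k := hk
    refine ⟨k + (C.filter (r x)).card, ?_⟩
    rw [h2]
    ring

namespace LinkCond

variable {a b : V}

/-- Adjacency in the link of the vertex that arises from the contraction of `ab`. -/
def MergedLink (K : Finset (Finset V)) (a b p q : V) : Prop :=
  p ≠ a ∧ p ≠ b ∧ q ≠ a ∧ q ≠ b ∧ (Tri K a p q ∨ Tri K b p q)

theorem mergedLink_swap {p q : V} : MergedLink K a b p q ↔ MergedLink K b a p q := by
  unfold MergedLink; tauto

theorem mergedLink_symm {p q : V} (h : MergedLink K a b p q) : MergedLink K a b q p := by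
  obtain ⟨h1, h2, h3, h4, h5⟩ := h
  exact ⟨h3, h4, h1, h2, h5.imp Tri.swap' Tri.swap'⟩

theorem reach_symm {p q : V} (h : Relation.ReflTransGen (MergedLink K a b) p q) :
    Relation.ReflTransGen (MergedLink K a b) q p := by
  induction h with
  | refl => exact .refl
  | tail _ h2 ih => exact .head (mergedLink_symm h2) ih

/-- A walk in the link of `a` from `p` to `b` reaches a third vertex of `ab` just before it first
meets `b`. -/
theorem reach_third (h : LinkCond K a b) {p : V} (hp : Adj K a p) (hpb : p ≠ b) :
    ∃ c, Tri K a b c ∧ Relation.ReflTransGen (MergedLink K a b) p c := by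
  have := h.surf.nbrs_of_closed (P := fun q => q = b ∨
    ∃ c, Tri K a b c ∧ Relation.ReflTransGen (MergedLink K a b) q c) h.adj (Or.inl rfl) (by
      intro p q hp hpq
      by_cases hqb : q = b
      · exact Or.inl hqb
      refine Or.inr ?_
      by_cases hpb : p = b
      · subst hpb
        exact ⟨q, hpq, .refl⟩
      · obtain ⟨c, hc, hr⟩ := hp.resolve_left hpb
        have hn := hpq.ne h.pure
        exact ⟨c, hc, .head ⟨hn.2.1.symm, hqb, hn.1.symm, hpb, Or.inl hpq.swap'⟩ hr⟩) p hp
  exact this.resolve_left hpb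

/-- The link of `a` is a cycle through `c, b, d`; without `b` it is a path from `c` to `d`. This is
obtained by parity: if `d` were not reached from `c`, all vertices reached in the link of `a`
without `b` would have degree 2 except `c`, which has degree 1, and the degree sum would be odd. -/
theorem reach_of_inner (h : LinkCond K a b) (ha : ¬ BdryVertex K a) {c d : V} (hc : Tri K a b c)
    (hd : Tri K a b d) (hcd : c ≠ d) : Relation.ReflTransGen (MergedLink K a b) c d := by
  classical
  by_contra hn
  set C := (nbrs K a).filter
    (fun p => p ≠ b ∧ Relation.ReflTransGen (MergedLink K a b) c p) with hC
  have hcC : c ∈ C := by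
    simp only [hC, Finset.mem_filter, mem_nbrs]
    exact ⟨(hc.adj h.pure).2.1, (hc.ne h.pure).2.2.symm, .refl⟩
  have hdC : d ∉ C := by
    simp only [hC, Finset.mem_filter]
    exact fun h => hn h.2.2
  have h1 : ∀ p ∈ C, C.filter (Tri K a p) = (thirds K a p).erase b := by
    intro p hp
    simp only [hC, Finset.mem_filter] at hp
    ext q
    simp only [hC, Finset.mem_filter, Finset.mem_erase, mem_thirds, mem_nbrs]
    constructor
    · rintro ⟨⟨-, h1, -⟩, h2⟩
      exact ⟨h1, h2⟩
    · rintro ⟨hqb, ht⟩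
      have hne := ht.ne h.pure
      exact ⟨⟨(ht.adj h.pure).2.1, hqb, hp.2.2.tail
        ⟨hne.1.symm, hp.2.1, hne.2.1.symm, hqb, Or.inl ht⟩⟩, ht⟩
  have h2 : ∀ p ∈ C, (C.filter (Tri K a p)).card + (if p = c then 1 else 0) = 2 := by
    intro p hp
    rw [h1 p hp]
    have hpa : Adj K a p := by
      simp only [hC, Finset.mem_filter] at hp
      exact mem_nbrs.1 hp.1
    have h3 := (h.surf.card_thirds hpa).2 fun hb => ha hb.left
    split_ifs with hpc
    · subst hpc
      rw [Finset.card_erase_add_one (mem_thirds.2 hc.swap'), h3]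
    · rw [Finset.erase_eq_of_notMem, h3]
      intro hb
      rcases h.surf.two_thirds hc hd (mem_thirds.1 hb).swap' with h | h | h
      exacts [hcd h, hpc h.symm, hdC (h ▸ hp)]
  have h3 := Finset.sum_congr rfl h2
  rw [Finset.sum_add_distrib, Finset.sum_const, smul_eq_mul, Finset.sum_ite_eq' C c, if_pos hcC] at h3
  obtain ⟨k, hk⟩ := even_sum_card_filter (Tri K a) (fun _ _ => Tri.swap')
    (fun x hx => (hx.ne h.pure).2.2 rfl) C
  omega

theorem reach_thirds (h : LinkCond K a b)
    (hb : BdryEdge K a b ∨ ¬ BdryVertex K a ∨ ¬ BdryVertex K b) {c d : V} (hc : Tri K a b c)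
    (hd : Tri K a b d) : Relation.ReflTransGen (MergedLink K a b) c d := by
  by_cases hcd : c = d
  · subst hcd; exact .refl
  rcases hb with hb | hb | hb
  · exact absurd (hb.unique h.pure hc hd) hcd
  · exact h.reach_of_inner hb hc hd hcd
  · exact Relation.ReflTransGen.mono (fun _ _ => mergedLink_swap.2) _ _
      (h.symm.reach_of_inner hb hc.swap hd.swap hcd)

theorem merged_connected (h : LinkCond K a b)
    (hb : BdryEdge K a b ∨ ¬ BdryVertex K a ∨ ¬ BdryVertex K b) {p q : V}
    (hp : Adj K a p ∨ Adj K b p) (hpa : p ≠ a) (hpb : p ≠ b)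
    (hq : Adj K a q ∨ Adj K b q) (hqa : q ≠ a) (hqb : q ≠ b) :
    Relation.ReflTransGen (MergedLink K a b) p q := by
  have key : ∀ p, p ≠ a → p ≠ b → Adj K a p ∨ Adj K b p →
      ∃ c, Tri K a b c ∧ Relation.ReflTransGen (MergedLink K a b) p c := by
    rintro p hpa hpb (hp | hp)
    · exact h.reach_third hp hpb
    · obtain ⟨c, hc, hr⟩ := h.symm.reach_third hp hpa
      exact ⟨c, hc.swap, Relation.ReflTransGen.mono (fun _ _ => mergedLink_swap.2) _ _ hr⟩
  obtain ⟨c, hc, hpc⟩ := key p hpa hpb hp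
  obtain ⟨d, hd, hqd⟩ := key q hqa hqb hq
  exact (hpc.trans (h.reach_thirds hb hc hd)).trans (reach_symm hqd)

/-- The link of the merged vertex is glued from the links of `a` and `b`, and its connectedness is
`merged_connected`. Every other link is the image of the old one under renaming `b` to `a`, so walks
in it are carried over, a step between `a` and `b` becoming trivial. For the bound on faces at a
merged edge `av`, a common neighbour `v` gives the collapsing face `abv`, which uses up one of the
two places on each side. -/
theorem isSurface_contract (h : LinkCond K a b)
    (hb : BdryEdge K a b ∨ ¬ BdryVertex K a ∨ ¬ BdryVertex K b) : IsSurface (contract K a b) where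
  nonempty := by
    obtain ⟨v, h1, h2, h3⟩ := h.exists_adj_ne
    obtain ⟨w, hw⟩ := (adj_iff (contract_pure a b)).1 ((h.adj_left h1 h2).2 (Or.inl h3))
    exact ⟨_, hw⟩
  card_face := contract_pure a b
  edge_le_two := by
    rw [edge_le_two_iff (contract_pure a b)]
    have left : ∀ v x y z, Tri (contract K a b) a v x → Tri (contract K a b) a v y →
        Tri (contract K a b) a v z → x = y ∨ x = z ∨ y = z := by
      intro v x y z hx hy hz
      have hv := (hx.ne (contract_pure a b)).1.symm
      have hv' := (h.tri_ne hx).2.1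
      have tl : ∀ w, Tri (contract K a b) a v w → w ≠ b ∧ w ≠ a ∧ (Tri K a v w ∨ Tri K b v w) := by
        intro w hw
        have h1 := (h.tri_ne hw).2.2
        have h2 := (hw.ne (contract_pure a b)).2.1.symm
        exact ⟨h1, h2, (h.tri_left hv hv' h2 h1).1 hw⟩
      have r1 := fun x y z => @IsSurface.two_thirds _ _ _ h.surf a v x y z
      have r2 := fun x y z => @IsSurface.two_thirds _ _ _ h.surf b v x y z
      have tb : Tri K a v b ↔ Tri K b v a := ⟨fun h => h.rot.rot.swap', fun h => h.rot.rot.swap'⟩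
      have hc : ∀ w w', Tri K a v w → Tri K b v w' → Tri K a v b := fun w w' h1 h2 =>
        (h.common v (h1.adj h.pure).1 (h2.adj h.pure).1).swap'
      have hx := tl x hx
      have hy := tl y hy
      have hz := tl z hz
      clear tl
      generalize Tri K a v = A at *
      generalize Tri K b v = B at *
      grind
    intro u v x y z hx hy hz
    by_cases hua : u = a
    · subst hua; exact left v x y z hx hy hz
    by_cases hva : v = a
    · subst hva; exact left u x y z hx.swap hy.swap hz.swap
    have hub := (h.tri_ne hx).1
    have hvb := (h.tri_ne hx).2.1
    have tl : ∀ w, Tri (contract K a b) u v w → ∃ w', Tri K u v w' ∧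
        (if w' = b then a else w') = w := by
      intro w hw
      by_cases hwa : w = a
      · subst hwa
        rcases (h.tri_left hua hub hva hvb).1 hw.rot.rot with h1 | h1
        exacts [⟨w, h1.rot, by simp [h.adj.1]⟩, ⟨b, h1.rot, by simp⟩]
      · have hwb := (h.tri_ne hw).2.2
        exact ⟨w, (h.tri_old hua hub hva hvb hwa hwb).1 hw, by simp [hwb]⟩
    obtain ⟨x', hx', rfl⟩ := tl x hx
    obtain ⟨y', hy', rfl⟩ := tl y hy
    obtain ⟨z', hz', rfl⟩ := tl z hz
    rcases h.surf.two_thirds hx' hy' hz' with h | h | h <;> simp [h]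
  link_connected := by
    intro v p q hp hq
    have hvb := (h.adj_ne hp).1
    have hpb := (h.adj_ne hp).2
    have hqb := (h.adj_ne hq).2
    by_cases hva : v = a
    · subst hva
      have hpa := hp.1.symm
      have hqa := hq.1.symm
      refine Relation.ReflTransGen.mono ?_ _ _ (h.merged_connected hb ((h.adj_left hpa hpb).1 hp)
        hpa hpb ((h.adj_left hqa hqb).1 hq) hqa hqb)
      rintro x y ⟨h1, h2, h3, h4, h5⟩
      exact (h.tri_left h1 h2 h3 h4).2 h5
    · set r : V → V := fun x => if x = b then a else x with hr
      have pre : ∀ p, Adj (contract K a b) v p → ∃ p', Adj K v p' ∧ r p' = p := by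
        intro p hp
        by_cases hpa : p = a
        · subst hpa
          rcases (h.adj_left hva hvb).1 hp.symm with h1 | h1
          exacts [⟨p, h1.symm, by simp [hr]⟩, ⟨b, h1.symm, by simp [hr]⟩]
        · have hpb := (h.adj_ne hp).2
          exact ⟨p, (h.adj_old hva hvb hpa hpb).1 hp, by simp [hr, hpb]⟩
      obtain ⟨p', hp', rfl⟩ := pre p hp
      obtain ⟨q', hq', rfl⟩ := pre q hq
      refine Relation.ReflTransGen.lift' r ?_ _ _ (h.surf.link_connected v p' q' hp' hq')
      intro x y hxy
      have hxy : Tri K v x y := hxy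
      have hne := hxy.ne h.pure
      have hab := h.adj.1
      by_cases hrxy : r x = r y
      · change Relation.ReflTransGen _ (r x) (r y)
        rw [hrxy]
      refine .single ?_
      change Tri (contract K a b) v (r x) (r y)
      simp only [hr] at hrxy ⊢
      split_ifs at hrxy ⊢ with hx hy hy
      · exact absurd rfl hrxy
      · subst hx
        have hya : y ≠ a := fun h => hrxy h.symm
        exact ((h.tri_left hya hy hva hvb).2 (Or.inr hxy.rot)).rot.rot
      · subst hy
        have hxa : x ≠ a := hrxy
        exact ((h.tri_left hva hvb hxa hx).2 (Or.inr hxy.rot.rot)).rot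
      · by_cases hxa : x = a
        · subst hxa
          exact ((h.tri_left hne.2.2.symm hy hva hvb).2 (Or.inl hxy.rot)).rot.rot
        by_cases hya : y = a
        · subst hya
          exact ((h.tri_left hva hvb hxa hx).2 (Or.inl hxy.rot.rot)).rot
        exact (h.tri_old hva hvb hxa hx hya hy).2 hxy
  connected := by
    intro u hu v hv
    rw [h.verts_contract, Finset.mem_erase] at hu hv
    set r : V → V := fun x => if x = b then a else x with hr
    have hru : r u = u := by simp [hr, hu.1]
    have hrv : r v = v := by simp [hr, hv.1]
    rw [← hru, ← hrv]
    refine Relation.ReflTransGen.lift' r ?_ _ _ (h.surf.connected u hu.2 v hv.2)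
    intro x y hxy
    have hne := hxy.1
    have hab := h.adj.1
    by_cases hrxy : r x = r y
    · change Relation.ReflTransGen _ (r x) (r y)
      rw [hrxy]
    refine .single ?_
    simp only [hr] at hrxy ⊢
    split_ifs at hrxy ⊢ with hx hy hy
    · exact absurd rfl hrxy
    · subst hx
      exact (h.adj_left (fun h => hrxy h.symm) hy).2 (Or.inr hxy)
    · subst hy
      exact ((h.adj_left hrxy hx).2 (Or.inr hxy.symm)).symm
    · by_cases hxa : x = a
      · subst hxa
        exact (h.adj_left hne.symm hy).2 (Or.inl hxy)
      by_cases hya : y = a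
      · subst hya
        exact ((h.adj_left hxa hx).2 (Or.inl hxy.symm)).symm
      exact (h.adj_old hxa hx hya hy).2 hxy

theorem bdryVertex_left (h : LinkCond K a b)
    (hb : BdryVertex (contract K a b) a) : BdryVertex K a ∨ BdryVertex K b := by
  obtain ⟨w, hw⟩ := hb
  rcases (h.bdryEdge_left hw.1.symm (h.adj_ne hw.adj).2).1 hw with h | h
  exacts [Or.inl h.left, Or.inr h.left]

theorem bdryVertex_old (h : LinkCond K a b) {v : V} (hv : v ≠ a) (hv' : v ≠ b) :
    BdryVertex (contract K a b) v ↔ BdryVertex K v := by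
  constructor
  · rintro ⟨w, hw⟩
    by_cases hwa : w = a
    · subst hwa
      rcases (h.bdryEdge_left hv hv').1 hw.symm with h | h
      exacts [h.right, h.right]
    · exact ((h.bdryEdge_old hv hv' hwa (h.adj_ne hw.adj).2).1 hw).left
  · rintro ⟨w, hw⟩
    by_cases hwa : w = a
    · subst hwa
      exact ((h.bdryEdge_left hv hv').2 (Or.inl hw.symm)).right
    by_cases hwb : w = b
    · subst hwb
      exact ((h.bdryEdge_left hv hv').2 (Or.inr hw.symm)).right
    · exact ((h.bdryEdge_old hv hv' hwa hwb).2 hw).left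

theorem isPunctured_contract (h : LinkCond K a b)
    (hb : BdryEdge K a b ∨ ¬ BdryVertex K a ∨ ¬ BdryVertex K b) :
    IsPunctured (contract K a b) where
  toIsSurface := h.isSurface_contract hb
  bdry_nonempty := by
    obtain ⟨u, v, huv⟩ := h.punctured.bdry_nonempty
    obtain ⟨x, y, hxy, hxa, hxb⟩ : ∃ x y, BdryEdge K x y ∧ x ≠ a ∧ x ≠ b := by
      by_cases hu : u ≠ a ∧ u ≠ b
      · exact ⟨u, v, huv, hu⟩
      · have hu' : u = a ∨ u = b := by tauto
        rcases hu' with rfl | rfl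
        · obtain ⟨q, hq, hqb⟩ := h.surf.exists_bdry_ne huv.left b
          exact ⟨q, u, hq.symm, hq.1.symm, hqb⟩
        · obtain ⟨q, hq, hqb⟩ := h.surf.exists_bdry_ne huv.left a
          exact ⟨q, u, hq.symm, hqb, hq.1.symm⟩
    obtain ⟨w, hw⟩ := (h.bdryVertex_old hxa hxb).2 hxy.left
    exact ⟨x, w, hw⟩
  bdry_connected := by
    intro u v hu hv
    set r : V → V := fun x => if x = b then a else x with hr
    have pre : ∀ u, BdryVertex (contract K a b) u → ∃ u', BdryVertex K u' ∧ r u' = u := by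
      intro u hu
      have hub : u ≠ b := by
        obtain ⟨w, hw⟩ := hu
        exact (h.adj_ne hw.adj).1
      by_cases hua : u = a
      · subst hua
        rcases h.bdryVertex_left hu with h1 | h1
        exacts [⟨u, h1, by simp [hr]⟩, ⟨b, h1, by simp [hr]⟩]
      · exact ⟨u, (h.bdryVertex_old hua hub).1 hu, by simp [hr, hub]⟩
    obtain ⟨u', hu', rfl⟩ := pre u hu
    obtain ⟨v', hv', rfl⟩ := pre v hv
    refine Relation.ReflTransGen.lift' r ?_ _ _ (h.punctured.bdry_connected u' v' hu' hv')
    intro x y hxy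
    have hne := hxy.1
    have hab := h.adj.1
    by_cases hrxy : r x = r y
    · change Relation.ReflTransGen _ (r x) (r y)
      rw [hrxy]
    refine .single ?_
    simp only [hr] at hrxy ⊢
    split_ifs at hrxy ⊢ with hx hy hy
    · exact absurd rfl hrxy
    · subst hx
      exact (h.bdryEdge_left (fun h => hrxy h.symm) hy).2 (Or.inr hxy)
    · subst hy
      exact ((h.bdryEdge_left hrxy hx).2 (Or.inr hxy.symm)).symm
    · by_cases hxa : x = a
      · subst hxa
        exact (h.bdryEdge_left hne.symm hy).2 (Or.inl hxy)
      by_cases hya : y = a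
      · subst hya
        exact ((h.bdryEdge_left hxa hx).2 (Or.inl hxy.symm)).symm
      exact (h.bdryEdge_old hxa hx hya hy).2 hxy

/-- The ends of a contractible inner edge are not both on the boundary. -/
theorem bdry_of_isSurface (h : LinkCond K a b) (hL : IsSurface (contract K a b)) :
    BdryEdge K a b ∨ ¬ BdryVertex K a ∨ ¬ BdryVertex K b := by
  by_contra! hc
  obtain ⟨hab, ⟨p, hp⟩, ⟨q, hq⟩⟩ := hc
  obtain ⟨p', hp', hpp⟩ := h.surf.exists_bdry_ne hp.left p
  have ha : ∀ x, BdryEdge K a x → x ≠ b := fun x hx hxb => hab (hxb ▸ hx)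
  have hb : ∀ x, BdryEdge K b x → x ≠ a := fun x hx hxb => hab (hxb ▸ hx).symm
  have hne : ∀ x y, BdryEdge K a x → BdryEdge K b y → x ≠ y := by
    rintro x y hx hy rfl
    exact h.not_bdry_bdry (h.common x hx.adj hy.adj) hx hy
  -- The two boundary edges at `a` and one at `b` stay distinct boundary edges of the merged vertex,
  -- which may have only two.
  have l1 := (h.bdryEdge_left hp.1.symm (ha p hp)).2 (Or.inl hp)
  have l2 := (h.bdryEdge_left hp'.1.symm (ha p' hp')).2 (Or.inl hp')
  have l3 := (h.bdryEdge_left (hb q hq) hq.1.symm).2 (Or.inr hq)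
  rcases hL.bdry_three l1 l2 l3 with h | h | h
  exacts [hpp h.symm, hne p q hp hq h, hne p' q hp' hq h]

end LinkCond

/-! ### Contraction and orientability. -/

theorem sum_antisymm {α : Type*} (S : Finset α) (e : α → α → ℤ) (he : ∀ p q, e p q = - e q p) :
    ∑ p ∈ S, ∑ q ∈ S, e p q = 0 := by
  have h1 : ∑ p ∈ S, ∑ q ∈ S, e p q = - ∑ p ∈ S, ∑ q ∈ S, e p q := by
    conv_lhs => rw [Finset.sum_comm]
    rw [← Finset.sum_neg_distrib]
    refine Finset.sum_congr rfl fun p _ => ?_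
    rw [← Finset.sum_neg_distrib]
    exact Finset.sum_congr rfl fun q _ => he q p
  omega

theorem pair_cases {α : Type*} {a b u v w w' : α} (hab : a ≠ b) (hvw : v ≠ w) (huw : u ≠ w)
    (hc : (a = u ∨ a = v ∨ a = w) ∧ (b = u ∨ b = v ∨ b = w))
    (hc' : (a = u ∨ a = v ∨ a = w') ∧ (b = u ∨ b = v ∨ b = w')) :
    (a = u ∧ b = v) ∨ (b = u ∧ a = v) ∨ (w = w') ∨ (a = w ∧ b = w') ∨ (b = w ∧ a = w') := by
  rcases hc with ⟨rfl | rfl | rfl, rfl | rfl | rfl⟩ <;> simp_all [eq_comm]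

/-- An orientation of the faces that do not contain both `a` and `b`, compatible with the
contraction of `ab`. -/
structure PartialOrient (K : Finset (Finset V)) (a b : V) (o : V → V → V → Prop) : Prop where
  rot : ∀ u v w, Tri K u v w → ¬ (a ∈ ({u, v, w} : Finset V) ∧ b ∈ ({u, v, w} : Finset V)) →
    (o u v w ↔ o v w u)
  swap : ∀ u v w, Tri K u v w → ¬ (a ∈ ({u, v, w} : Finset V) ∧ b ∈ ({u, v, w} : Finset V)) →
    (o u v w ↔ ¬ o v u w)
  edge : ∀ u v w w', w ≠ w' → Tri K u v w → Tri K u v w' →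
    ¬ (a ∈ ({u, v, w} : Finset V) ∧ b ∈ ({u, v, w} : Finset V)) →
    ¬ (a ∈ ({u, v, w'} : Finset V) ∧ b ∈ ({u, v, w'} : Finset V)) → (o u v w ↔ ¬ o u v w')
  cross : ∀ c d d', Tri K a c d → Tri K b c d' → d ≠ b → d' ≠ a → (o a c d ↔ ¬ o b c d')

namespace LinkCond

variable {a b : V}

theorem PartialOrient.symm {o : V → V → V → Prop} (h : PartialOrient K a b o) :
    PartialOrient K b a o where
  rot u v w h1 h2 := h.rot u v w h1 fun h3 => h2 h3.symm
  swap u v w h1 h2 := h.swap u v w h1 fun h3 => h2 h3.symm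
  edge u v w w' hw h1 h2 h3 h4 := h.edge u v w w' hw h1 h2 (fun h => h3 h.symm) fun h => h4 h.symm
  cross c d d' h1 h2 h3 h4 := by
    have := h.cross c d' d h2 h1 h4 h3
    tauto

/-- The orientation is transported around the inner vertex `a`, from one face at `ab` to the other,
along the side avoiding `b`. Instead of following the path, one sums the signs `e p q` of the faces
`apq` over all ordered pairs. The total is zero by antisymmetry; the row of any `p` other than `c`,
`d` cancels because its two faces are oppositely oriented. So the two remaining entries, in the rows
of `c` and `d`, have opposite signs. -/
theorem orient_around (h : LinkCond K a b) {o : V → V → V → Prop} (ho : PartialOrient K a b o)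
    (ha : ¬ BdryVertex K a) {c d q q' : V} (hc : Tri K a b c) (hd : Tri K a b d) (hcd : c ≠ d)
    (hq : Tri K a c q) (hqb : q ≠ b) (hq' : Tri K a d q') (hqb' : q' ≠ b) :
    o a c q ↔ ¬ o a d q' := by
  classical
  have hab := h.adj.1
  set e : V → V → ℤ := fun p q => if Tri K a p q ∧ p ≠ b ∧ q ≠ b then (if o a p q then 1 else -1) else 0
    with he
  have epos : ∀ p q, Tri K a p q → p ≠ b → q ≠ b → e p q = if o a p q then 1 else -1 :=
    fun p q h1 h2 h3 => if_pos ⟨h1, h2, h3⟩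
  have h1 : ∀ p q, e p q = - e q p := by
    intro p q
    simp only [he]
    by_cases ht : Tri K a p q ∧ p ≠ b ∧ q ≠ b
    · have ht' : Tri K a q p ∧ q ≠ b ∧ p ≠ b := ⟨ht.1.swap', ht.2.2, ht.2.1⟩
      rw [if_pos ht, if_pos ht']
      have hn := ht.1.ne h.pure
      have nb : ∀ x y z : V, x ≠ b → y ≠ b → z ≠ b →
          ¬ (a ∈ ({x, y, z} : Finset V) ∧ b ∈ ({x, y, z} : Finset V)) := by
        intro x y z hx hy hz hh
        have := hh.2
        simp only [Finset.mem_insert, Finset.mem_singleton] at this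
        tauto
      have i1 := ho.rot a p q ht.1 (nb _ _ _ hab ht.2.1 ht.2.2)
      have i2 := ho.swap p q a ht.1.rot (nb _ _ _ ht.2.1 ht.2.2 hab)
      have i3 := ho.rot a q p ht'.1 (nb _ _ _ hab ht.2.2 ht.2.1)
      have : o a p q ↔ ¬ o a q p := by tauto
      by_cases hh : o a q p
      · have : ¬ o a p q := by tauto
        simp [hh, this]
      · have : o a p q := by tauto
        simp [hh, this]
    · have ht' : ¬ (Tri K a q p ∧ q ≠ b ∧ p ≠ b) := fun ⟨x, y, z⟩ => ht ⟨x.swap', z, y⟩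
      rw [if_neg ht, if_neg ht']
      simp
  set S := (nbrs K a).erase b with hS
  have h2 := sum_antisymm S e h1
  have nb : ∀ x y : V, x ≠ b → y ≠ b →
      ¬ (a ∈ ({a, x, y} : Finset V) ∧ b ∈ ({a, x, y} : Finset V)) := by
    intro x y hx hy hh
    have := hh.2
    simp only [Finset.mem_insert, Finset.mem_singleton] at this
    rcases this with h | h | h
    exacts [hab h.symm, hx h.symm, hy h.symm]
  have mem : ∀ p q, Tri K a p q → q ≠ b → q ∈ S := fun p q ht hq =>
    Finset.mem_erase.2 ⟨hq, mem_nbrs.2 (ht.adj h.pure).2.1⟩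
  have hcb := (hc.ne h.pure).2.2.symm
  have hdb := (hd.ne h.pure).2.2.symm
  have single : ∀ c q, Tri K a b c → Tri K a c q → q ≠ b → ∑ x ∈ S, e c x = e c q := by
    intro c q hc hq hqb
    refine Finset.sum_eq_single_of_mem q (mem _ _ hq hqb) ?_
    intro x hx hxq
    simp only [he]
    rw [if_neg]
    rintro ⟨h1, -, h2⟩
    rcases h.surf.two_thirds hc.swap' hq h1 with h | h | h
    exacts [hqb h.symm, h2 h.symm, hxq h.symm]
  have rest : ∀ p ∈ S, p ≠ c → p ≠ d → ∑ x ∈ S, e p x = 0 := by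
    intro p hp hpc hpd
    obtain ⟨hpb, hpa⟩ := Finset.mem_erase.1 hp
    have hpa := mem_nbrs.1 hpa
    obtain ⟨x, y, hxy, hth⟩ := Finset.card_eq_two.1
      ((h.surf.card_thirds hpa).2 fun hb => ha hb.left)
    have hx : Tri K a p x := mem_thirds.1 (by simp [hth])
    have hy : Tri K a p y := mem_thirds.1 (by simp [hth])
    have nbx : ∀ x, Tri K a p x → x ≠ b := by
      rintro x hx rfl
      rcases h.surf.two_thirds hc hd hx.swap' with h | h | h
      exacts [hcd h, hpc h.symm, hpd h.symm]
    have hsub : ∑ z ∈ S, e p z = ∑ z ∈ ({x, y} : Finset V), e p z := by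
      symm
      refine Finset.sum_subset ?_ ?_
      · intro z hz
        rw [← hth] at hz
        exact mem _ _ (mem_thirds.1 hz) (nbx _ (mem_thirds.1 hz))
      · intro z _ hz
        simp only [he]
        rw [if_neg]
        rintro ⟨h1, -, -⟩
        exact hz (hth ▸ mem_thirds.2 h1)
    rw [hsub, Finset.sum_pair hxy]
    rw [epos p x hx hpb (nbx x hx), epos p y hy hpb (nbx y hy)]
    have := ho.edge a p x y hxy hx hy (nb _ _ hpb (nbx x hx)) (nb _ _ hpb (nbx y hy))
    by_cases hh : o a p y
    · have : ¬ o a p x := by tauto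
      simp [hh, this]
    · have : o a p x := by tauto
      simp [hh, this]
  have hcS : c ∈ S := mem _ _ hc hcb
  have hdS : d ∈ S.erase c := Finset.mem_erase.2 ⟨hcd.symm, mem _ _ hd hdb⟩
  rw [← Finset.add_sum_erase _ _ hcS, ← Finset.add_sum_erase _ _ hdS,
    Finset.sum_eq_zero (s := (S.erase c).erase d), single c q hc hq hqb,
    single d q' hd hq' hqb'] at h2
  · rw [epos c q hq hcb hqb, epos d q' hq' hdb hqb'] at h2
    split_ifs at h2 with x y y
    · omega
    · exact iff_of_true x y
    · exact iff_of_false x (not_not.2 y)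
    · omega
  · intro x hx
    simp only [Finset.mem_erase] at hx
    exact rest x hx.2.2 hx.2.1 hx.1

/-- Each collapsed face `abc` has its orientation forced by its neighbour across `ac` or `bc`. The
compatibility `cross` makes both neighbours agree, and if there are two collapsed faces,
`orient_around` makes them induce opposite directions on `ab`. -/
theorem orientable_of_partial (h : LinkCond K a b)
    (hb : BdryEdge K a b ∨ ¬ BdryVertex K a ∨ ¬ BdryVertex K b) {o : V → V → V → Prop}
    (ho : PartialOrient K a b o) : Orientable K := by
  have hab := h.adj.1
  -- The truth value to be given to the cyclic order `a, b, c`, read off from whichever outer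
  -- neighbour of `abc` exists.
  set t : V → Prop := fun c => (∃ q, q ≠ b ∧ Tri K a c q ∧ o a c q) ∨
    (∃ q, q ≠ a ∧ Tri K b c q ∧ ¬ o b c q) with ht
  have t1 : ∀ c q, Tri K a b c → Tri K a c q → q ≠ b → (t c ↔ o a c q) := by
    intro c q hc hq hqb
    constructor
    · rintro (⟨x, hx1, hx2, hx3⟩ | ⟨x, hx1, hx2, hx3⟩)
      · rcases h.surf.two_thirds hc.swap' hq hx2 with h | h | h
        exacts [absurd h.symm hqb, absurd h.symm hx1, h ▸ hx3]
      · have := ho.cross c q x hq hx2 hqb hx1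
        tauto
    · exact fun hh => Or.inl ⟨q, hqb, hq, hh⟩
  have t2 : ∀ c q, Tri K a b c → Tri K b c q → q ≠ a → (t c ↔ ¬ o b c q) := by
    intro c q hc hq hqb
    constructor
    · rintro (⟨x, hx1, hx2, hx3⟩ | ⟨x, hx1, hx2, hx3⟩)
      · have := ho.cross c x q hx2 hq hx1 hqb
        tauto
      · rcases h.surf.two_thirds hc.rot hq hx2 with h | h | h
        exacts [absurd h.symm hqb, absurd h.symm hx1, h ▸ hx3]
    · exact fun hh => Or.inr ⟨q, hqb, hq, hh⟩
  have t3 : ∀ c d, Tri K a b c → Tri K a b d → c ≠ d → (t c ↔ ¬ t d) := by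
    intro c d hc hd hcd
    rcases hb with hb | hb | hb
    · exact absurd (hb.unique h.pure hc hd) hcd
    · obtain ⟨q, hq, hqb⟩ := exists_other h.pure hc.swap' fun hh => hb hh.left
      obtain ⟨q', hq', hqb'⟩ := exists_other h.pure hd.swap' fun hh => hb hh.left
      rw [t1 c q hc hq hqb, t1 d q' hd hq' hqb']
      exact h.orient_around ho hb hc hd hcd hq hqb hq' hqb'
    · obtain ⟨q, hq, hqb⟩ := exists_other h.pure hc.rot fun hh => hb hh.left
      obtain ⟨q', hq', hqb'⟩ := exists_other h.pure hd.rot fun hh => hb hh.left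
      rw [t2 c q hc hq hqb, t2 d q' hd hq' hqb']
      have := h.symm.orient_around (PartialOrient.symm ho) hb hc.swap hd.swap hcd hq hqb hq' hqb'
      tauto
  have hn := fun u v w => @Tri.ne _ _ K h.pure u v w
  have hs := fun u v w => @Tri.swap _ _ K u v w
  have hr := fun u v w => @Tri.rot _ _ K u v w
  obtain ⟨o1, o2, o3, -⟩ := ho
  simp only [Finset.mem_insert, Finset.mem_singleton] at o1 o2 o3
  clear_value t
  -- The first three cases are the cyclic rotations of `a, b, c`, the next three those of `b, a, c`;
  -- all other faces keep `o`.
  set o' : V → V → V → Prop := fun u v w =>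
    (u = a ∧ v = b ∧ t w) ∨ (v = a ∧ w = b ∧ t u) ∨ (w = a ∧ u = b ∧ t v) ∨
    (u = b ∧ v = a ∧ ¬ t w) ∨ (v = b ∧ w = a ∧ ¬ t u) ∨ (w = b ∧ u = a ∧ ¬ t v) ∨
    (¬ ((a = u ∨ a = v ∨ a = w) ∧ (b = u ∨ b = v ∨ b = w)) ∧ o u v w) with ho'
  have e1 : ∀ w, w ≠ a → w ≠ b → (o' a b w ↔ t w) ∧ (o' b w a ↔ t w) ∧ (o' w a b ↔ t w) ∧
      (o' b a w ↔ ¬ t w) ∧ (o' a w b ↔ ¬ t w) ∧ (o' w b a ↔ ¬ t w) := by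
    intro w hwa hwb
    simp [ho', hwa, hwb, hab, hab.symm]
  have e2 : ∀ u v w, ¬ ((a = u ∨ a = v ∨ a = w) ∧ (b = u ∨ b = v ∨ b = w)) →
      (o' u v w ↔ o u v w) := by
    intro u v w hn
    simp only [ho', hn, not_false_eq_true, true_and]
    constructor
    · rintro (⟨h1, h2, -⟩ | ⟨h1, h2, -⟩ | ⟨h1, h2, -⟩ | ⟨h1, h2, -⟩ | ⟨h1, h2, -⟩ | ⟨h1, h2, -⟩ | h)
      on_goal 7 => exact h
      all_goals exact absurd (by simp [h1, h2]) hn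
    · intro h
      simp only [h, or_true]
  clear_value o'
  refine ⟨o', ?_, ?_⟩
  · intro u v w huvw
    have huvw : Tri K u v w := huvw
    have n := hn _ _ _ huvw
    by_cases hc : (a = u ∨ a = v ∨ a = w) ∧ (b = u ∨ b = v ∨ b = w)
    · obtain ⟨rfl | rfl | rfl, hc⟩ := hc <;> rcases hc with rfl | rfl | rfl
      · exact absurd rfl hab
      · obtain ⟨i1, i2, i3, i4, i5, i6⟩ := e1 w n.2.1.symm n.2.2.symm
        rw [i1, i2, i4, not_not]; exact ⟨Iff.rfl, Iff.rfl⟩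
      · obtain ⟨i1, i2, i3, i4, i5, i6⟩ := e1 v n.1.symm n.2.2
        rw [i5, i6, i3]; exact ⟨Iff.rfl, Iff.rfl⟩
      · obtain ⟨i1, i2, i3, i4, i5, i6⟩ := e1 w n.2.2.symm n.2.1.symm
        rw [i4, i5, i1]; exact ⟨Iff.rfl, Iff.rfl⟩
      · exact absurd rfl hab
      · obtain ⟨i1, i2, i3, i4, i5, i6⟩ := e1 u n.1 n.2.1
        rw [i3, i1, i5, not_not]; exact ⟨Iff.rfl, Iff.rfl⟩
      · obtain ⟨i1, i2, i3, i4, i5, i6⟩ := e1 v n.2.2 n.1.symm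
        rw [i2, i3, i6, not_not]; exact ⟨Iff.rfl, Iff.rfl⟩
      · obtain ⟨i1, i2, i3, i4, i5, i6⟩ := e1 u n.2.1 n.1
        rw [i6, i4, i2]; exact ⟨Iff.rfl, Iff.rfl⟩
      · exact absurd rfl hab
    · rw [e2 u v w hc, e2 v w u (by tauto), e2 v u w (by tauto)]
      exact ⟨o1 u v w huvw hc, o2 u v w huvw hc⟩
  · have mixed : ∀ u v w w', w ≠ w' → Tri K u v w → Tri K u v w' →
        ((a = u ∨ a = v ∨ a = w) ∧ (b = u ∨ b = v ∨ b = w)) →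
        ¬ ((a = u ∨ a = v ∨ a = w') ∧ (b = u ∨ b = v ∨ b = w')) → (o' u v w ↔ ¬ o' u v w') := by
      intro u v w w' hw h1 h2 hc hc'
      have n1 := hn _ _ _ h1
      have n2 := hn _ _ _ h2
      rw [e2 u v w' hc']
      obtain ⟨rfl | rfl | rfl, hc⟩ := hc <;> rcases hc with rfl | rfl | rfl
      · exact absurd rfl hab
      · exact absurd (by simp) hc'
      · obtain ⟨i1, i2, i3, i4, i5, i6⟩ := e1 v n1.1.symm n1.2.2
        rw [i5, t1 v w' h1.swap' h2 hw.symm]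
      · exact absurd (by simp) hc'
      · exact absurd rfl hab
      · obtain ⟨i1, i2, i3, i4, i5, i6⟩ := e1 u n1.1 n1.2.1
        rw [i3, t1 u w' h1.rot h2.swap hw.symm, o2 u a w' h2 hc', not_not]
      · obtain ⟨i1, i2, i3, i4, i5, i6⟩ := e1 v n1.2.2 n1.1.symm
        rw [i2, t2 v w' h1.rot.rot h2 hw.symm]
      · obtain ⟨i1, i2, i3, i4, i5, i6⟩ := e1 u n1.2.1 n1.1
        rw [i6, t2 u w' h1.rot.swap h2.swap hw.symm, o2 u b w' h2 hc', not_not]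
      · exact absurd rfl hab
    intro u v w w' hw h1 h2
    have h1 : Tri K u v w := h1
    have h2 : Tri K u v w' := h2
    by_cases hc : (a = u ∨ a = v ∨ a = w) ∧ (b = u ∨ b = v ∨ b = w) <;>
      by_cases hc' : (a = u ∨ a = v ∨ a = w') ∧ (b = u ∨ b = v ∨ b = w')
    · have n1 := hn _ _ _ h1
      have n2 := hn _ _ _ h2
      have hcases := pair_cases hab n1.2.2 n1.2.1 hc hc'
      rcases hcases with ⟨rfl, rfl⟩ | ⟨rfl, rfl⟩ | hww | ⟨rfl, rfl⟩ | ⟨rfl, rfl⟩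
      · rw [(e1 w n1.2.1.symm n1.2.2.symm).1, (e1 w' n2.2.1.symm n2.2.2.symm).1]
        exact t3 _ _ h1 h2 hw
      · rw [(e1 w n1.2.2.symm n1.2.1.symm).2.2.2.1, (e1 w' n2.2.2.symm n2.2.1.symm).2.2.2.1,
          t3 _ _ h1.swap h2.swap hw]
      · exact absurd hww hw
      · exact absurd h2.rot.rot fun h' => h.not_tri h1.rot.rot h'
      · exact absurd h2.rot.rot fun h' => h.not_tri h' h1.rot.rot
    · exact mixed u v w w' hw h1 h2 hc hc'
    · rw [mixed u v w' w hw.symm h2 h1 hc' hc, not_not]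
    · rw [e2 u v w hc, e2 u v w' hc']
      exact o3 u v w w' hw h1 h2 hc hc'

/-- Forwards, a face of the contraction inherits the orientation of the face it comes from, with `a`
and `b` exchanged if that face contained `b`. Backwards, an orientation pulled back along the
renaming of `b` to `a` is a `PartialOrient`, since faces `acd` and `bcd'` become the two faces at
the merged edge. -/
theorem orientable_iff (h : LinkCond K a b)
    (hb : BdryEdge K a b ∨ ¬ BdryVertex K a ∨ ¬ BdryVertex K b) :
    Orientable K ↔ Orientable (contract K a b) := by
  have hab := h.adj.1
  constructor
  · rintro ⟨o, o1, o2⟩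
    have o1 : ∀ u v w, Tri K u v w → (o u v w ↔ o v w u) ∧ (o u v w ↔ ¬ o v u w) := o1
    have o2 : ∀ u v w w', w ≠ w' → Tri K u v w → Tri K u v w' → (o u v w ↔ ¬ o u v w') := o2
    set s := Equiv.swap a b with hs
    have sa : s a = b := Equiv.swap_apply_left a b
    have so : ∀ x, x ≠ a → x ≠ b → s x = x := fun x => Equiv.swap_apply_of_ne_of_ne
    have tl : ∀ u v w, Tri (contract K a b) u v w → ¬ Tri K u v w → Tri K (s u) (s v) (s w) := by
      intro u v w ht hn
      obtain ⟨hu, hv, hw, hh⟩ := (tri_contract_iff h.pure hab).1 ht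
      rcases hh with hh | ⟨rfl, h1, h2, hh⟩ | ⟨rfl, h1, h2, hh⟩ | ⟨rfl, h1, h2, hh⟩
      · exact absurd hh hn
      · rwa [sa, so v h1 hv, so w h2 hw]
      · rwa [sa, so u h1 hu, so w h2 hw]
      · rwa [sa, so u h1 hu, so v h2 hv]
    -- At a merged edge, one face comes from `a` and the other from `b`; the collapsed face between
    -- them is adjacent to both, and passing through it relates their orientations.
    have mixed : ∀ u v w w', w ≠ w' → u ≠ b → v ≠ b → w ≠ b → w' ≠ b → u ≠ v → u ≠ w' → v ≠ w' →
        Tri K u v w → Tri K (s u) (s v) (s w') → (o u v w ↔ ¬ o (s u) (s v) (s w')) := by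
      intro u v w w' hw hu hv hwb hwb' n1 n2 n3 ht ht'
      by_cases hua : u = a
      · subst hua
        rw [sa, so v n1.symm hv, so w' n2.symm hwb'] at ht' ⊢
        have hc := h.common v (ht.adj h.pure).1 (ht'.adj h.pure).1
        have i1 := o2 _ _ _ _ hwb ht hc.swap'
        have i2 := o2 _ _ _ _ n2.symm ht' hc.rot
        have i3 := o1 _ _ _ hc.swap'
        have i4 := o1 _ _ _ hc.rot
        rw [i1, i3.2, not_not, i2, not_not, i4.1]
      by_cases hva : v = a
      · subst hva
        rw [sa, so u hua hu, so w' n3.symm hwb'] at ht' ⊢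
        have hc := h.common u (ht.adj h.pure).1.symm (ht'.adj h.pure).1.symm
        have i1 := o2 _ _ _ _ hwb ht hc.rot.rot
        have i2 := o2 _ _ _ _ n3.symm ht' hc.swap.rot.rot
        have i3 := o1 _ _ _ hc.rot.rot
        have i4 := o1 _ _ _ hc.swap.rot.rot
        have i5 := o1 _ _ _ hc
        rw [i1, i3.1, i5.2, not_not, i2, not_not, i4.1]
      rw [so u hua hu, so v hva hv] at ht' ⊢
      refine o2 _ _ _ _ ?_ ht ht'
      by_cases hwa : w' = a
      · rw [hwa, sa]; exact hwb
      · rw [so w' hwa hwb']; exact hw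
    refine ⟨fun u v w => (Tri K u v w ∧ o u v w) ∨ (¬ Tri K u v w ∧ o (s u) (s v) (s w)), ?_, ?_⟩
    · intro u v w ht
      have ht : Tri (contract K a b) u v w := ht
      by_cases hk : Tri K u v w
      · have := o1 _ _ _ hk
        simp only [hk, hk.rot, hk.swap, true_and, not_true_eq_false, false_and, or_false]
        exact this
      · have := o1 _ _ _ (tl _ _ _ ht hk)
        have k1 : ¬ Tri K v w u := fun h => hk h.rot.rot
        have k2 : ¬ Tri K v u w := fun h => hk h.swap
        simp only [hk, k1, k2, false_and, not_false_eq_true, true_and, false_or]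
        exact this
    · intro u v w w' hw h1 h2
      have h1 : Tri (contract K a b) u v w := h1
      have h2 : Tri (contract K a b) u v w' := h2
      have b1 := h.tri_ne h1
      have b2 := h.tri_ne h2
      have n1 := h1.ne (contract_pure a b)
      have n2 := h2.ne (contract_pure a b)
      by_cases k1 : Tri K u v w <;> by_cases k2 : Tri K u v w' <;>
        simp only [k1, k2, true_and, not_true_eq_false, false_and, or_false, not_false_eq_true,
          false_or]
      · exact o2 _ _ _ _ hw k1 k2
      · exact mixed u v w w' hw b1.1 b1.2.1 b1.2.2 b2.2.2 n2.1 n2.2.1 n2.2.2 k1 (tl _ _ _ h2 k2)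
      · have := mixed u v w' w hw.symm b1.1 b1.2.1 b2.2.2 b1.2.2 n1.1 n1.2.1 n1.2.2 k2 (tl _ _ _ h1 k1)
        rw [this, not_not]
      · exact o2 _ _ _ _ (fun hh => hw (s.injective hh)) (tl _ _ _ h1 k1) (tl _ _ _ h2 k2)
  · rintro ⟨o, o1, o2⟩
    have o1 : ∀ u v w, Tri (contract K a b) u v w →
      (o u v w ↔ o v w u) ∧ (o u v w ↔ ¬ o v u w) := o1
    have o2 : ∀ u v w w', w ≠ w' → Tri (contract K a b) u v w → Tri (contract K a b) u v w' →
      (o u v w ↔ ¬ o u v w') := o2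
    set r : V → V := fun x => if x = b then a else x with hr
    have rb : r b = a := by simp [hr]
    have ro : ∀ x, x ≠ b → r x = x := fun x hx => by simp [hr, hx]
    have tr : ∀ u v w, Tri K u v w →
        ¬ (a ∈ ({u, v, w} : Finset V) ∧ b ∈ ({u, v, w} : Finset V)) →
        Tri (contract K a b) (r u) (r v) (r w) := by
      intro u v w ht hn
      have n := ht.ne h.pure
      simp only [Finset.mem_insert, Finset.mem_singleton] at hn
      rw [tri_contract_iff h.pure hab]
      simp only [hr]
      split_ifs <;> grind
    refine h.orientable_of_partial hb (o := fun u v w => o (r u) (r v) (r w)) ⟨?_, ?_, ?_, ?_⟩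
    · exact fun u v w ht hn => (o1 _ _ _ (tr u v w ht hn)).1
    · exact fun u v w ht hn => (o1 _ _ _ (tr u v w ht hn)).2
    · intro u v w w' hw h1 h2 n1 n2
      refine o2 _ _ _ _ ?_ (tr _ _ _ h1 n1) (tr _ _ _ h2 n2)
      simp only [hr]
      split_ifs with e1 e2 e2
      · exact fun _ => hw (e1.trans e2.symm)
      · subst e1
        rintro rfl
        exact h.not_tri h2.rot.rot h1.rot.rot
      · subst e2
        rintro rfl
        exact h.not_tri h1.rot.rot h2.rot.rot
      · exact hw
    · intro c d d' h1 h2 hd hd'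
      have m1 := h1.ne h.pure
      have m2 := h2.ne h.pure
      have e1 := ro c m2.1.symm
      have e2 := ro d hd
      have e3 := ro d' m2.2.1.symm
      have e4 := ro a hab
      simp only [rb, e1, e2, e3, e4]
      refine o2 _ _ _ _ ?_ ?_ ?_
      · rintro rfl; exact h.not_tri h1 h2
      · exact (h.tri_left m1.1.symm m2.1.symm m1.2.1.symm hd).2 (Or.inl h1)
      · exact (h.tri_left m1.1.symm m2.1.symm hd' m2.2.1.symm).2 (Or.inr h2)

/-- Contraction of an edge that satisfies the link condition preserves the surface. -/
theorem sameSurface (h : LinkCond K a b)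
    (hb : BdryEdge K a b ∨ ¬ BdryVertex K a ∨ ¬ BdryVertex K b) : SameSurface K (contract K a b) :=
  ⟨h.punctured, h.isPunctured_contract hb, h.eulerChar_contract, h.orientable_iff hb⟩

end LinkCond

/-! ### Diagonal flips: faces, degrees and surface axioms. -/

/-- The complex with the diagonal `ac` of the quadrilateral `abcd` replaced by `bd`. -/
def flip (K : Finset (Finset V)) (a b c d : V) : Finset (Finset V) :=
  (K.erase {a, b, c}).erase {a, c, d} ∪ {{a, b, d}, {b, c, d}}

/-- The faces `abc` and `acd` can be replaced by `abd` and `bcd`. -/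
structure FlipCond (K : Finset (Finset V)) (a b c d : V) : Prop where
  pure : Pure3 K
  ne : b ≠ d
  abc : Tri K a b c
  acd : Tri K a c d
  only : ∀ w, Tri K a c w → w = b ∨ w = d
  nadj : ¬ Adj K b d

theorem eq_of_tri_iff {K L : Finset (Finset V)} (hK : Pure3 K) (hL : Pure3 L)
    (h : ∀ u v w, Tri K u v w ↔ Tri L u v w) : K = L := by
  ext f
  constructor
  · intro hf
    obtain ⟨x, y, z, -, -, -, rfl⟩ := Finset.card_eq_three.1 (hK f hf)
    exact (h x y z).1 hf
  · intro hf
    obtain ⟨x, y, z, -, -, -, rfl⟩ := Finset.card_eq_three.1 (hL f hf)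
    exact (h x y z).2 hf

theorem triple_eq_iff {a b c u v w : V} (hab : a ≠ b) (hac : a ≠ c) (hbc : b ≠ c) :
    ({u, v, w} : Finset V) = {a, b, c} ↔
      (a = u ∨ a = v ∨ a = w) ∧ (b = u ∨ b = v ∨ b = w) ∧ (c = u ∨ c = v ∨ c = w) := by
  constructor
  · intro h
    have : ∀ x, x ∈ ({a, b, c} : Finset V) → (x = u ∨ x = v ∨ x = w) := by
      intro x hx
      rw [← h] at hx
      simpa using hx
    exact ⟨this a (by simp), this b (by simp), this c (by simp)⟩
  · rintro ⟨h1, h2, h3⟩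
    symm
    apply Finset.eq_of_subset_of_card_le
    · intro x hx
      simp only [Finset.mem_insert, Finset.mem_singleton] at hx ⊢
      rcases hx with rfl | rfl | rfl <;> assumption
    · rw [Finset.card_eq_three.2 ⟨a, b, c, hab, hac, hbc, rfl⟩]
      exact Finset.card_le_three

namespace FlipCond

variable {a b c d : V}

theorem swap_bd (h : FlipCond K a b c d) : FlipCond K a d c b :=
  ⟨h.pure, h.ne.symm, h.acd.swap', h.abc.swap', fun w hw => (h.only w hw).symm,
    fun hh => h.nadj hh.symm⟩

theorem swap_ac (h : FlipCond K a b c d) : FlipCond K c b a d :=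
  ⟨h.pure, h.ne, h.abc.rot.rot.swap', h.acd.swap, fun w hw => h.only w hw.swap, h.nadj⟩

theorem distinct (h : FlipCond K a b c d) : a ≠ b ∧ a ≠ c ∧ a ≠ d ∧ b ≠ c ∧ b ≠ d ∧ c ≠ d := by
  have h1 := h.abc.ne h.pure
  have h2 := h.acd.ne h.pure
  exact ⟨h1.1, h1.2.1, h2.2.1, h1.2.2, h.ne, h2.2.2⟩

theorem mem_of_tri (h : FlipCond K a b c d) {u v w : V} (ht : Tri K u v w)
    (ha : a = u ∨ a = v ∨ a = w) (hc : c = u ∨ c = v ∨ c = w) :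
    (b = u ∨ b = v ∨ b = w) ∨ (d = u ∨ d = v ∨ d = w) := by
  have n2 := h.distinct.2.1
  have ho := h.only
  rcases ha with rfl | rfl | rfl <;> rcases hc with rfl | rfl | rfl
  · exact absurd rfl n2
  · rcases ho _ ht with rfl | rfl <;> simp
  · rcases ho _ ht.swap' with rfl | rfl <;> simp
  · rcases ho _ ht.swap with rfl | rfl <;> simp
  · exact absurd rfl n2
  · rcases ho _ ht.rot with rfl | rfl <;> simp
  · rcases ho _ ht.rot.rot with rfl | rfl <;> simp
  · rcases ho _ ht.rot.swap with rfl | rfl <;> simp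
  · exact absurd rfl n2

/-- Phrased through membership of `a, b, c, d` in the triple, the criterion does not depend on the
order of `u, v, w`, and the symmetries of the quadrilateral become propositional tautologies. -/
theorem tri_iff (h : FlipCond K a b c d) {u v w : V} : Tri (flip K a b c d) u v w ↔
    (Tri K u v w ∧ ¬ ((a = u ∨ a = v ∨ a = w) ∧ (c = u ∨ c = v ∨ c = w))) ∨
    ((b = u ∨ b = v ∨ b = w) ∧ (d = u ∨ d = v ∨ d = w) ∧
      ((a = u ∨ a = v ∨ a = w) ∨ (c = u ∨ c = v ∨ c = w))) := by
  obtain ⟨n1, n2, n3, n4, n5, n6⟩ := h.distinct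
  have hmem : Tri (flip K a b c d) u v w ↔ (Tri K u v w ∧ ¬ ({u, v, w} : Finset V) = {a, b, c} ∧
      ¬ ({u, v, w} : Finset V) = {a, c, d}) ∨ ({u, v, w} : Finset V) = {a, b, d} ∨
      ({u, v, w} : Finset V) = {b, c, d} := by
    simp only [Tri, flip, Finset.mem_union, Finset.mem_erase, Finset.mem_insert,
      Finset.mem_singleton]
    tauto
  rw [hmem, triple_eq_iff n1 n2 n4, triple_eq_iff n2 n3 n6, triple_eq_iff n1 n3 n5,
    triple_eq_iff n4 n5 n6]
  have hk := h.mem_of_tri (u := u) (v := v) (w := w)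
  clear n1 n2 n3 n4 n5 n6 hmem
  generalize (a = u ∨ a = v ∨ a = w) = A at hk ⊢
  generalize (b = u ∨ b = v ∨ b = w) = B at hk ⊢
  generalize (c = u ∨ c = v ∨ c = w) = C at hk ⊢
  generalize (d = u ∨ d = v ∨ d = w) = D at hk ⊢
  generalize Tri K u v w = T at hk ⊢
  tauto

theorem flip_pure (h : FlipCond K a b c d) : Pure3 (flip K a b c d) := by
  obtain ⟨n1, n2, n3, n4, n5, n6⟩ := h.distinct
  intro f hf
  simp only [flip, Finset.mem_union, Finset.mem_erase, Finset.mem_insert,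
      Finset.mem_singleton] at hf
  rcases hf with hf | rfl | rfl
  · exact h.pure f hf.2.2
  · exact Finset.card_eq_three.2 ⟨a, b, d, n1, n3, n5, rfl⟩
  · exact Finset.card_eq_three.2 ⟨b, c, d, n4, n5, n6, rfl⟩

theorem flip_swap_bd (h : FlipCond K a b c d) : flip K a d c b = flip K a b c d := by
  refine eq_of_tri_iff h.swap_bd.flip_pure h.flip_pure fun u v w => ?_
  rw [h.tri_iff, h.swap_bd.tri_iff]
  generalize (a = u ∨ a = v ∨ a = w) = A at ⊢
  generalize (b = u ∨ b = v ∨ b = w) = B at ⊢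
  generalize (c = u ∨ c = v ∨ c = w) = C at ⊢
  generalize (d = u ∨ d = v ∨ d = w) = D at ⊢
  generalize Tri K u v w = T at ⊢
  tauto

theorem flip_swap_ac (h : FlipCond K a b c d) : flip K c b a d = flip K a b c d := by
  refine eq_of_tri_iff h.swap_ac.flip_pure h.flip_pure fun u v w => ?_
  rw [h.tri_iff, h.swap_ac.tri_iff]
  generalize (a = u ∨ a = v ∨ a = w) = A at ⊢
  generalize (b = u ∨ b = v ∨ b = w) = B at ⊢
  generalize (c = u ∨ c = v ∨ c = w) = C at ⊢
  generalize (d = u ∨ d = v ∨ d = w) = D at ⊢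
  generalize Tri K u v w = T at ⊢
  tauto

theorem tri_side (h : FlipCond K a b c d) {w : V} :
    Tri (flip K a b c d) a b w ↔ w = d ∨ (w ≠ c ∧ Tri K a b w) := by
  obtain ⟨n1, n2, n3, n4, n5, n6⟩ := h.distinct
  rw [h.tri_iff]
  simp [n2.symm, n4.symm, n3.symm, n5.symm, eq_comm (a := d), eq_comm (a := c)]
  tauto

theorem tri_far (h : FlipCond K a b c d) {u v w : V} (h1 : ¬ ((u = a ∨ u = c) ∧ (v = b ∨ v = d)))
    (h2 : ¬ ((u = b ∨ u = d) ∧ (v = a ∨ v = c))) (h3 : ¬ (u = a ∧ v = c)) (h4 : ¬ (u = c ∧ v = a))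
    (h5 : ¬ (u = b ∧ v = d)) (h6 : ¬ (u = d ∧ v = b)) :
    Tri (flip K a b c d) u v w ↔ Tri K u v w := by
  obtain ⟨n1, n2, n3, n4, n5, n6⟩ := h.distinct
  rw [h.tri_iff]
  have ho := h.only
  have hk : Tri K u v w → u ≠ v ∧ u ≠ w ∧ v ≠ w := fun ht => ht.ne h.pure
  have s1 : Tri K u v w → Tri K w u v := fun ht => ht.rot.rot
  have s2 : Tri K u v w → Tri K u w v := fun ht => ht.swap'
  have s3 : Tri K u v w → Tri K v w u := fun ht => ht.rot
  have s4 : Tri K u v w → Tri K w v u := fun ht => ht.rot.swap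
  grind

theorem not_tri_diag (h : FlipCond K a b c d) {w : V} : ¬ Tri (flip K a b c d) a c w := by
  obtain ⟨n1, n2, n3, n4, n5, n6⟩ := h.distinct
  rw [h.tri_iff]
  simp only [true_or, or_true, and_true, and_self, not_true_eq_false, and_false, false_or]
  rintro ⟨h1, h2⟩
  grind

theorem tri_diag (h : FlipCond K a b c d) {w : V} :
    Tri (flip K a b c d) b d w ↔ w = a ∨ w = c := by
  obtain ⟨n1, n2, n3, n4, n5, n6⟩ := h.distinct
  have h1 : ¬ Tri K b d w := fun ht => h.nadj (ht.adj h.pure).1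
  rw [h.tri_iff]
  simp [h1, n1, n3, n4.symm, n6, eq_comm (a := a), eq_comm (a := c)]

theorem reverse (h : FlipCond K a b c d) : FlipCond (flip K a b c d) b a d c where
  pure := h.flip_pure
  ne := h.distinct.2.1
  abc := h.tri_diag.2 (Or.inl rfl) |>.swap'
  acd := h.tri_diag.2 (Or.inr rfl)
  only w hw := h.tri_diag.1 hw
  nadj ha := by
    obtain ⟨w, hw⟩ := (adj_iff h.flip_pure).1 ha
    exact h.not_tri_diag hw

/-- Together with `reverse`, this gives the converse of every one-sided statement about flips for
free. -/
theorem flip_flip (h : FlipCond K a b c d) : flip (flip K a b c d) b a d c = K := by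
  obtain ⟨n1, n2, n3, n4, n5, n6⟩ := h.distinct
  refine eq_of_tri_iff h.reverse.flip_pure h.pure fun u v w => ?_
  rw [h.reverse.tri_iff, h.tri_iff]
  have hn : Tri K u v w → (b = u ∨ b = v ∨ b = w) → (d = u ∨ d = v ∨ d = w) → False := by
    intro ht hb hd
    have := ht.adj h.pure
    have := h.nadj
    have := fun x y => @Adj.symm _ K x y
    have := h.ne
    grind
  have hy : (a = u ∨ a = v ∨ a = w) → (c = u ∨ c = v ∨ c = w) →
      (b = u ∨ b = v ∨ b = w) ∨ (d = u ∨ d = v ∨ d = w) → Tri K u v w := by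
    rintro h1 h2 (h3 | h3)
    · have := (triple_eq_iff n1 n2 n4).2 ⟨h1, h3, h2⟩
      unfold Tri
      rw [this]; exact h.abc
    · have := (triple_eq_iff n2 n3 n6).2 ⟨h1, h2, h3⟩
      unfold Tri
      rw [this]; exact h.acd
  have hk := h.mem_of_tri (u := u) (v := v) (w := w)
  clear n1 n2 n3 n4 n5 n6
  generalize (a = u ∨ a = v ∨ a = w) = A at hn hy hk ⊢
  generalize (b = u ∨ b = v ∨ b = w) = B at hn hy hk ⊢
  generalize (c = u ∨ c = v ∨ c = w) = C at hn hy hk ⊢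
  generalize (d = u ∨ d = v ∨ d = w) = D at hn hy hk ⊢
  generalize Tri K u v w = T at hn hy hk ⊢
  tauto

theorem adj_flip (h : FlipCond K a b c d) {u v : V} : Adj (flip K a b c d) u v ↔
    (Adj K u v ∧ ¬ (u = a ∧ v = c) ∧ ¬ (u = c ∧ v = a)) ∨ (u = b ∧ v = d) ∨ (u = d ∧ v = b) := by
  have key : ∀ {K : Finset (Finset V)} {a b c d : V}, FlipCond K a b c d → ∀ {u v : V}, Adj K u v →
      ¬ (u = a ∧ v = c) → ¬ (u = c ∧ v = a) → Adj (flip K a b c d) u v := by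
    intro K a b c d h u v huv h1 h2
    obtain ⟨n1, n2, n3, n4, n5, n6⟩ := h.distinct
    obtain ⟨w, hw⟩ := (adj_iff h.pure).1 huv
    -- If the face at `uv` is destroyed, it is `abc` or `acd`; as `uv` is not the diagonal, it is a
    -- side of the quadrilateral and lies in one of the new faces.
    by_cases hac : (a = u ∨ a = v ∨ a = w) ∧ (c = u ∨ c = v ∨ c = w)
    · have hL := h.reverse.acd.adj h.flip_pure
      have hL2 := h.reverse.abc.adj h.flip_pure
      have hk : w = a ∨ w = c := by grind
      have hs := fun x y => @Adj.symm _ (flip K a b c d) x y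
      have hu : (u = b ∨ u = d) ∨ (v = b ∨ v = d) := by
        have ho := h.only
        have hn := hw.ne h.pure
        rcases hk with rfl | rfl
        · rcases hac.2 with rfl | rfl | rfl
          · exact Or.inr (ho _ hw.rot.rot)
          · exact Or.inl (ho _ hw.rot.swap)
          · exact absurd rfl n2
        · rcases hac.1 with rfl | rfl | rfl
          · exact Or.inr (ho _ hw.swap')
          · exact Or.inl (ho _ hw.rot)
          · exact absurd rfl n2
      have hn := hw.ne h.pure
      grind
    · exact (adj_iff h.flip_pure).2 ⟨w, h.tri_iff.2 (Or.inl ⟨hw, hac⟩)⟩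
  constructor
  · intro hL
    by_cases h1 : (u = b ∧ v = d) ∨ (u = d ∧ v = b)
    · exact Or.inr h1
    · left
      have := key h.reverse hL (by tauto) (by tauto)
      rw [h.flip_flip] at this
      refine ⟨this, ?_, ?_⟩
      · rintro ⟨rfl, rfl⟩
        exact h.reverse.nadj hL
      · rintro ⟨rfl, rfl⟩
        exact h.reverse.nadj hL.symm
  · rintro (⟨h1, h2, h3⟩ | ⟨rfl, rfl⟩ | ⟨rfl, rfl⟩)
    · exact key h h1 h2 h3
    · exact (h.reverse.acd.adj h.flip_pure).1
    · exact (h.reverse.acd.adj h.flip_pure).1.symm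

theorem bdry_side (h : FlipCond K a b c d) :
    BdryEdge K a b ↔ BdryEdge (flip K a b c d) a b := by
  obtain ⟨n1, n2, n3, n4, n5, n6⟩ := h.distinct
  have h1 : ¬ Tri K a b d := fun ht => h.nadj (ht.adj h.pure).2.2
  have h2 := h.abc
  rw [bdryEdge_iff h.pure, bdryEdge_iff h.flip_pure]
  simp only [h.tri_side]
  constructor
  · rintro ⟨w, hw, hu⟩
    refine ⟨d, Or.inl rfl, ?_⟩
    rintro x (hx | ⟨hx, hx'⟩)
    · exact hx
    · exact absurd ((hu x hx').trans (hu c h2).symm) hx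
  · rintro ⟨w, hw, hu⟩
    refine ⟨c, h2, fun x hx => ?_⟩
    by_contra hxc
    have e1 := hu x (Or.inr ⟨hxc, hx⟩)
    have e2 := hu d (Or.inl rfl)
    rw [e1, ← e2] at hx
    exact h1 hx

/-- On each side of the quadrilateral one third vertex is exchanged for another, both diagonals are
inner edges where they occur, and no other edge is touched. -/
theorem bdryEdge_flip (h : FlipCond K a b c d) {u v : V} :
    BdryEdge (flip K a b c d) u v ↔ BdryEdge K u v := by
  have s1 := h.bdry_side
  have s2 := h.swap_bd.bdry_side
  have s3 := h.swap_ac.bdry_side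
  have s4 := h.swap_bd.swap_ac.bdry_side
  rw [h.flip_swap_bd] at s2
  rw [h.flip_swap_ac] at s3
  rw [h.swap_bd.flip_swap_ac, h.flip_swap_bd] at s4
  have sym : ∀ (K : Finset (Finset V)) (x y : V), BdryEdge K x y ↔ BdryEdge K y x :=
    fun K x y => ⟨BdryEdge.symm, BdryEdge.symm⟩
  have d1 : ¬ BdryEdge K a c := not_bdryEdge h.pure h.abc.swap' h.acd h.ne
  have d2 : ¬ BdryEdge (flip K a b c d) b d :=
    not_bdryEdge h.flip_pure h.reverse.abc.swap' h.reverse.acd h.distinct.2.1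
  have d3 : ¬ BdryEdge K b d := fun hb => h.nadj hb.adj
  have d4 : ¬ BdryEdge (flip K a b c d) a c := fun hb => h.reverse.nadj hb.adj
  by_cases g1 : (u = a ∨ u = c) ∧ (v = b ∨ v = d)
  · obtain ⟨rfl | rfl, rfl | rfl⟩ := g1
    exacts [s1.symm, s2.symm, s3.symm, s4.symm]
  by_cases g2 : (u = b ∨ u = d) ∧ (v = a ∨ v = c)
  · rw [sym, sym K]
    obtain ⟨rfl | rfl, rfl | rfl⟩ := g2
    exacts [s1.symm, s3.symm, s2.symm, s4.symm]
  by_cases g3 : u = a ∧ v = c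
  · obtain ⟨rfl, rfl⟩ := g3
    exact iff_of_false d4 d1
  by_cases g4 : u = c ∧ v = a
  · obtain ⟨rfl, rfl⟩ := g4
    rw [sym, sym K]
    exact iff_of_false d4 d1
  by_cases g5 : u = b ∧ v = d
  · obtain ⟨rfl, rfl⟩ := g5
    exact iff_of_false d2 d3
  by_cases g6 : u = d ∧ v = b
  · obtain ⟨rfl, rfl⟩ := g6
    rw [sym, sym K]
    exact iff_of_false d2 d3
  rw [bdryEdge_iff h.pure, bdryEdge_iff h.flip_pure]
  simp only [h.tri_far g1 g2 g3 g4 g5 g6]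

theorem bdryVertex_flip (h : FlipCond K a b c d) {u : V} :
    BdryVertex (flip K a b c d) u ↔ BdryVertex K u := by
  simp only [BdryVertex, h.bdryEdge_flip]

theorem verts_flip (h : FlipCond K a b c d) : verts (flip K a b c d) = verts K := by
  have key : ∀ {K : Finset (Finset V)} {a b c d : V}, FlipCond K a b c d → ∀ v, v ∈ verts K →
      v ∈ verts (flip K a b c d) := by
    intro K a b c d h v hv
    obtain ⟨w, hw⟩ := (mem_verts_iff_adj h.pure).1 hv
    by_cases hva : v = a
    · subst hva; exact (h.reverse.abc.adj h.flip_pure).1.mem_verts_right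
    by_cases hvc : v = c
    · subst hvc; exact (h.reverse.acd.adj h.flip_pure).2.1.mem_verts_right
    · exact (h.adj_flip.2 (Or.inl ⟨hw, by tauto, by tauto⟩)).mem_verts_left
  ext v
  refine ⟨fun hv => ?_, key h v⟩
  have := key h.reverse v hv
  rwa [h.flip_flip] at this

theorem deg_a (h : FlipCond K a b c d) : deg (flip K a b c d) a + 1 = deg K a := by
  obtain ⟨n1, n2, n3, n4, n5, n6⟩ := h.distinct
  have : nbrs (flip K a b c d) a = (nbrs K a).erase c := by
    ext w
    simp only [mem_nbrs, Finset.mem_erase, h.adj_flip]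
    simp [n1, n2, n3]
    tauto
  rw [deg_eq_card_nbrs, deg_eq_card_nbrs, this,
    Finset.card_erase_add_one (mem_nbrs.2 (h.abc.adj h.pure).2.1)]

theorem deg_c (h : FlipCond K a b c d) : deg (flip K a b c d) c + 1 = deg K c := by
  rw [← h.flip_swap_ac]; exact h.swap_ac.deg_a

theorem deg_b (h : FlipCond K a b c d) : deg (flip K a b c d) b = deg K b + 1 := by
  have := h.reverse.deg_a
  rw [h.flip_flip] at this
  exact this.symm

theorem deg_d (h : FlipCond K a b c d) : deg (flip K a b c d) d = deg K d + 1 := by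
  rw [← h.flip_swap_bd]; exact h.swap_bd.deg_b

theorem deg_other (h : FlipCond K a b c d) {v : V} (ha : v ≠ a) (hb : v ≠ b) (hc : v ≠ c)
    (hd : v ≠ d) : deg (flip K a b c d) v = deg K v := by
  rw [deg_eq_card_nbrs, deg_eq_card_nbrs]
  congr 1
  ext w
  simp only [mem_nbrs, h.adj_flip]
  simp [ha, hb, hc, hd]

/-- The ends of the old diagonal lose one degree and those of the new one gain one, so the degree
sum is constant; the vertices and the number of faces do not change. -/
theorem eulerChar_flip (h : FlipCond K a b c d) : eulerChar K = eulerChar (flip K a b c d) := by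
  obtain ⟨n1, n2, n3, n4, n5, n6⟩ := h.distinct
  have hE := sum_deg (K := K)
  have hE' := sum_deg (K := flip K a b c d)
  rw [h.verts_flip] at hE'
  have hF : (flip K a b c d).card = K.card := by
    rw [flip, Finset.card_union_of_disjoint, Finset.card_erase_of_mem, Finset.card_erase_of_mem,
      Finset.card_pair]
    · have : 2 ≤ K.card := by
        rw [← Finset.card_pair (a := ({a, b, c} : Finset V)) (b := {a, c, d})]
        · refine Finset.card_le_card ?_
          intro f hf
          simp only [Finset.mem_insert, Finset.mem_singleton] at hf
          rcases hf with rfl | rfl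
          exacts [h.abc, h.acd]
        · rw [Ne, triple_eq_iff n2 n3 n6]
          rintro ⟨-, -, h | h | h⟩
          exacts [n3 h.symm, n5 h.symm, n6 h.symm]
      omega
    · rw [Ne, triple_eq_iff n4 n5 n6]
      rintro ⟨-, h | h | h, -⟩
      exacts [n2 h.symm, n4 h.symm, n6 h]
    · exact h.abc
    · rw [Finset.mem_erase, Ne, triple_eq_iff n1 n2 n4]
      refine ⟨?_, h.acd⟩
      rintro ⟨-, h | h | h, -⟩
      exacts [n1 h.symm, n4 h, n5 h]
    · rw [Finset.disjoint_right]
      intro f hf hf'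
      have hfK := Finset.mem_of_mem_erase (Finset.mem_of_mem_erase hf')
      simp only [Finset.mem_insert, Finset.mem_singleton] at hf
      rcases hf with rfl | rfl
      · exact h.nadj ⟨n5, _, hfK, by simp, by simp⟩
      · exact h.nadj ⟨n5, _, hfK, by simp, by simp⟩
  have ma := (h.abc.adj h.pure).1.mem_verts_left
  have mb : b ∈ (verts K).erase a :=
    Finset.mem_erase.2 ⟨n1.symm, (h.abc.adj h.pure).1.mem_verts_right⟩
  have mc : c ∈ ((verts K).erase a).erase b := by
    simp only [Finset.mem_erase]
    exact ⟨n4.symm, n2.symm, (h.abc.adj h.pure).2.1.mem_verts_right⟩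
  have md : d ∈ (((verts K).erase a).erase b).erase c := by
    simp only [Finset.mem_erase]
    exact ⟨n6.symm, n5.symm, n3.symm, (h.acd.adj h.pure).2.1.mem_verts_right⟩
  rw [← Finset.add_sum_erase _ _ ma, ← Finset.add_sum_erase _ _ mb, ← Finset.add_sum_erase _ _ mc,
    ← Finset.add_sum_erase _ _ md] at hE hE'
  have hs : ∑ v ∈ ((((verts K).erase a).erase b).erase c).erase d, deg (flip K a b c d) v
      = ∑ v ∈ ((((verts K).erase a).erase b).erase c).erase d, deg K v := by
    refine Finset.sum_congr rfl fun v hv => ?_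
    simp only [Finset.mem_erase] at hv
    exact h.deg_other hv.2.2.2.1 hv.2.2.1 hv.2.1 hv.1
  have da := h.deg_a
  have db := h.deg_b
  have dc := h.deg_c
  have dd := h.deg_d
  have hE2 : (edges (flip K a b c d)).card = (edges K).card := by
    rw [hs] at hE'
    omega
  unfold eulerChar
  rw [h.verts_flip, hF, hE2]

theorem isSurface_flip (h : FlipCond K a b c d) (hK : IsSurface K) :
    IsSurface (flip K a b c d) where
  nonempty := ⟨_, h.reverse.abc⟩
  card_face := h.flip_pure
  edge_le_two := by
    rw [edge_le_two_iff h.flip_pure]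
    have side : ∀ {a b c d : V}, FlipCond K a b c d → ∀ x y z, Tri (flip K a b c d) a b x →
        Tri (flip K a b c d) a b y → Tri (flip K a b c d) a b z → x = y ∨ x = z ∨ y = z := by
      intro a b c d h x y z hx hy hz
      have hc := h.abc
      have r := fun x y => @IsSurface.two_thirds _ _ _ hK a b x y c
      rw [h.tri_side] at hx hy hz
      have r1 := r x y
      have r2 := r x z
      have r3 := r y z
      grind
    intro u v x y z hx hy hz
    have s1 := side h x y z
    have s2 := side h.swap_bd x y z
    have s3 := side h.swap_ac x y z
    have s4 := side h.swap_bd.swap_ac x y z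
    rw [h.flip_swap_bd] at s2
    rw [h.flip_swap_ac] at s3
    rw [h.swap_bd.flip_swap_ac, h.flip_swap_bd] at s4
    by_cases g1 : (u = a ∨ u = c) ∧ (v = b ∨ v = d)
    · obtain ⟨rfl | rfl, rfl | rfl⟩ := g1
      exacts [s1 hx hy hz, s2 hx hy hz, s3 hx hy hz, s4 hx hy hz]
    by_cases g2 : (u = b ∨ u = d) ∧ (v = a ∨ v = c)
    · obtain ⟨rfl | rfl, rfl | rfl⟩ := g2
      exacts [s1 hx.swap hy.swap hz.swap, s3 hx.swap hy.swap hz.swap, s2 hx.swap hy.swap hz.swap,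
        s4 hx.swap hy.swap hz.swap]
    by_cases g3 : u = a ∧ v = c
    · obtain ⟨rfl, rfl⟩ := g3
      exact absurd hx h.not_tri_diag
    by_cases g4 : u = c ∧ v = a
    · obtain ⟨rfl, rfl⟩ := g4
      exact absurd hx.swap h.not_tri_diag
    by_cases g5 : u = b ∧ v = d
    · obtain ⟨rfl, rfl⟩ := g5
      rw [h.tri_diag] at hx hy hz
      grind
    by_cases g6 : u = d ∧ v = b
    · obtain ⟨rfl, rfl⟩ := g6
      have hx := hx.swap
      have hy := hy.swap
      have hz := hz.swap
      rw [h.tri_diag] at hx hy hz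
      grind
    rw [h.tri_far g1 g2 g3 g4 g5 g6] at hx hy hz
    exact hK.two_thirds hx hy hz
  link_connected := by
    have la : ∀ {a b c d : V}, FlipCond K a b c d → ∀ p q, Adj (flip K a b c d) a p →
        Adj (flip K a b c d) a q → Relation.ReflTransGen (LinkAdj (flip K a b c d) a) p q := by
      intro a b c d h p q hp hq
      obtain ⟨n1, n2, n3, n4, n5, n6⟩ := h.distinct
      rw [h.adj_flip] at hp hq
      have hp' : Adj K a p ∧ p ≠ c := by grind
      have hq' : Adj K a q ∧ q ≠ c := by grind
      -- In the link of `a` the piece `b, c, d` is shortened to `b, d`; sending `c` to `b` turns old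
      -- walks into new ones.
      set r : V → V := fun x => if x = c then b else x with hr
      have rp : r p = p := by simp [hr, hp'.2]
      have rq : r q = q := by simp [hr, hq'.2]
      rw [← rp, ← rq]
      refine Relation.ReflTransGen.lift' r ?_ _ _ (hK.link_connected a p q hp'.1 hq'.1)
      intro x y hxy
      have hxy : Tri K a x y := hxy
      have hd : Tri (flip K a b c d) a b d := h.tri_side.2 (Or.inl rfl)
      have hn := hxy.ne h.pure
      change Relation.ReflTransGen _ (r x) (r y)
      by_cases hxc : x = c
      · subst hxc
        have : r x = b := by simp [hr]
        rw [this, show r y = y by simp [hr, hn.2.2.symm]]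
        rcases h.only y hxy with rfl | rfl
        · exact .refl
        · exact .single hd
      · by_cases hyc : y = c
        · subst hyc
          have : r y = b := by simp [hr]
          rw [this, show r x = x by simp [hr, hxc]]
          rcases h.only x hxy.swap' with rfl | rfl
          · exact .refl
          · exact .single hd.swap'
        · rw [show r x = x by simp [hr, hxc], show r y = y by simp [hr, hyc]]
          refine .single (h.tri_iff.2 (Or.inl ⟨hxy, ?_⟩))
          rintro ⟨-, h | h | h⟩
          exacts [n2 h.symm, hxc h.symm, hyc h.symm]
    have lb : ∀ {a b c d : V}, FlipCond K a b c d → ∀ p q, Adj (flip K a b c d) b p →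
        Adj (flip K a b c d) b q → Relation.ReflTransGen (LinkAdj (flip K a b c d) b) p q := by
      intro a b c d h p q hp hq
      obtain ⟨n1, n2, n3, n4, n5, n6⟩ := h.distinct
      have t1 : Tri (flip K a b c d) b a d := h.reverse.abc
      have t2 : Tri (flip K a b c d) b d c := h.reverse.acd
      -- In the link of `b` the edge `ac` is subdivided by `d`, so a step along it becomes two
      -- steps.
      have main : ∀ p q, Adj K b p → Adj K b q →
          Relation.ReflTransGen (LinkAdj (flip K a b c d) b) p q := by
        intro p q hp hq
        refine Relation.ReflTransGen.lift' id ?_ _ _ (hK.link_connected b p q hp hq)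
        intro x y hxy
        have hxy : Tri K b x y := hxy
        by_cases hc : (a = b ∨ a = x ∨ a = y) ∧ (c = b ∨ c = x ∨ c = y)
        · have : (x = a ∧ y = c) ∨ (x = c ∧ y = a) := by grind
          rcases this with ⟨rfl, rfl⟩ | ⟨rfl, rfl⟩
          · exact .head t1 (.single t2)
          · exact .head t2.swap' (.single t1.swap')
        · exact .single (h.tri_iff.2 (Or.inl ⟨hxy, hc⟩))
      have hba : Adj K b a := (h.abc.adj h.pure).1.symm
      rw [h.adj_flip] at hp hq
      have hp' : Adj K b p ∨ p = d := by grind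
      have hq' : Adj K b q ∨ q = d := by grind
      rcases hp' with hp' | rfl <;> rcases hq' with hq' | rfl
      · exact main p q hp' hq'
      · exact (main p a hp' hba).tail t1
      · exact .head t1.swap' (main a q hba hq')
      · exact .refl
    intro v p q hp hq
    by_cases hva : v = a
    · subst hva; exact la h p q hp hq
    by_cases hvc : v = c
    · subst hvc
      have := la h.swap_ac p q
      rw [h.flip_swap_ac] at this
      exact this hp hq
    by_cases hvb : v = b
    · subst hvb; exact lb h p q hp hq
    by_cases hvd : v = d
    · subst hvd
      have := lb h.swap_bd p q
      rw [h.flip_swap_bd] at this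
      exact this hp hq
    have hk : ∀ p, Adj (flip K a b c d) v p → Adj K v p := by
      intro p hp
      rw [h.adj_flip] at hp
      tauto
    refine Relation.ReflTransGen.mono ?_ _ _ (hK.link_connected v p q (hk p hp) (hk q hq))
    intro x y hxy
    have hxy : Tri K v x y := hxy
    refine h.tri_iff.2 (Or.inl ⟨hxy, ?_⟩)
    rintro ⟨h1 | h1 | h1, h2 | h2 | h2⟩ <;> subst_vars
    all_goals first | exact hva rfl | exact hvc rfl | exact h.distinct.2.1 rfl | skip
    · rcases h.only v hxy.rot with rfl | rfl
      exacts [hvb rfl, hvd rfl]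
    · rcases h.only v hxy.rot.swap with rfl | rfl
      exacts [hvb rfl, hvd rfl]
  connected := by
    obtain ⟨n1, n2, n3, n4, n5, n6⟩ := h.distinct
    intro u hu v hv
    rw [h.verts_flip] at hu hv
    refine Relation.ReflTransGen.lift' id ?_ _ _ (hK.connected u hu v hv)
    intro x y hxy
    have e1 : Adj (flip K a b c d) a b := (h.reverse.abc.adj h.flip_pure).1.symm
    have e2 : Adj (flip K a b c d) b c := (h.reverse.acd.adj h.flip_pure).2.1
    by_cases h1 : x = a ∧ y = c
    · obtain ⟨rfl, rfl⟩ := h1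
      exact .head e1 (.single e2)
    by_cases h2 : x = c ∧ y = a
    · obtain ⟨rfl, rfl⟩ := h2
      exact .head e2.symm (.single e1.symm)
    exact .single (h.adj_flip.2 (Or.inl ⟨hxy, h1, h2⟩))

theorem isPunctured_flip (h : FlipCond K a b c d) (hK : IsPunctured K) :
    IsPunctured (flip K a b c d) where
  toIsSurface := h.isSurface_flip hK.toIsSurface
  bdry_nonempty := by
    simp only [h.bdryEdge_flip]
    exact hK.bdry_nonempty
  bdry_connected := by
    intro u v hu hv
    rw [h.bdryVertex_flip] at hu hv
    refine Relation.ReflTransGen.mono ?_ _ _ (hK.bdry_connected u v hu hv)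
    intro x y hxy
    exact h.bdryEdge_flip.2 hxy

end FlipCond

/-! ### Diagonal flips and orientability. -/

namespace FlipCond

variable {a b c d : V}

theorem flip_rotations {α : Type*} {a b c d u v w : α} (n1 : a ≠ b) (n2 : a ≠ c) (n3 : a ≠ d)
    (n4 : b ≠ c) (n5 : b ≠ d) (n6 : c ≠ d) (s1 : u ≠ v) (s2 : u ≠ w) (s3 : v ≠ w)
    (hb : b = u ∨ b = v ∨ b = w) (hd : d = u ∨ d = v ∨ d = w)
    (hac : (a = u ∨ a = v ∨ a = w) ∨ (c = u ∨ c = v ∨ c = w)) :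
    (((u = a ∧ v = b ∧ w = d) ∨ (u = b ∧ v = d ∧ w = a) ∨ (u = d ∧ v = a ∧ w = b) ∨
      (u = b ∧ v = c ∧ w = d) ∨ (u = c ∧ v = d ∧ w = b) ∨ (u = d ∧ v = b ∧ w = c)) ↔
      ((v = a ∧ w = b ∧ u = d) ∨ (v = b ∧ w = d ∧ u = a) ∨ (v = d ∧ w = a ∧ u = b) ∨
      (v = b ∧ w = c ∧ u = d) ∨ (v = c ∧ w = d ∧ u = b) ∨ (v = d ∧ w = b ∧ u = c))) ∧
    (((u = a ∧ v = b ∧ w = d) ∨ (u = b ∧ v = d ∧ w = a) ∨ (u = d ∧ v = a ∧ w = b) ∨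
      (u = b ∧ v = c ∧ w = d) ∨ (u = c ∧ v = d ∧ w = b) ∨ (u = d ∧ v = b ∧ w = c)) ↔
      ¬ ((v = a ∧ u = b ∧ w = d) ∨ (v = b ∧ u = d ∧ w = a) ∨ (v = d ∧ u = a ∧ w = b) ∨
      (v = b ∧ u = c ∧ w = d) ∨ (v = c ∧ u = d ∧ w = b) ∨ (v = d ∧ u = b ∧ w = c))) := by
  constructor
  · constructor
    · rintro (⟨h, h', h''⟩ | ⟨h, h', h''⟩ | ⟨h, h', h''⟩ | ⟨h, h', h''⟩ | ⟨h, h', h''⟩ | ⟨h, h', h''⟩)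
      exacts [Or.inr (Or.inl ⟨h', h'', h⟩), Or.inr (Or.inr (Or.inl ⟨h', h'', h⟩)),
        Or.inl ⟨h', h'', h⟩, Or.inr (Or.inr (Or.inr (Or.inr (Or.inl ⟨h', h'', h⟩)))),
        Or.inr (Or.inr (Or.inr (Or.inr (Or.inr ⟨h', h'', h⟩)))),
        Or.inr (Or.inr (Or.inr (Or.inl ⟨h', h'', h⟩)))]
    · rintro (⟨h, h', h''⟩ | ⟨h, h', h''⟩ | ⟨h, h', h''⟩ | ⟨h, h', h''⟩ | ⟨h, h', h''⟩ | ⟨h, h', h''⟩)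
      exacts [Or.inr (Or.inr (Or.inl ⟨h'', h, h'⟩)), Or.inl ⟨h'', h, h'⟩,
        Or.inr (Or.inl ⟨h'', h, h'⟩),
        Or.inr (Or.inr (Or.inr (Or.inr (Or.inr ⟨h'', h, h'⟩)))),
        Or.inr (Or.inr (Or.inr (Or.inl ⟨h'', h, h'⟩))),
        Or.inr (Or.inr (Or.inr (Or.inr (Or.inl ⟨h'', h, h'⟩))))]
  have m1 := n1.symm
  have m2 := n2.symm
  have m3 := n3.symm
  have m4 := n4.symm
  have m5 := n5.symm
  have m6 := n6.symm
  rcases hb with rfl | rfl | rfl <;> rcases hd with rfl | rfl | rfl <;>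
    rcases hac with (rfl | rfl | rfl) | (rfl | rfl | rfl) <;>
    first | contradiction | simp only [*, not_false_eq_true, and_false, and_true, and_self,
      or_false, or_true, not_true_eq_false]

/-- After a possible global reversal, the faces `abc` and `acd` are oriented along the cyclic order
of the quadrilateral. The new faces `abd` and `bcd` take the same cyclic order and thus induce the
old directions on the four sides. -/
theorem orientable_flip (h : FlipCond K a b c d) (ho : Orientable K) :
    Orientable (flip K a b c d) := by
  obtain ⟨n1, n2, n3, n4, n5, n6⟩ := h.distinct
  have hb1 : ∀ w, ¬ Tri K b d w := fun w hw => h.nadj (hw.adj h.pure).1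
  have hb2 : ∀ w, ¬ Tri K d b w := fun w hw => h.nadj (hw.adj h.pure).1.symm
  obtain ⟨o, o1, o2, habc⟩ : ∃ o : V → V → V → Prop,
      (∀ u v w, Tri K u v w → (o u v w ↔ o v w u) ∧ (o u v w ↔ ¬ o v u w)) ∧
      (∀ u v w w', w ≠ w' → Tri K u v w → Tri K u v w' → (o u v w ↔ ¬ o u v w')) ∧ o a b c := by
    obtain ⟨o, o1, o2⟩ := ho
    by_cases habc : o a b c
    · exact ⟨o, o1, o2, habc⟩
    · refine ⟨fun u v w => o v u w, ?_, ?_, ?_⟩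
      · intro u v w ht
        exact ⟨(o1 w v u ht.rot.swap).1.symm, (o1 v u w ht.swap).2⟩
      · intro u v w w' hw h1 h2
        exact o2 v u w w' hw h1.swap h2.swap
      · have := (o1 a b c h.abc).2
        exact by_contra fun hh => habc (this.2 hh)
  have hbca : o b c a := (o1 a b c h.abc).1.1 habc
  have hcab : o c a b := (o1 b c a h.abc.rot).1.1 hbca
  have hacd : o a c d := by
    by_contra hh
    have := (o2 a c d b h.ne.symm h.acd h.abc.swap').not.1 hh
    rw [not_not] at this
    exact (o1 c a b h.abc.rot.rot).2.1 hcab this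
  have hcda : o c d a := (o1 a c d h.acd).1.1 hacd
  have hdac : o d a c := (o1 c d a h.acd.rot).1.1 hcda
  set o' : V → V → V → Prop := fun u v w =>
    (Tri K u v w ∧ ¬ ((a = u ∨ a = v ∨ a = w) ∧ (c = u ∨ c = v ∨ c = w)) ∧ o u v w) ∨
    (u = a ∧ v = b ∧ w = d) ∨ (u = b ∧ v = d ∧ w = a) ∨ (u = d ∧ v = a ∧ w = b) ∨
    (u = b ∧ v = c ∧ w = d) ∨ (u = c ∧ v = d ∧ w = b) ∨ (u = d ∧ v = b ∧ w = c) with ho'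
  have m1 : ∀ x u v w : V, (x = v ∨ x = w ∨ x = u) → (x = u ∨ x = v ∨ x = w) :=
    fun x u v w hh => by rcases hh with h | h | h <;> simp [h]
  have m2 : ∀ x u v w : V, (x = v ∨ x = u ∨ x = w) → (x = u ∨ x = v ∨ x = w) :=
    fun x u v w hh => by rcases hh with h | h | h <;> simp [h]
  have c1 : ∀ u v w, Tri (flip K a b c d) u v w →
      (o' u v w ↔ o' v w u) ∧ (o' u v w ↔ ¬ o' v u w) := by
    intro u v w ht
    rcases h.tri_iff.1 ht with ⟨hk, hac⟩ | ⟨hb, hd, hac⟩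
    · have hbd : ¬ ((b = u ∨ b = v ∨ b = w) ∧ (d = u ∨ d = v ∨ d = w)) := by
        rintro ⟨hb, hd⟩
        rcases hb with rfl | rfl | rfl <;> rcases hd with rfl | rfl | rfl
        exacts [n5 rfl, hb1 _ hk, hb1 _ hk.swap', hb2 _ hk, n5 rfl, hb1 _ hk.rot, hb2 _ hk.swap',
          hb2 _ hk.rot, n5 rfl]
      have e : ∀ x y z, Tri K x y z →
          ¬ ((a = x ∨ a = y ∨ a = z) ∧ (c = x ∨ c = y ∨ c = z)) →
          ¬ ((b = x ∨ b = y ∨ b = z) ∧ (d = x ∨ d = y ∨ d = z)) → (o' x y z ↔ o x y z) := by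
        intro x y z h1 h2 h3
        constructor
        · rintro (hh | ⟨rfl, rfl, rfl⟩ | ⟨rfl, rfl, rfl⟩ | ⟨rfl, rfl, rfl⟩ | ⟨rfl, rfl, rfl⟩ |
            ⟨rfl, rfl, rfl⟩ | ⟨rfl, rfl, rfl⟩)
          on_goal 1 => exact hh.2.2
          all_goals exact absurd (by simp) h3
        · exact fun hh => Or.inl ⟨h1, h2, hh⟩
      rw [e u v w hk hac hbd, e v w u hk.rot (fun hh => hac (hh.imp (m1 _ _ _ _) (m1 _ _ _ _)))
          (fun hh => hbd (hh.imp (m1 _ _ _ _) (m1 _ _ _ _))),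
        e v u w hk.swap (fun hh => hac (hh.imp (m2 _ _ _ _) (m2 _ _ _ _)))
          (fun hh => hbd (hh.imp (m2 _ _ _ _) (m2 _ _ _ _)))]
      exact o1 u v w hk
    · have hno : ∀ x y z, (b = x ∨ b = y ∨ b = z) → (d = x ∨ d = y ∨ d = z) → ¬ Tri K x y z := by
        intro x y z hb hd hk
        rcases hb with rfl | rfl | rfl <;> rcases hd with rfl | rfl | rfl
        exacts [n5 rfl, hb1 _ hk, hb1 _ hk.swap', hb2 _ hk, n5 rfl, hb1 _ hk.rot, hb2 _ hk.swap',
          hb2 _ hk.rot, n5 rfl]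
      have k1 := hno u v w hb hd
      have k2 := hno v w u (m1 _ _ _ _ (m1 _ _ _ _ hb)) (m1 _ _ _ _ (m1 _ _ _ _ hd))
      have k3 := hno v u w (m2 _ _ _ _ hb) (m2 _ _ _ _ hd)
      have s := ht.ne h.flip_pure
      simp only [ho', k1, k2, k3, false_and, false_or]
      exact flip_rotations n1 n2 n3 n4 n5 n6 s.1 s.2.1 s.2.2 hb hd hac
  refine ⟨o', c1, ?_⟩
  -- It suffices that two different faces at `uv` are not both positive: two negative ones would
  -- both be positive for `vu`.
  have c2 : ∀ u v w w', w ≠ w' → o' u v w → o' u v w' → False := by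
    have mixed : ∀ u v w w', Tri K u v w →
        ¬ ((a = u ∨ a = v ∨ a = w) ∧ (c = u ∨ c = v ∨ c = w)) → o u v w →
        ((u = a ∧ v = b ∧ w' = d) ∨ (u = b ∧ v = d ∧ w' = a) ∨ (u = d ∧ v = a ∧ w' = b) ∨
        (u = b ∧ v = c ∧ w' = d) ∨ (u = c ∧ v = d ∧ w' = b) ∨ (u = d ∧ v = b ∧ w' = c)) →
        False := by
      intro u v w w' hk hac hoo hh
      rcases hh with ⟨rfl, rfl, -⟩ | ⟨rfl, rfl, -⟩ | ⟨rfl, rfl, -⟩ | ⟨rfl, rfl, -⟩ |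
        ⟨rfl, rfl, -⟩ | ⟨rfl, rfl, -⟩
      · have hw : w ≠ c := by rintro rfl; exact hac (by simp)
        exact (o2 _ _ _ _ hw hk h.abc).1 hoo habc
      · exact hb1 _ hk
      · have hw : w ≠ c := by rintro rfl; exact hac (by simp)
        exact (o2 _ _ _ _ hw hk h.acd.rot.rot).1 hoo hdac
      · have hw : w ≠ a := by rintro rfl; exact hac (by simp)
        exact (o2 _ _ _ _ hw hk h.abc.rot).1 hoo hbca
      · have hw : w ≠ a := by rintro rfl; exact hac (by simp)
        exact (o2 _ _ _ _ hw hk h.acd.rot).1 hoo hcda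
      · exact hb2 _ hk
    have rots : ∀ u v w w', ((u = a ∧ v = b ∧ w = d) ∨ (u = b ∧ v = d ∧ w = a) ∨
        (u = d ∧ v = a ∧ w = b) ∨ (u = b ∧ v = c ∧ w = d) ∨ (u = c ∧ v = d ∧ w = b) ∨
        (u = d ∧ v = b ∧ w = c)) → ((u = a ∧ v = b ∧ w' = d) ∨ (u = b ∧ v = d ∧ w' = a) ∨
        (u = d ∧ v = a ∧ w' = b) ∨ (u = b ∧ v = c ∧ w' = d) ∨ (u = c ∧ v = d ∧ w' = b) ∨
        (u = d ∧ v = b ∧ w' = c)) → w = w' := by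
      clear * - n1 n2 n3 n4 n5 n6
      intro u v w w' h1 h2
      grind
    rintro u v w w' hw (h1 | h1) (h2 | h2)
    · exact (o2 _ _ _ _ hw h1.1 h2.1).1 h1.2.2 h2.2.2
    · exact mixed u v w w' h1.1 h1.2.1 h1.2.2 h2
    · exact mixed u v w' w h2.1 h2.2.1 h2.2.2 h1
    · exact hw (rots u v w w' h1 h2)
  intro u v w w' hw h1 h2
  constructor
  · exact fun h3 h4 => c2 u v w w' hw h3 h4
  · intro h3
    by_contra h4
    have h5 : o' v u w := by_contra fun h5 => h4 ((c1 u v w h1).2.2 h5)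
    have h6 : o' v u w' := by_contra fun h6 => h3 ((c1 u v w' h2).2.2 h6)
    exact c2 v u w w' hw h5 h6

theorem sameSurface (h : FlipCond K a b c d) (hK : IsPunctured K) :
    SameSurface K (flip K a b c d) := by
  refine ⟨hK, h.isPunctured_flip hK, h.eulerChar_flip, h.orientable_flip, fun ho => ?_⟩
  have := h.reverse.orientable_flip ho
  rwa [h.flip_flip] at this

end FlipCond

/-! ### Vertices of degree four -/

theorem card_le_deg {v : V} {S : Finset V} (h : ∀ q ∈ S, Adj K v q) : S.card ≤ deg K v := by
  rw [deg_eq_card_nbrs]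
  exact Finset.card_le_card fun q hq => mem_nbrs.2 (h q hq)

theorem five_le_deg {v a b c d e : V} (ha : Adj K v a) (hb : Adj K v b) (hc : Adj K v c)
    (hd : Adj K v d) (he : Adj K v e) (hn : [a, b, c, d, e].Nodup) : 5 ≤ deg K v := by
  have := card_le_deg (K := K) (v := v) (S := [a, b, c, d, e].toFinset) (by
    intro q hq
    simp only [List.mem_toFinset, List.mem_cons, List.not_mem_nil, or_false] at hq
    rcases hq with rfl | rfl | rfl | rfl | rfl <;> assumption)
  rwa [List.toFinset_card_of_nodup hn] at this

theorem four_le_deg {v a b c d : V} (ha : Adj K v a) (hb : Adj K v b) (hc : Adj K v c)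
    (hd : Adj K v d) (hn : [a, b, c, d].Nodup) : 4 ≤ deg K v := by
  have := card_le_deg (K := K) (v := v) (S := [a, b, c, d].toFinset) (by
    intro q hq
    simp only [List.mem_toFinset, List.mem_cons, List.not_mem_nil, or_false] at hq
    rcases hq with rfl | rfl | rfl | rfl <;> assumption)
  rwa [List.toFinset_card_of_nodup hn] at this

theorem deg_le_four {v a b c d : V} (h : ∀ w, Adj K v w → w = a ∨ w = b ∨ w = c ∨ w = d) :
    deg K v ≤ 4 :=
  (IsSurface.deg_le_of_nbrs (S := {a, b, c, d}) (by simpa using h)).trans Finset.card_le_four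

/-- Four distinct neighbours of a vertex of degree `4` are all its neighbours. -/
theorem nbr_of_deg_four {v a b c d : V} (hdeg : deg K v = 4) (ha : Adj K v a) (hb : Adj K v b)
    (hc : Adj K v c) (hd : Adj K v d) (hn : [a, b, c, d].Nodup) {w : V} (hw : Adj K v w) :
    w = a ∨ w = b ∨ w = c ∨ w = d := by
  by_contra! hne
  have := five_le_deg hw ha hb hc hd (by
    rw [List.nodup_cons]
    exact ⟨by simpa using hne, hn⟩)
  omega

/-- The link of `v` is the 4-cycle `acxy`. -/
structure Cyc (K : Finset (Finset V)) (v a c x y : V) : Prop where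
  t1 : Tri K v a c
  t2 : Tri K v c x
  t3 : Tri K v x y
  t4 : Tri K v y a
  ax : a ≠ x
  cy : c ≠ y

/-- The link of `v` is the path `pacq`. -/
structure Pth (K : Finset (Finset V)) (v p a c q : V) : Prop where
  t1 : Tri K v p a
  t2 : Tri K v a c
  t3 : Tri K v c q
  bp : BdryEdge K v p
  bq : BdryEdge K v q
  pc : p ≠ c
  aq : a ≠ q

namespace Cyc

variable {v a c x y : V}

theorem rot (h : Cyc K v a c x y) : Cyc K v c x y a :=
  ⟨h.t2, h.t3, h.t4, h.t1, h.cy, h.ax.symm⟩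

theorem refl (h : Cyc K v a c x y) : Cyc K v a y x c :=
  ⟨h.t4.swap', h.t3.swap', h.t2.swap', h.t1.swap', h.ax, h.cy.symm⟩

/-- The pairwise distinctness of `v, a, c, x, y`. -/
theorem ne (h : Cyc K v a c x y) (hK : IsSurface K) :
    v ≠ a ∧ v ≠ c ∧ v ≠ x ∧ v ≠ y ∧ a ≠ c ∧ a ≠ x ∧ a ≠ y ∧ c ≠ x ∧ c ≠ y ∧ x ≠ y := by
  have n1 := h.t1.ne hK.pure
  have n2 := h.t2.ne hK.pure
  have n3 := h.t3.ne hK.pure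
  have n4 := h.t4.ne hK.pure
  exact ⟨n1.1, n1.2.1, n2.2.1, n3.2.1, n1.2.2, h.ax, n4.2.2.symm, n2.2.2, h.cy, n3.2.2⟩

theorem nbr (h : Cyc K v a c x y) (hK : IsSurface K) {w : V} (hw : Adj K v w) :
    w = a ∨ w = c ∨ w = x ∨ w = y := by
  refine hK.nbrs_of_closed (P := fun w => w = a ∨ w = c ∨ w = x ∨ w = y)
    (h.t1.adj hK.pure).1 (Or.inl rfl) ?_ w hw
  have key : ∀ {a c x y q : V}, Cyc K v a c x y → Tri K v a q → q = c ∨ q = y := by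
    intro a c x y q h ht
    rcases hK.two_thirds h.t1 h.t4.swap' ht with e | e | e
    exacts [absurd e h.cy, Or.inl e.symm, Or.inr e.symm]
  intro p q hp hq
  rcases hp with rfl | rfl | rfl | rfl
  · rcases key h hq with e | e <;> simp [e]
  · rcases key h.rot hq with e | e <;> simp [e]
  · rcases key h.rot.rot hq with e | e <;> simp [e]
  · rcases key h.rot.rot.rot hq with e | e <;> simp [e]

theorem not_adj (h : Cyc K v a c x y) (hK : IsSurface K) {w : V} (h1 : w ≠ a) (h2 : w ≠ c)
    (h3 : w ≠ x) (h4 : w ≠ y) : ¬ Adj K v w := by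
  intro hw
  rcases h.nbr hK hw with e | e | e | e
  exacts [h1 e, h2 e, h3 e, h4 e]

theorem third (h : Cyc K v a c x y) (hK : IsSurface K) {q : V} (ht : Tri K v a q) :
    q = c ∨ q = y := by
  rcases hK.two_thirds h.t1 h.t4.swap' ht with e | e | e
  exacts [absurd e h.cy, Or.inl e.symm, Or.inr e.symm]

theorem inner (h : Cyc K v a c x y) (hK : IsSurface K) : ¬ BdryVertex K v := by
  rintro ⟨w, hw⟩
  rcases h.nbr hK hw.adj with rfl | rfl | rfl | rfl
  · exact h.cy (hw.unique hK.pure h.t1 h.t4.swap')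
  · exact h.ax (hw.unique hK.pure h.t1.swap' h.t2)
  · exact h.cy (hw.unique hK.pure h.t2.swap' h.t3)
  · exact h.ax (hw.unique hK.pure h.t4 h.t3.swap')

theorem deg_eq (h : Cyc K v a c x y) (hK : IsSurface K) : deg K v = 4 := by
  obtain ⟨-, -, -, -, n1, n2, n3, n4, n5, n6⟩ := h.ne hK
  refine le_antisymm (deg_le_four fun w hw => h.nbr hK hw) ?_
  exact four_le_deg (h.t1.adj hK.pure).1 (h.t2.adj hK.pure).1 (h.t3.adj hK.pure).1
    (h.t4.adj hK.pure).1 (by simp [n1, n2, n3, n4, n5, n6])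

end Cyc

namespace Pth

variable {v p a c q : V}

theorem symm (h : Pth K v p a c q) : Pth K v q c a p :=
  ⟨h.t3.swap', h.t2.swap', h.t1.swap', h.bq, h.bp, h.aq.symm, h.pc.symm⟩

/-- The pairwise distinctness of `v, p, a, c, q`. -/
theorem ne (h : Pth K v p a c q) (hK : IsSurface K) :
    v ≠ p ∧ v ≠ a ∧ v ≠ c ∧ v ≠ q ∧ p ≠ a ∧ p ≠ c ∧ p ≠ q ∧ a ≠ c ∧ a ≠ q ∧ c ≠ q := by
  have n1 := h.t1.ne hK.pure
  have n2 := h.t2.ne hK.pure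
  have n3 := h.t3.ne hK.pure
  refine ⟨n1.1, n1.2.1, n2.2.1, n3.2.1, n1.2.2, h.pc, ?_, n2.2.2, h.aq, n3.2.2⟩
  rintro rfl
  exact n2.2.2 (h.bp.unique hK.pure h.t1 h.t3.swap')

theorem nbr (h : Pth K v p a c q) (hK : IsSurface K) {w : V} (hw : Adj K v w) :
    w = p ∨ w = a ∨ w = c ∨ w = q := by
  refine hK.nbrs_of_closed (P := fun w => w = p ∨ w = a ∨ w = c ∨ w = q)
    (h.t1.adj hK.pure).1 (Or.inl rfl) ?_ w hw
  have key : ∀ {p a c q r : V}, Pth K v p a c q → Tri K v a r → r = p ∨ r = c := by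
    intro p a c q r h ht
    rcases hK.two_thirds h.t1.swap' h.t2 ht with e | e | e
    exacts [absurd e h.pc, Or.inl e.symm, Or.inr e.symm]
  intro x y hx hy
  rcases hx with rfl | rfl | rfl | rfl
  · exact Or.inr (Or.inl (h.bp.unique hK.pure hy h.t1))
  · rcases key h hy with e | e <;> simp [e]
  · rcases key h.symm hy with e | e <;> simp [e]
  · exact Or.inr (Or.inr (Or.inl (h.bq.unique hK.pure hy h.t3.swap')))

theorem not_adj (h : Pth K v p a c q) (hK : IsSurface K) {w : V} (h1 : w ≠ p) (h2 : w ≠ a)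
    (h3 : w ≠ c) (h4 : w ≠ q) : ¬ Adj K v w := by
  intro hw
  rcases h.nbr hK hw with e | e | e | e
  exacts [h1 e, h2 e, h3 e, h4 e]

theorem deg_eq (h : Pth K v p a c q) (hK : IsSurface K) : deg K v = 4 := by
  obtain ⟨-, -, -, -, n1, n2, n3, n4, n5, n6⟩ := h.ne hK
  refine le_antisymm (deg_le_four fun w hw => h.nbr hK hw) ?_
  exact four_le_deg (h.t1.adj hK.pure).1 (h.t2.adj hK.pure).1 (h.t3.adj hK.pure).1
    (h.t3.adj hK.pure).2.1 (by simp [n1, n2, n3, n4, n5, n6])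

end Pth

namespace IsSurface

/-- The link continues from `a` to `y` and from `c` to `x`. These differ, as a triangle in the link
would give degree 3; so `a, c, x, y` are all the neighbours, and the next vertex after `x` can only
be `y`. -/
theorem exists_cyc (hK : IsSurface K) {v a c : V} (hd : deg K v = 4) (hv : ¬ BdryVertex K v)
    (ht : Tri K v a c) : ∃ x y, Cyc K v a c x y := by
  obtain ⟨x, hx, hxa⟩ := exists_other hK.pure ht.swap' fun h => hv h.left
  obtain ⟨y, hy, hyc⟩ := exists_other hK.pure ht fun h => hv h.left
  have n1 := ht.ne hK.pure
  have n2 := hx.ne hK.pure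
  have n3 := hy.ne hK.pure
  have hxy : x ≠ y := by
    rintro rfl
    have := hK.deg_le_three ht hx hy
    omega
  obtain ⟨w, hw, hwc⟩ := exists_other hK.pure hx.swap' fun h => hv h.left
  have n4 := hw.ne hK.pure
  rcases nbr_of_deg_four hd (ht.adj hK.pure).1 (hx.adj hK.pure).1 (hx.adj hK.pure).2.1
    (hy.adj hK.pure).2.1 (by simp [n1.2.2, hxa.symm, n3.2.2, n2.2.2, hyc.symm, hxy])
    (hw.adj hK.pure).2.1 with rfl | rfl | rfl | rfl
  · have := hK.deg_le_three ht hx hw.swap'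
    omega
  · exact absurd rfl hwc
  · exact absurd rfl n4.2.2
  · exact ⟨x, w, ht, hx, hw, hy.swap', hxa.symm, hyc.symm⟩

theorem exists_pth (hK : IsSurface K) {v p a : V} (hd : deg K v = 4) (hp : BdryEdge K v p)
    (ht : Tri K v p a) : ∃ c q, Pth K v p a c q := by
  obtain ⟨q, hq, hqp⟩ := hK.exists_bdry_ne hp.left p
  obtain ⟨c, hc⟩ := (adj_iff hK.pure).1 hq.adj
  have n1 := ht.ne hK.pure
  have n2 := hc.ne hK.pure
  have haq : a ≠ q := by
    rintro rfl
    have := hK.deg_le_two hp hq ht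
    omega
  have hpc : p ≠ c := by
    rintro rfl
    exact haq (hp.unique hK.pure ht hc.swap')
  have hac : a ≠ c := by
    rintro rfl
    have := hK.deg_le_three_of_bdry hp hq ht hc.swap' hqp.symm
    omega
  have hva : ¬ BdryEdge K v a := by
    intro h
    rcases hK.bdry_three hp hq h with e | e | e
    exacts [hqp e.symm, n1.2.2 e, haq e.symm]
  obtain ⟨w, hw, hwp⟩ := exists_other hK.pure ht.swap' hva
  have n3 := hw.ne hK.pure
  rcases nbr_of_deg_four hd (ht.adj hK.pure).1 (ht.adj hK.pure).2.1 (hc.adj hK.pure).1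
    (hc.adj hK.pure).2.1 (by simp [n1.2.2, hqp.symm, hpc, haq, hac, n2.2.2])
    (hw.adj hK.pure).2.1 with rfl | rfl | rfl | rfl
  · exact absurd rfl hwp
  · exact absurd rfl n3.2.2
  · exact absurd (hq.unique hK.pure hw.swap' hc) hac
  · exact ⟨w, q, ht, hw, hc.swap', hp, hq, hpc, haq⟩

theorem exists_pth_mid (hK : IsSurface K) {v a : V} (hd : deg K v = 4) (hv : BdryVertex K v)
    (ha : Adj K v a) (hb : ¬ BdryEdge K v a) : ∃ p c q, Pth K v p a c q := by
  obtain ⟨p, hp⟩ := hv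
  obtain ⟨x, hx⟩ := (adj_iff hK.pure).1 hp.adj
  obtain ⟨c, q, h⟩ := hK.exists_pth hd hp hx
  rcases h.nbr hK ha with rfl | rfl | rfl | rfl
  · exact absurd h.bp hb
  · exact ⟨_, _, _, h⟩
  · exact ⟨_, _, _, h.symm⟩
  · exact absurd h.bq hb

end IsSurface

/-! ### Reducible triangulations -/

/-- After some flips, a 4-reduction that lowers the number of vertices is possible. -/
def Reducible (K : Finset (Finset V)) : Prop :=
  ∃ L L', Relation.ReflTransGen DiagonalFlip K L ∧ FourReduction L L' ∧
    (verts L').card < (verts K).card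

namespace InF4

theorem surf (h : InF4 K) : IsSurface K := h.1.toIsSurface

theorem pure (h : InF4 K) : Pure3 K := h.surf.pure

theorem deg_ge (h : InF4 K) {u v : V} (huv : Adj K u v) : 4 ≤ deg K u :=
  h.2 u huv.mem_verts_left

theorem linkCond (h : InF4 K) {a b : V} (hab : Adj K a b)
    (hc : ∀ c, Adj K a c → Adj K b c → Tri K a b c) : LinkCond K a b where
  punctured := h.1
  adj := hab
  common := hc
  deg_ge := fun v hv => (h.2 v hv).trans' (by norm_num)
  deg_end := Or.inl (h.deg_ge hab)

theorem linkCond_of_contractible (h : InF4 K) {a b : V} (hab : Contractible K a b) :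
    LinkCond K a b := h.linkCond hab.1 hab.2.1

theorem contractible (h : InF4 K) {a b : V} (hab : Adj K a b)
    (hb : BdryEdge K a b ∨ ¬ BdryVertex K a ∨ ¬ BdryVertex K b)
    (hc : ∀ c, Adj K a c → Adj K b c → Tri K a b c) : Contractible K a b :=
  ⟨hab, hc, (h.linkCond hab hc).sameSurface hb⟩

/-- Only the third vertices at `ab` lose a degree, so they must have degree 5. The merged vertex is
safe: its degree is at least 4 + 4 − 2 − 2. -/
theorem reducible_of_contract (h : InF4 K) {a b : V} (hab : Adj K a b)
    (hb : BdryEdge K a b ∨ ¬ BdryVertex K a ∨ ¬ BdryVertex K b)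
    (hc : ∀ c, Adj K a c → Adj K b c → Tri K a b c ∧ 5 ≤ deg K c) : Reducible K := by
  have hl := h.linkCond hab fun c h1 h2 => (hc c h1 h2).1
  have hs := hl.sameSurface hb
  have hcard := hl.card_verts
  refine ⟨K, contract K a b, .refl, ⟨h, ⟨hs.2.1, ?_⟩, hs, Or.inl ⟨a, b,
    h.contractible hab hb fun c h1 h2 => (hc c h1 h2).1, rfl⟩⟩, by omega⟩
  intro v hv
  rw [hl.verts_contract, Finset.mem_erase] at hv
  by_cases hva : v = a
  · subst hva
    have h1 := hl.deg_left
    have h2 := hl.card_thirds_le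
    have h3 := h.deg_ge hab
    have h4 := h.deg_ge hab.symm
    omega
  · by_cases ht : Tri K a b v
    · have h1 := hl.deg_of_tri ht
      have h2 := hc v (ht.adj h.pure).2.1 (ht.adj h.pure).2.2
      omega
    · rw [hl.deg_of_not_tri hva hv.1 ht]
      exact h.2 v hv.2

theorem flipCond (h : InF4 K) {a b c d : V} (h1 : Tri K a b c) (h2 : Tri K a c d) (hbd : b ≠ d)
    (hn : ¬ Adj K b d) : FlipCond K a b c d where
  pure := h.pure
  ne := hbd
  abc := h1
  acd := h2
  only := fun w hw => by
    rcases h.surf.two_thirds h1.swap' h2 hw with e | e | e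
    exacts [absurd e hbd, Or.inl e.symm, Or.inr e.symm]
  nadj := hn

theorem flip (h : InF4 K) {a b c d : V} (hf : FlipCond K a b c d) (ha : 5 ≤ deg K a)
    (hc : 5 ≤ deg K c) : InF4 (flip K a b c d) := by
  refine ⟨hf.isPunctured_flip h.1, fun v hv => ?_⟩
  rw [hf.verts_flip] at hv
  have h0 := h.2 v hv
  by_cases h1 : v = a
  · subst h1
    have := hf.deg_a
    omega
  by_cases h2 : v = b
  · subst h2
    have := hf.deg_b
    omega
  by_cases h3 : v = c
  · subst h3
    have := hf.deg_c
    omega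
  by_cases h4 : v = d
  · subst h4
    have := hf.deg_d
    omega
  rwa [hf.deg_other h1 h2 h3 h4]

theorem reducible_of_flip (h : InF4 K) {a b c d : V} (hf : FlipCond K a b c d)
    (ha : 5 ≤ deg K a) (hc : 5 ≤ deg K c) (hr : Reducible (SurfTri.flip K a b c d)) :
    Reducible K := by
  obtain ⟨L, L', h1, h2, h3⟩ := hr
  have hd : DiagonalFlip K (SurfTri.flip K a b c d) :=
    ⟨h, h.flip hf ha hc, hf.sameSurface h.1, a, b, c, d, hf.ne, hf.abc, hf.acd, hf.nadj, rfl⟩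
  exact ⟨L, L', .head hd h1, h2, by rwa [hf.verts_flip] at h3⟩

end InF4

/-- Contraction of the edge from a 4-valent inner vertex to a neighbour. -/
theorem Cyc.contract {v a c x y : V} (hK : InF4 K) (h : Cyc K v a c x y) (hax : ¬ Adj K a x) :
    deg K c = 4 ∨ deg K y = 4 ∨ Reducible K := by
  by_contra! hc
  have h4 := hK.deg_ge (h.t1.adj hK.pure).2.1.symm
  have h5 := hK.deg_ge (h.t4.adj hK.pure).1.symm
  refine hc.2.2 (hK.reducible_of_contract (h.t1.adj hK.pure).1
    (Or.inr (Or.inl (h.inner hK.surf))) fun w h1 h2 => ?_)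
  rcases h.nbr hK.surf h1 with rfl | rfl | rfl | rfl
  · exact absurd rfl h2.1
  · exact ⟨h.t1, by omega⟩
  · exact absurd h2 hax
  · exact ⟨h.t4.swap', by omega⟩

/-- Contraction of an inner edge from a 4-valent boundary vertex to a neighbour. -/
theorem Pth.contract_inner {v p a c q : V} (hK : InF4 K) (h : Pth K v p a c q)
    (haq : ¬ Adj K a q) (ha : ¬ BdryVertex K a) : deg K p = 4 ∨ deg K c = 4 ∨ Reducible K := by
  by_contra! hc
  have h4 := hK.deg_ge (h.t1.adj hK.pure).1.symm
  have h5 := hK.deg_ge (h.t2.adj hK.pure).2.1.symm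
  refine hc.2.2 (hK.reducible_of_contract (h.t2.adj hK.pure).1
    (Or.inr (Or.inr ha)) fun w h1 h2 => ?_)
  rcases h.nbr hK.surf h1 with rfl | rfl | rfl | rfl
  · exact ⟨h.t1.swap', by omega⟩
  · exact absurd rfl h2.1
  · exact ⟨h.t2, by omega⟩
  · exact absurd h2 haq

/-- Contraction of a boundary edge at a 4-valent boundary vertex. -/
theorem Pth.contract_end {v p a c q : V} (hK : InF4 K) (h : Pth K v p a c q)
    (hpc : ¬ Adj K p c) (hpq : ¬ Adj K p q) : deg K a = 4 ∨ Reducible K := by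
  by_contra! hc
  have h4 := hK.deg_ge (h.t1.adj hK.pure).2.1.symm
  refine hc.2 (hK.reducible_of_contract (h.t1.adj hK.pure).1 (Or.inl h.bp) fun w h1 h2 => ?_)
  rcases h.nbr hK.surf h1 with rfl | rfl | rfl | rfl
  · exact absurd rfl h2.1
  · exact ⟨h.t1, by omega⟩
  · exact absurd h2 hpc
  · exact absurd h2 hpq

theorem FlipCond.tri_away {a b c d v p q : V} (h : FlipCond K a b c d) (ha : v ≠ a) (hb : v ≠ b)
    (hc : v ≠ c) (hd : v ≠ d) : Tri (flip K a b c d) v p q ↔ Tri K v p q :=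
  h.tri_far (by tauto) (by tauto) (by tauto) (by tauto) (by tauto) (by tauto)

theorem Cyc.flip {a b c d v p q r s : V} (hc : Cyc K v p q r s) (h : FlipCond K a b c d)
    (h1 : v ≠ a) (h2 : v ≠ b) (h3 : v ≠ c) (h4 : v ≠ d) :
    Cyc (SurfTri.flip K a b c d) v p q r s :=
  ⟨(h.tri_away h1 h2 h3 h4).2 hc.t1, (h.tri_away h1 h2 h3 h4).2 hc.t2,
    (h.tri_away h1 h2 h3 h4).2 hc.t3, (h.tri_away h1 h2 h3 h4).2 hc.t4, hc.ax, hc.cy⟩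

theorem Pth.flip {a b c d v p q r s : V} (hc : Pth K v p q r s) (h : FlipCond K a b c d)
    (h1 : v ≠ a) (h2 : v ≠ b) (h3 : v ≠ c) (h4 : v ≠ d) :
    Pth (SurfTri.flip K a b c d) v p q r s :=
  ⟨(h.tri_away h1 h2 h3 h4).2 hc.t1, (h.tri_away h1 h2 h3 h4).2 hc.t2,
    (h.tri_away h1 h2 h3 h4).2 hc.t3, h.bdryEdge_flip.2 hc.bp, h.bdryEdge_flip.2 hc.bq,
    hc.pc, hc.aq⟩

theorem nodup_five {α : Type*} {a b c d e : α} (h : a ≠ b ∧ a ≠ c ∧ a ≠ d ∧ a ≠ e)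
    (h' : b ≠ c ∧ b ≠ d ∧ b ≠ e) (h'' : c ≠ d ∧ c ≠ e ∧ d ≠ e) : [a, b, c, d, e].Nodup := by
  simp [h.1, h.2.1, h.2.2.1, h.2.2.2, h'.1, h'.2.1, h'.2.2, h''.1, h''.2.1, h''.2.2]

theorem nodup_four {α : Type*} {a b c d : α} (h : a ≠ b ∧ a ≠ c ∧ a ≠ d)
    (h' : b ≠ c ∧ b ≠ d ∧ c ≠ d) : [a, b, c, d].Nodup := by
  simp [h.1, h.2.1, h.2.2, h'.1, h'.2.1, h'.2.2]

/-! ### Octahedra and octahedra with one boundary vertex in the center. -/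

/-- Pairwise distinctness of six vertices. -/
def Distinct (v₁ v₂ v₃ a₁ a₂ a₃ : V) : Prop :=
  (v₁ ≠ v₂ ∧ v₁ ≠ v₃ ∧ v₁ ≠ a₁ ∧ v₁ ≠ a₂ ∧ v₁ ≠ a₃) ∧ (v₂ ≠ v₃ ∧ v₂ ≠ a₁ ∧ v₂ ≠ a₂ ∧ v₂ ≠ a₃) ∧
    (v₃ ≠ a₁ ∧ v₃ ≠ a₂ ∧ v₃ ≠ a₃) ∧ (a₁ ≠ a₂ ∧ a₁ ≠ a₃ ∧ a₂ ≠ a₃)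

/-- The seven faces of an octahedron without the face `a₁a₂a₃`. -/
structure Oct (K : Finset (Finset V)) (v₁ v₂ v₃ a₁ a₂ a₃ : V) : Prop where
  ne : Distinct v₁ v₂ v₃ a₁ a₂ a₃
  t : Tri K v₁ v₂ v₃
  t₁ : Tri K v₂ v₃ a₁
  t₂ : Tri K v₃ v₁ a₂
  t₃ : Tri K v₁ v₂ a₃
  u₁ : Tri K v₁ a₂ a₃
  u₂ : Tri K v₂ a₃ a₁
  u₃ : Tri K v₃ a₁ a₂

theorem Cyc.tri_transfer {v a c x y : V} (h : Cyc K v a c x y) (hK : IsSurface K)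
    (h' : Cyc L v a c x y) {p q : V} (ht : Tri K v p q) : Tri L v p q := by
  have key : ∀ {a c x y : V}, Cyc K v a c x y → Cyc L v a c x y → ∀ {q}, Tri K v a q →
      Tri L v a q := by
    intro a c x y h h' q ht
    rcases h.third hK ht with rfl | rfl
    exacts [h'.t1, h'.t4.swap']
  rcases h.nbr hK (ht.adj hK.pure).1 with rfl | rfl | rfl | rfl
  exacts [key h h' ht, key h.rot h'.rot ht, key h.rot.rot h'.rot.rot ht,
    key h.rot.rot.rot h'.rot.rot.rot ht]

namespace Oct

variable {v₁ v₂ v₃ a₁ a₂ a₃ : V}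

theorem rot (h : Oct K v₁ v₂ v₃ a₁ a₂ a₃) : Oct K v₂ v₃ v₁ a₂ a₃ a₁ := by
  obtain ⟨⟨n1, n2, n3, n4⟩, t, t₁, t₂, t₃, u₁, u₂, u₃⟩ := h
  exact ⟨⟨⟨n2.1, n1.1.symm, n2.2.2.1, n2.2.2.2, n2.2.1⟩,
    ⟨n1.2.1.symm, n3.2.1, n3.2.2, n3.1⟩, ⟨n1.2.2.2.1, n1.2.2.2.2, n1.2.2.1⟩,
    n4.2.2, n4.1.symm, n4.2.1.symm⟩, t.rot, t₂, t₃, t₁, u₂, u₃, u₁⟩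

theorem cyc (h : Oct K v₁ v₂ v₃ a₁ a₂ a₃) : Cyc K v₁ v₂ v₃ a₂ a₃ :=
  ⟨h.t, h.t₂.swap, h.u₁, h.t₃.swap', h.ne.2.1.2.2.1, h.ne.2.2.1.2.2⟩

/-- The closed octahedron is not punctured. -/
theorem not_tri (h : Oct K v₁ v₂ v₃ a₁ a₂ a₃) (hK : IsPunctured K) : ¬ Tri K a₁ a₂ a₃ := by
  intro ht
  have hs := hK.toIsSurface
  -- With the eighth face all six links are closed 4-cycles. By connectedness there are no further
  -- vertices, and no vertex is on the boundary.
  have key : ∀ {v₁ v₂ v₃ a₁ a₂ a₃ : V}, Oct K v₁ v₂ v₃ a₁ a₂ a₃ → Tri K a₁ a₂ a₃ →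
      Cyc K a₁ v₂ v₃ a₂ a₃ := fun h ht =>
    ⟨h.t₁.rot.rot, h.u₃.swap, ht, h.u₂.rot.rot.swap', h.ne.2.1.2.2.1, h.ne.2.2.1.2.2⟩
  have c1 := h.cyc
  have c2 := h.rot.cyc
  have c3 := h.rot.rot.cyc
  have c4 := key h ht
  have c5 := key h.rot ht.rot
  have c6 := key h.rot.rot ht.rot.rot
  obtain ⟨u, w, huw⟩ := hK.bdry_nonempty
  have := hs.verts_of_closed (P := fun v => v = v₁ ∨ v = v₂ ∨ v = v₃ ∨ v = a₁ ∨ v = a₂ ∨ v = a₃)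
    (h.t.adj hs.pure).1.mem_verts_left (Or.inl rfl) (by
      rintro x y (rfl | rfl | rfl | rfl | rfl | rfl) hxy
      · rcases c1.nbr hs hxy with e | e | e | e <;> simp [e]
      · rcases c2.nbr hs hxy with e | e | e | e <;> simp [e]
      · rcases c3.nbr hs hxy with e | e | e | e <;> simp [e]
      · rcases c4.nbr hs hxy with e | e | e | e <;> simp [e]
      · rcases c5.nbr hs hxy with e | e | e | e <;> simp [e]
      · rcases c6.nbr hs hxy with e | e | e | e <;> simp [e]) u huw.adj.mem_verts_left
  rcases this with rfl | rfl | rfl | rfl | rfl | rfl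
  exacts [c1.inner hs huw.left, c2.inner hs huw.left, c3.inner hs huw.left,
    c4.inner hs huw.left, c5.inner hs huw.left, c6.inner hs huw.left]

theorem octaFaces (hn : Distinct v₁ v₂ v₃ a₁ a₂ a₃) :
    Oct (octaFaces v₁ v₂ v₃ a₁ a₂ a₃) v₁ v₂ v₃ a₁ a₂ a₃ where
  ne := hn
  t := by simp [Tri, SurfTri.octaFaces]
  t₁ := by simp [Tri, SurfTri.octaFaces]
  t₂ := Tri.swap (a := v₁) (b := v₃) (by simp [Tri, SurfTri.octaFaces])
  t₃ := by simp [Tri, SurfTri.octaFaces]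
  u₁ := by simp [Tri, SurfTri.octaFaces]
  u₂ := Tri.swap' (b := a₁) (c := a₃) (by simp [Tri, SurfTri.octaFaces])
  u₃ := by simp [Tri, SurfTri.octaFaces]

theorem card_octaFaces (hn : Distinct v₁ v₂ v₃ a₁ a₂ a₃) :
    (SurfTri.octaFaces v₁ v₂ v₃ a₁ a₂ a₃).card = 7 := by
  obtain ⟨⟨b1, b2, b3, b4, b5⟩, ⟨b6, b7, b8, b9⟩, ⟨b10, b11, b12⟩, b13, b14, b15⟩ := hn
  -- The count is transported to six concrete labels, where it is decidable.
  set f : Fin 6 → V := ![v₁, v₂, v₃, a₁, a₂, a₃] with hf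
  have hinj : Function.Injective f := by
    refine List.nodup_ofFn.1 ?_
    simp [hf, List.ofFn_succ, b1, b2, b3, b4, b5, b6, b7, b8, b9, b10, b11, b12, b13, b14, b15]
  have : SurfTri.octaFaces v₁ v₂ v₃ a₁ a₂ a₃ =
      (SurfTri.octaFaces (0 : Fin 6) 1 2 3 4 5).image (Finset.image f) := by
    simp [SurfTri.octaFaces, Finset.image_insert, hf]
  rw [this, Finset.card_image_of_injective _ (Finset.image_injective hinj)]
  decide

/-- An octahedron without a face triangulates the disk. -/
theorem isDisk (h : Oct K v₁ v₂ v₃ a₁ a₂ a₃) (hK : IsPunctured K) (b₁ : BdryEdge K a₂ a₃)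
    (b₂ : BdryEdge K a₃ a₁) (b₃ : BdryEdge K a₁ a₂) : IsDisk K := by
  have hs := hK.toIsSurface
  have c1 := h.cyc
  have c2 := h.rot.cyc
  have c3 := h.rot.rot.cyc
  have key : ∀ {v₁ v₂ v₃ a₁ a₂ a₃ : V}, Oct K v₁ v₂ v₃ a₁ a₂ a₃ → BdryEdge K a₁ a₂ →
      BdryEdge K a₃ a₁ → Pth K a₁ a₂ v₃ v₂ a₃ := fun h b₃ b₂ =>
    ⟨h.u₃.rot, h.t₁.rot.rot.swap', h.u₂.rot.rot, b₃, b₂.symm,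
      h.ne.2.1.2.2.1.symm, h.ne.2.2.1.2.2⟩
  have p1 := key h b₃ b₂
  have p2 := key h.rot b₁ b₃
  have p3 := key h.rot.rot b₂ b₁
  have hall := hs.verts_of_closed
    (P := fun v => v = v₁ ∨ v = v₂ ∨ v = v₃ ∨ v = a₁ ∨ v = a₂ ∨ v = a₃)
    (h.t.adj hs.pure).1.mem_verts_left (Or.inl rfl) (by
      rintro x y (rfl | rfl | rfl | rfl | rfl | rfl) hxy
      · rcases c1.nbr hs hxy with e | e | e | e <;> simp [e]
      · rcases c2.nbr hs hxy with e | e | e | e <;> simp [e]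
      · rcases c3.nbr hs hxy with e | e | e | e <;> simp [e]
      · rcases p1.nbr hs hxy with e | e | e | e <;> simp [e]
      · rcases p2.nbr hs hxy with e | e | e | e <;> simp [e]
      · rcases p3.nbr hs hxy with e | e | e | e <;> simp [e])
  have hverts : verts K = {v₁, v₂, v₃, a₁, a₂, a₃} := by
    ext v
    simp only [Finset.mem_insert, Finset.mem_singleton]
    refine ⟨hall v, ?_⟩
    rintro (rfl | rfl | rfl | rfl | rfl | rfl)
    exacts [(h.t.adj hs.pure).1.mem_verts_left, (h.t.adj hs.pure).1.mem_verts_right,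
      (h.t.adj hs.pure).2.1.mem_verts_right, b₃.adj.mem_verts_left, b₁.adj.mem_verts_left,
      b₁.adj.mem_verts_right]
  have hcv : (verts K).card = 6 := by
    obtain ⟨⟨b1, b2, b3, b4, b5⟩, ⟨b6, b7, b8, b9⟩, ⟨b10, b11, b12⟩, b13, b14, b15⟩ := h.ne
    rw [hverts]
    simp [b1, b2, b3, b4, b5, b6, b7, b8, b9, b10, b11, b12, b13, b14, b15]
  -- All six vertices are 4-valent, so there are 12 edges; with 7 faces the Euler characteristic is
  -- 6 − 12 + 7 = 1.
  have hce : 2 * (edges K).card = 24 := by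
    rw [← sum_deg, Finset.sum_const_nat (m := 4), hcv]
    intro v hv
    rcases hall v hv with rfl | rfl | rfl | rfl | rfl | rfl
    exacts [c1.deg_eq hs, c2.deg_eq hs, c3.deg_eq hs, p1.deg_eq hs, p2.deg_eq hs, p3.deg_eq hs]
  have ho := octaFaces h.ne
  have hKO : K = SurfTri.octaFaces v₁ v₂ v₃ a₁ a₂ a₃ := by
    refine Finset.Subset.antisymm ?_ ?_
    · have s1 : ∀ {p q}, Tri K v₁ p q → Tri (SurfTri.octaFaces v₁ v₂ v₃ a₁ a₂ a₃) v₁ p q :=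
        fun ht => c1.tri_transfer hs ho.cyc ht
      have s2 : ∀ {p q}, Tri K v₂ p q → Tri (SurfTri.octaFaces v₁ v₂ v₃ a₁ a₂ a₃) v₂ p q :=
        fun ht => c2.tri_transfer hs ho.rot.cyc ht
      have s3 : ∀ {p q}, Tri K v₃ p q → Tri (SurfTri.octaFaces v₁ v₂ v₃ a₁ a₂ a₃) v₃ p q :=
        fun ht => c3.tri_transfer hs ho.rot.rot.cyc ht
      intro f hf
      obtain ⟨u, hu⟩ := Finset.card_pos.1 (show 0 < f.card by rw [hs.pure f hf]; norm_num)
      obtain ⟨p, q, rfl⟩ : ∃ p q, f = {u, p, q} := by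
        obtain ⟨x, y, z, -, -, -, rfl⟩ := Finset.card_eq_three.1 (hs.pure f hf)
        simp only [Finset.mem_insert, Finset.mem_singleton] at hu
        rcases hu with rfl | rfl | rfl
        · exact ⟨y, z, rfl⟩
        · exact ⟨x, z, Finset.insert_comm _ _ _⟩
        · exact ⟨x, y, by rw [Finset.pair_comm y, Finset.insert_comm]⟩
      have ht : Tri K u p q := hf
      rcases hall u (mem_verts.2 ⟨_, hf, hu⟩) with rfl | rfl | rfl | rfl | rfl | rfl
      · exact s1 ht
      · exact s2 ht
      · exact s3 ht
      · rcases p1.nbr hs (ht.adj hs.pure).1 with rfl | rfl | rfl | rfl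
        · rw [b₃.unique hs.pure ht p1.t1]; exact ho.u₃.rot
        · exact (s3 ht.swap).swap
        · exact (s2 ht.swap).swap
        · rw [b₂.symm.unique hs.pure ht p1.t3.swap']; exact ho.u₂.rot.rot.swap'
      · rcases p2.nbr hs (ht.adj hs.pure).1 with rfl | rfl | rfl | rfl
        · rw [b₁.unique hs.pure ht p2.t1]; exact ho.u₁.rot
        · exact (s1 ht.swap).swap
        · exact (s3 ht.swap).swap
        · rw [b₃.symm.unique hs.pure ht p2.t3.swap']; exact ho.u₃.rot.rot.swap'
      · rcases p3.nbr hs (ht.adj hs.pure).1 with rfl | rfl | rfl | rfl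
        · rw [b₂.unique hs.pure ht p3.t1]; exact ho.u₂.rot
        · exact (s2 ht.swap).swap
        · exact (s1 ht.swap).swap
        · rw [b₁.symm.unique hs.pure ht p3.t3.swap']; exact ho.u₁.rot.rot.swap'
    · intro f hf
      simp only [SurfTri.octaFaces, Finset.mem_insert, Finset.mem_singleton] at hf
      rcases hf with rfl | rfl | rfl | rfl | rfl | rfl | rfl
      exacts [h.t, h.t₃, h.t₁, h.t₂.swap, h.u₁, h.u₂.swap', h.u₃]
  have hcf : K.card = 7 := by rw [hKO]; exact card_octaFaces h.ne
  refine ⟨hK, ?_⟩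
  rw [eulerChar, hcv, hcf]
  omega

end Oct

theorem FlipCond.adj_of_ne {a b c d u w : V} (h : FlipCond K a b c d)
    (ht : Adj (SurfTri.flip K a b c d) u w) (hb : u ≠ b) (hd : u ≠ d) : Adj K u w := by
  rcases h.adj_flip.1 ht with h | h | h
  exacts [h.1, absurd h.1 hb, absurd h.1 hd]

theorem FlipCond.not_adj_diag {a b c d : V} (h : FlipCond K a b c d) :
    ¬ Adj (SurfTri.flip K a b c d) a c := by
  obtain ⟨n1, n2, n3, n4, n5, n6⟩ := h.distinct
  intro ht
  rcases h.adj_flip.1 ht with h | h | h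
  exacts [h.2.1 ⟨rfl, rfl⟩, n1 h.1, n3 h.1]

theorem nbr_of_deg_five {v a b c d e : V} (hdeg : deg K v = 5) (ha : Adj K v a) (hb : Adj K v b)
    (hc : Adj K v c) (hd : Adj K v d) (he : Adj K v e) (hn : [a, b, c, d, e].Nodup) {w : V}
    (hw : Adj K v w) : w = a ∨ w = b ∨ w = c ∨ w = d ∨ w = e := by
  by_contra! hne
  have hn' : [w, a, b, c, d, e].Nodup := by
    rw [List.nodup_cons]
    exact ⟨by simpa using hne, hn⟩
  have := card_le_deg (K := K) (v := v) (S := [w, a, b, c, d, e].toFinset) (by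
    intro q hq
    simp only [List.mem_toFinset, List.mem_cons, List.not_mem_nil, or_false] at hq
    rcases hq with rfl | rfl | rfl | rfl | rfl | rfl <;> assumption)
  rw [List.toFinset_card_of_nodup hn'] at this
  simp only [List.length_cons, List.length_nil] at this
  omega

/-- An octahedron with an inner edge `a₁a₂`. -/
theorem Oct.reducible_of_not_bdryEdge {v₁ v₂ v₃ a₁ a₂ a₃ : V} (h : Oct K v₁ v₂ v₃ a₁ a₂ a₃)
    (hK : InF4 K) (hb : ¬ BdryEdge K a₁ a₂) : Reducible K := by
  have hs := hK.surf
  have hp := hK.pure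
  obtain ⟨⟨n12, n13, m11, m12, m13⟩, ⟨n23, m21, m22, m23⟩, ⟨m31, m32, m33⟩, p12, p13, p23⟩ := h.ne
  have c1 := h.cyc
  have c2 := h.rot.cyc
  have c3 := h.rot.rot.cyc
  obtain ⟨w, hw, hw3⟩ := exists_other hp h.u₃.rot hb
  have wa3 : w ≠ a₃ := by
    rintro rfl
    exact h.not_tri hK.1 hw
  obtain ⟨-, wa1, wa2⟩ := hw.ne hp
  have hw1 : w ≠ v₁ := by
    rintro rfl
    exact c1.not_adj hs m21.symm m31.symm p12 p13 (hw.adj hp).2.1.symm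
  have hw2 : w ≠ v₂ := by
    rintro rfl
    exact c2.not_adj hs m32.symm m12.symm p23 p12.symm (hw.adj hp).2.2.symm
  have d1 : 5 ≤ deg K a₁ := five_le_deg (h.t₁.adj hp).2.1.symm (h.t₁.adj hp).2.2.symm
    (hw.adj hp).1 (h.u₂.adj hp).2.2.symm (hw.adj hp).2.1
    (nodup_five ⟨n23, m22, m23, hw2.symm⟩ ⟨m32, m33, hw3.symm⟩ ⟨p23, wa2, wa3.symm⟩)
  have d2 : 5 ≤ deg K a₂ := five_le_deg (h.t₂.adj hp).2.1.symm (h.t₂.adj hp).2.2.symm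
    (hw.adj hp).1.symm (h.u₁.adj hp).2.2 (hw.adj hp).2.2
    (nodup_five ⟨n13.symm, m31, m33, hw3.symm⟩ ⟨m11, m13, hw1.symm⟩ ⟨p13, wa1, wa3.symm⟩)
  have hn3 : ¬ Adj K v₃ w := c3.not_adj hs hw1 hw2 wa1.symm wa2.symm
  have hn2 : ¬ Adj K v₂ w := c2.not_adj hs hw3 hw1 wa3 wa1.symm
  -- The inner edge `a₁a₂` is replaced by `v₃w`, which raises `v₃` to degree 5. If `a₃` has degree
  -- at least 5, the edge `v₁v₂` can be contracted afterwards.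
  have hf := hK.flipCond h.u₃.rot.swap' hw hw3.symm hn3
  have hL := hK.flip hf d1 d2
  have hn22 : ¬ Adj K v₂ a₂ := c2.not_adj hs m32.symm m12.symm p23 p12.symm
  have v3L := hf.deg_b
  rw [c3.deg_eq hs] at v3L
  by_cases d3 : deg K a₃ = 4
  · have nb3 : ∀ {z}, Adj K a₃ z → z = v₁ ∨ z = v₂ ∨ z = a₁ ∨ z = a₂ := fun hz =>
      nbr_of_deg_four d3 (h.t₃.adj hp).2.1.symm (h.t₃.adj hp).2.2.symm (h.u₂.adj hp).2.2
        (h.u₁.adj hp).2.2.symm (nodup_four ⟨n12, m11, m12⟩ ⟨m21, m22, p12⟩) hz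
    have hn11 : ¬ Adj K v₁ a₁ := c1.not_adj hs m21.symm m31.symm p12 p13
    have b13 : BdryEdge K a₁ a₃ := by
      refine (bdryEdge_iff hp).2 ⟨v₂, h.u₂.rot.rot.swap', fun z hz => ?_⟩
      rcases nb3 (hz.adj hp).2.2 with rfl | rfl | rfl | rfl
      · exact absurd (hz.adj hp).2.1.symm hn11
      · rfl
      · exact absurd rfl (hz.adj hp).2.1.1
      · exact absurd hz.swap' (h.not_tri hK.1)
    -- Here `a₃` is 4-valent and `a₁a₃` is a boundary edge. If `a₁` has degree 5, then `a₁w` is a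
    -- boundary edge too, with `a₂` as the only common neighbour, and it is contracted without any
    -- flip.
    by_cases e1 : deg K a₁ = 5
    · have nb1 : ∀ {z}, Adj K a₁ z → z = v₂ ∨ z = v₃ ∨ z = a₂ ∨ z = a₃ ∨ z = w := fun hz =>
        nbr_of_deg_five e1 (h.t₁.adj hp).2.1.symm (h.t₁.adj hp).2.2.symm (hw.adj hp).1
          (h.u₂.adj hp).2.2.symm (hw.adj hp).2.1
          (nodup_five ⟨n23, m22, m23, hw2.symm⟩ ⟨m32, m33, hw3.symm⟩ ⟨p23, wa2, wa3.symm⟩) hz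
      have hc : ∀ z, Adj K a₁ z → Adj K w z → z = a₂ := by
        intro z h1 h2
        rcases nb1 h1 with rfl | rfl | rfl | rfl | rfl
        · exact absurd h2.symm hn2
        · exact absurd h2.symm hn3
        · rfl
        · rcases nb3 h2.symm with e | e | e | e
          exacts [absurd e hw1, absurd e hw2, absurd e.symm wa1, absurd e.symm wa2]
        · exact absurd rfl h2.1
      have bw : BdryEdge K a₁ w := (bdryEdge_iff hp).2
        ⟨a₂, hw.swap', fun z hz => hc z (hz.adj hp).2.1 (hz.adj hp).2.2⟩
      refine hK.reducible_of_contract bw.adj (Or.inl bw) fun z h1 h2 => ?_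
      obtain rfl := hc z h1 h2
      exact ⟨hw.swap', d2⟩
    · refine hK.reducible_of_flip hf d1 d2 ?_
      have a1L := hf.deg_a
      have hnL : ¬ Adj (SurfTri.flip K a₁ v₃ a₂ w) v₂ w := fun ht => by
        rcases hf.adj_flip.1 ht with e | e | e
        exacts [hn2 e.1, n23 e.1, hw2 e.1.symm]
      have t1 : Tri (SurfTri.flip K a₁ v₃ a₂ w) a₁ v₃ v₂ :=
        hf.tri_side.2 (Or.inr ⟨m22, h.t₁.rot.rot.swap'⟩)
      have t2 : Tri (SurfTri.flip K a₁ v₃ a₂ w) a₁ v₃ w := hf.tri_side.2 (Or.inl rfl)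
      -- With `a₁` of degree at least 6 a second flip is allowed: `a₁v₃` becomes `v₂w`. Now `v₂` has
      -- degree 5 and is the only common neighbour of `a₁` and `a₃`, so the boundary edge `a₁a₃` can
      -- be contracted.
      have hf2 := hL.flipCond t1.swap' t2 hw2.symm hnL
      have e2 : 5 ≤ deg (SurfTri.flip K a₁ v₃ a₂ w) a₁ := by omega
      have e3 : 5 ≤ deg (SurfTri.flip K a₁ v₃ a₂ w) v₃ := by omega
      have hM := hL.flip hf2 e2 e3
      refine hL.reducible_of_flip hf2 e2 e3 ?_
      have bM := hf2.bdryEdge_flip.2 (hf.bdryEdge_flip.2 b13)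
      have dM := hf2.deg_b
      rw [hf.deg_other m21 n23 m22 hw2.symm, c2.deg_eq hs] at dM
      refine hM.reducible_of_contract bM.symm.adj (Or.inl bM.symm) fun z h1 h2 => ?_
      have h1L := hf2.adj_of_ne h1 m23.symm wa3.symm
      rcases nb3 (hf.adj_of_ne h1L m33.symm wa3.symm) with rfl | rfl | rfl | rfl
      · exact absurd (hf.adj_of_ne (hf2.adj_of_ne h2 m21.symm wa1) m31.symm wa1).symm
          hn11
      · refine ⟨?_, dM.ge⟩
        rw [hf2.tri_away p13.symm m23.symm m33.symm wa3.symm,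
          hf.tri_away p13.symm m33.symm p23.symm wa3.symm]
        exact h.u₂.rot
      · exact absurd rfl h2.1
      · exact absurd (hf2.adj_of_ne h2 m21.symm wa1) hf.not_adj_diag
  · refine hK.reducible_of_flip hf d1 d2 ?_
    have a3L := hf.deg_other p13.symm m33.symm p23.symm wa3.symm
    have hn : ¬ Adj (SurfTri.flip K a₁ v₃ a₂ w) v₂ a₂ := fun ht =>
      hn22 (hf.adj_of_ne ht n23 hw2.symm)
    rcases (c1.flip hf m11 n13 m12 hw1.symm).contract hL hn with e | e | e
    · omega
    · omega
    · exact e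

/-- Some edge of `a₁a₂a₃` is inner, since otherwise the octahedron is the whole surface and a disk.
-/
theorem Oct.reducible {v₁ v₂ v₃ a₁ a₂ a₃ : V} (h : Oct K v₁ v₂ v₃ a₁ a₂ a₃)
    (hK : InF4 K) (hd : ¬ IsDisk K) : Reducible K := by
  by_cases b₃ : BdryEdge K a₁ a₂
  · by_cases b₁ : BdryEdge K a₂ a₃
    · by_cases b₂ : BdryEdge K a₃ a₁
      · exact absurd (h.isDisk hK.1 b₁ b₂ b₃) hd
      · exact h.rot.rot.reducible_of_not_bdryEdge hK b₂
    · exact h.rot.reducible_of_not_bdryEdge hK b₁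
  · exact h.reducible_of_not_bdryEdge hK b₃

/-- An octahedron whose center `v₁v₂v₃` has the single boundary vertex `v₃`. -/
structure OneB (K : Finset (Finset V)) (v₁ v₂ v₃ a₁ a₂ a₃ : V) : Prop where
  ne : Distinct v₁ v₂ v₃ a₁ a₂ a₃
  t : Tri K v₁ v₂ v₃
  t₁ : Tri K v₂ v₃ a₁
  t₂ : Tri K v₃ v₁ a₂
  t₃ : Tri K v₁ v₂ a₃
  u₁ : Tri K v₁ a₂ a₃
  u₂ : Tri K v₂ a₃ a₁
  b₁ : BdryEdge K v₃ a₁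
  b₂ : BdryEdge K v₃ a₂

namespace OneB

variable {v₁ v₂ v₃ a₁ a₂ a₃ : V}

theorem swap (h : OneB K v₁ v₂ v₃ a₁ a₂ a₃) : OneB K v₂ v₁ v₃ a₂ a₁ a₃ := by
  obtain ⟨⟨n1, n2, n3, n4⟩, t, t₁, t₂, t₃, u₁, u₂, b₁, b₂⟩ := h
  exact ⟨⟨⟨n1.1.symm, n2.1, n2.2.2.1, n2.2.1, n2.2.2.2⟩,
    ⟨n1.2.1, n1.2.2.2.1, n1.2.2.1, n1.2.2.2.2⟩, ⟨n3.2.1, n3.1, n3.2.2⟩,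
    n4.1.symm, n4.2.2, n4.2.1⟩, t.swap, t₂.swap, t₁.swap, t₃.swap, u₂.swap', u₁.swap', b₂, b₁⟩

theorem cyc (h : OneB K v₁ v₂ v₃ a₁ a₂ a₃) : Cyc K v₁ v₂ v₃ a₂ a₃ :=
  ⟨h.t, h.t₂.swap, h.u₁, h.t₃.swap', h.ne.2.1.2.2.1, h.ne.2.2.1.2.2⟩

theorem pth (h : OneB K v₁ v₂ v₃ a₁ a₂ a₃) : Pth K v₃ a₂ v₁ v₂ a₁ :=
  ⟨h.t₂.swap', h.t.rot.rot, h.t₁.swap, h.b₂, h.b₁, h.ne.2.1.2.2.1.symm, h.ne.1.2.2.1⟩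

/-- If `a₁a₂a₃` is a face, then `v₁v₂a₃` is the center of an octahedron. -/
theorem oct (h : OneB K v₁ v₂ v₃ a₁ a₂ a₃) (ht : Tri K a₁ a₂ a₃) :
    Oct K v₁ v₂ a₃ a₁ a₂ v₃ := by
  obtain ⟨⟨n12, n13, m11, m12, m13⟩, ⟨n23, m21, m22, m23⟩, ⟨m31, m32, m33⟩, p12, p13, p23⟩ := h.ne
  exact ⟨⟨⟨n12, m13, m11, m12, n13⟩, ⟨m23, m21, m22, n23⟩, ⟨p13.symm, p23.symm, m33.symm⟩,
    p12, m31.symm, m32.symm⟩, h.t₃, h.u₂, h.u₁.rot.rot, h.t, h.t₂.rot, h.t₁,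
    ht.rot.rot⟩

/-- The other face at the edge `a₁a₃`. -/
theorem exists_outer (h : OneB K v₁ v₂ v₃ a₁ a₂ a₃) (hK : InF4 K) :
    ∃ w, Tri K a₁ a₃ w ∧ w ≠ v₁ ∧ w ≠ v₂ ∧ w ≠ v₃ := by
  have hs := hK.surf
  have hp := hK.pure
  obtain ⟨⟨n12, n13, m11, m12, m13⟩, ⟨n23, m21, m22, m23⟩, ⟨m31, m32, m33⟩, p12, p13, p23⟩ := h.ne
  have hb : ¬ BdryEdge K a₁ a₃ := fun hb => by
    have h1 := hs.deg_le_three_of_bdry h.b₁.symm hb h.t₁.rot.rot.swap' h.u₂.rot.rot m33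
    have h2 := hK.deg_ge hb.adj
    omega
  obtain ⟨w, hw, hw2⟩ := exists_other hp h.u₂.rot.rot.swap' hb
  refine ⟨w, hw, ?_, hw2, ?_⟩
  · rintro rfl
    exact h.cyc.not_adj hs m21.symm m31.symm p12 p13 (hw.adj hp).2.1.symm
  · rintro rfl
    exact h.pth.not_adj hs p23.symm m13.symm m23.symm p13.symm (hw.adj hp).2.2.symm

/-- Contraction of a boundary edge outside of the configuration. -/
theorem reducible_of_deg_four (h : OneB K v₁ v₂ v₃ a₁ a₂ a₃) (hK : InF4 K)
    (hn : ¬ Tri K a₁ a₂ a₃) (h1 : deg K a₁ = 4) : Reducible K := by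
  have hs := hK.surf
  have hp := hK.pure
  obtain ⟨⟨n12, n13, m11, m12, m13⟩, ⟨n23, m21, m22, m23⟩, ⟨m31, m32, m33⟩, p12, p13, p23⟩ := h.ne
  obtain ⟨w, hw, hw1, hw2, hw3⟩ := h.exists_outer hK
  have wn := hw.ne hp
  have wa2 : w ≠ a₂ := by
    rintro rfl
    exact hn hw.swap'
  have d3 : 5 ≤ deg K a₃ := five_le_deg (h.t₃.adj hp).2.1.symm (h.t₃.adj hp).2.2.symm
    (hw.adj hp).1.symm (h.u₁.adj hp).2.2.symm (hw.adj hp).2.2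
    (nodup_five ⟨n12, m11, m12, hw1.symm⟩ ⟨m21, m22, hw2.symm⟩ ⟨p12, wn.2.1, wa2.symm⟩)
  have hc : ∀ z, Adj K a₁ z → Adj K w z → z = a₃ := by
    intro z h1' h2
    rcases nbr_of_deg_four h1 (h.t₁.adj hp).2.1.symm (h.t₁.adj hp).2.2.symm (hw.adj hp).1
      (hw.adj hp).2.1 (nodup_four ⟨n23, m23, hw2.symm⟩ ⟨m33, hw3.symm, wn.2.2⟩) h1' with
      rfl | rfl | rfl | rfl
    · exact absurd h2.symm (h.swap.cyc.not_adj hs hw1 hw3 wn.2.1.symm wn.2.2.symm)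
    · exact absurd h2.symm (h.pth.not_adj hs wa2 hw1 hw2 wn.2.1.symm)
    · rfl
    · exact absurd rfl h2.1
  have bw : BdryEdge K a₁ w := (bdryEdge_iff hp).2
    ⟨a₃, hw.swap', fun z hz => hc z (hz.adj hp).2.1 (hz.adj hp).2.2⟩
  refine hK.reducible_of_contract bw.adj (Or.inl bw) fun z h1 h2 => ?_
  obtain rfl := hc z h1 h2
  exact ⟨hw.swap', d3⟩

/-- If `a₁a₂a₃` is a face, the configuration is an octahedron with another center; if `a₁` or `a₂`
is 4-valent, a boundary edge next to it is contracted. Otherwise flipping `a₁a₃` raises `v₂` to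
degree 5 and makes `v₁v₃` contractible within the family. -/
theorem reducible (h : OneB K v₁ v₂ v₃ a₁ a₂ a₃) (hK : InF4 K) (hd : ¬ IsDisk K) :
    Reducible K := by
  have hs := hK.surf
  have hp := hK.pure
  by_cases ht : Tri K a₁ a₂ a₃
  · exact (h.oct ht).reducible hK hd
  by_cases d1 : deg K a₁ = 4
  · exact h.reducible_of_deg_four hK ht d1
  by_cases d2 : deg K a₂ = 4
  · exact h.swap.reducible_of_deg_four hK (fun h => ht h.swap) d2
  obtain ⟨⟨n12, n13, m11, m12, m13⟩, ⟨n23, m21, m22, m23⟩, ⟨m31, m32, m33⟩, p12, p13, p23⟩ := h.ne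
  obtain ⟨w, hw, hw1, hw2, hw3⟩ := h.exists_outer hK
  have wn := hw.ne hp
  have wa2 : w ≠ a₂ := by
    rintro rfl
    exact ht hw.swap'
  have d1' := hK.deg_ge (h.u₂.adj hp).2.2.symm
  have d2' := hK.deg_ge (h.u₁.adj hp).2.2
  have d3 : 5 ≤ deg K a₃ := five_le_deg (h.t₃.adj hp).2.1.symm (h.t₃.adj hp).2.2.symm
    (hw.adj hp).1.symm (h.u₁.adj hp).2.2.symm (hw.adj hp).2.2
    (nodup_five ⟨n12, m11, m12, hw1.symm⟩ ⟨m21, m22, hw2.symm⟩ ⟨p12, wn.2.1, wa2.symm⟩)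
  have d1'' : 5 ≤ deg K a₁ := by omega
  have hf := hK.flipCond h.u₂.swap'.swap hw hw2.symm
    (h.swap.cyc.not_adj hs hw1 hw3 wn.2.1.symm wn.2.2.symm)
  refine hK.reducible_of_flip hf d1'' d3 ?_
  have e2 := hf.deg_other p12.symm m22.symm p23 wa2.symm
  have e1 := hf.deg_b
  rw [h.swap.cyc.deg_eq hs] at e1
  rcases (h.cyc.flip hf m11 n12 m13 hw1.symm).rot.contract (hK.flip hf d1'' d3) (fun hh =>
    h.pth.not_adj hs p23.symm m13.symm m23.symm p13.symm (hf.adj_of_ne hh n23.symm hw3.symm)) with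
    e | e | e
  · omega
  · omega
  · exact e

end OneB

/-! ### Configurations with a boundary 3-cycle. -/

/-- The boundary is `acd`, and the neighbours of `a`, `b`, `c` are known. -/
theorem reducible_of_two_bdry {a b c d x y : V} (hK : InF4 K) (hd : ¬ IsDisk K)
    (ha : Pth K a c b y d) (hc : Pth K c a b x d) (hb : Cyc K b a c x y) : Reducible K := by
  have hs := hK.surf
  have hp := hK.pure
  obtain ⟨ac, ab, ay, ad, cb, cy, cd, bY, bd, yd⟩ := ha.ne hs
  obtain ⟨-, -, cx, -, -, ax, -, bx, -, xd⟩ := hc.ne hs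
  have xy : x ≠ y := (hb.t3.ne hp).2.2
  have hn : ¬ Tri K x y d := fun ht => hd (Oct.isDisk (v₁ := b) (v₂ := x) (v₃ := y) (a₁ := d)
    (a₂ := a) (a₃ := c) ⟨⟨⟨bx, bY, bd, ab.symm, cb.symm⟩, ⟨xy, xd, ax.symm, cx.symm⟩,
      ⟨yd, ay.symm, cy.symm⟩, ad.symm, cd.symm, ac⟩, hb.t3, ht, hb.t4.swap, hb.t2.swap', hb.t1,
      hc.t3.rot.swap', ha.t3.rot⟩ hK.1 ha.bp hc.bq ha.bq.symm)
  have hbd : ¬ Adj K b d := hb.not_adj hs ad.symm cd.symm xd.symm yd.symm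
  -- A 4-valent `d` would have the path `a, y, x, c` as its link, and `xyd` would be a face.
  have dd : 5 ≤ deg K d := by
    by_contra hcon
    have h4 := hK.deg_ge ha.bq.adj.symm
    obtain ⟨c', q', h⟩ := hs.exists_pth (show deg K d = 4 by omega) ha.bq.symm ha.t3.rot.rot
    have hq' : q' = c := by
      rcases hs.bdry_three ha.bq.symm hc.bq.symm h.bq with e | e | e
      exacts [absurd e ac, absurd e (h.ne hs).2.2.2.2.2.2.1, e.symm]
    subst hq'
    have hc' : c' = x := hc.bq.symm.unique hp h.t3.swap' hc.t3.rot.rot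
    subst hc'
    exact hn h.t2.rot.swap
  have hxi : ¬ BdryVertex K x := fun hh => by
    rcases hK.1.bdry_of_triangle ha.bp hc.bq ha.bq hh with e | e | e
    exacts [ax e.symm, cx e.symm, xd e]
  obtain ⟨w, hw, hwb⟩ := exists_other hp hb.t3.rot fun hh => hxi hh.left
  have wn := hw.ne hp
  have hwd : w ≠ d := by
    rintro rfl
    exact hn hw
  have hwa : w ≠ a := by
    rintro rfl
    exact ha.not_adj hs cx.symm bx.symm xy xd (hw.adj hp).2.1.symm
  have hwc : w ≠ c := by
    rintro rfl
    exact hc.not_adj hs ay.symm bY.symm xy.symm yd (hw.adj hp).2.2.symm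
  have dx : 5 ≤ deg K x := five_le_deg (hc.t2.adj hp).2.1.symm (hb.t2.adj hp).2.1.symm
    (hb.t3.adj hp).2.2 (hc.t3.adj hp).2.2 (hw.adj hp).2.1
    (nodup_five ⟨cb, cy, cd, hwc.symm⟩ ⟨bY, bd, hwb.symm⟩ ⟨yd, wn.2.2, hwd.symm⟩)
  have dy : 5 ≤ deg K y := five_le_deg (ha.t2.adj hp).2.1.symm (ha.t2.adj hp).2.2.symm
    (hb.t3.adj hp).2.2.symm (ha.t3.adj hp).2.2 (hw.adj hp).2.2
    (nodup_five ⟨ab, ax, ad, hwa.symm⟩ ⟨bx, bd, hwb.symm⟩ ⟨xd, wn.2.1, hwd.symm⟩)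
  -- Replacing `xy` by `bw` raises `b` to degree 5; the inner edge `cx` is then contracted, with `b`
  -- and `d` opposite to it.
  have hf := hK.flipCond hb.t3.rot.swap' hw hwb.symm
    (hb.not_adj hs hwa hwc wn.2.1.symm wn.2.2.symm)
  have hL := hK.flip hf dx dy
  refine hK.reducible_of_flip hf dx dy ?_
  have e1 := hf.deg_b
  rw [hb.deg_eq hs] at e1
  have e2 := hf.deg_other xd.symm bd.symm yd.symm hwd.symm
  rcases (hc.flip hf cx cb cy hwc.symm).symm.contract_inner hL (fun hh =>
    ha.not_adj hs cx.symm bx.symm xy xd (hf.adj_of_ne hh.symm ab hwa.symm))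
    (fun hh => hxi (hf.bdryVertex_flip.1 hh)) with e | e | e
  · omega
  · omega
  · exact e

/-- The boundary is `v₁v₂v₃`, and all three boundary vertices have degree `4`. -/
theorem reducible_of_three_bdry {v₁ v₂ v₃ a₁ a₂ a₃ : V} (hK : InF4 K) (hd : ¬ IsDisk K)
    (h1 : Pth K v₁ v₂ a₃ a₂ v₃) (h2 : Pth K v₂ v₁ a₃ a₁ v₃) (h3 : Pth K v₃ v₁ a₂ a₁ v₂) :
    Reducible K := by
  have hs := hK.surf
  have hp := hK.pure
  obtain ⟨n12, m13, m12, n13, m23, m22, n23, p32, m33, m32⟩ := h1.ne hs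
  obtain ⟨-, -, m21, -, -, m11, -, p31, -, m31⟩ := h2.ne hs
  have p21 : a₂ ≠ a₁ := (h3.t2.ne hp).2.2
  have hv : ∀ {v}, BdryVertex K v → v = v₁ ∨ v = v₂ ∨ v = v₃ := fun hv =>
    hK.1.bdry_of_triangle h1.bp h2.bq h1.bq hv
  have ha1 : ¬ BdryVertex K a₁ := fun hh => by
    rcases hv hh with e | e | e
    exacts [m11 e.symm, m21 e.symm, m31 e]
  have ha2 : ¬ BdryVertex K a₂ := fun hh => by
    rcases hv hh with e | e | e
    exacts [m12 e.symm, m22 e.symm, m32 e]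
  have ha3 : ¬ BdryVertex K a₃ := fun hh => by
    rcases hv hh with e | e | e
    exacts [m13 e.symm, m23 e.symm, m33 e]
  have hn : ¬ Tri K a₁ a₂ a₃ := fun ht => hd (Oct.isDisk (v₁ := a₁) (v₂ := a₂) (v₃ := a₃) (a₁ := v₁)
    (a₂ := v₂) (a₃ := v₃) ⟨⟨⟨p21.symm, p31.symm, m11.symm, m21.symm, m31⟩,
      ⟨p32.symm, m12.symm, m22.symm, m32⟩, ⟨m13.symm, m23.symm, m33⟩, n12, n13, n23⟩, ht,
      h1.t2.rot.swap, h2.t2.rot, h3.t2.rot.swap, h2.t3.rot.swap', h1.t3.rot, h1.t1.rot.rot⟩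
    hK.1 h2.bq h1.bq.symm h1.bp)
  have da3 : 5 ≤ deg K a₃ := by
    by_contra hcon
    have h4 := hK.deg_ge (h1.t1.adj hp).2.1.symm
    obtain ⟨x, y, h⟩ := hs.exists_cyc (show deg K a₃ = 4 by omega) ha3 h1.t1.rot.rot
    have hx : a₁ = x := (h.rot.third hs h2.t2.swap).resolve_right m11.symm
    have hy : a₂ = y := (h.third hs h1.t2.swap).resolve_left m22.symm
    subst hx hy
    exact hn h.t3.rot
  obtain ⟨w, hw, hw3⟩ := exists_other hp h3.t2.rot.swap fun hh => ha1 hh.left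
  have wn := hw.ne hp
  have hwa3 : w ≠ a₃ := by
    rintro rfl
    exact hn hw
  have hw1 : w ≠ v₁ := by
    rintro rfl
    exact h1.not_adj hs m21.symm p31.symm p21.symm m31 (hw.adj hp).2.1.symm
  have hw2 : w ≠ v₂ := by
    rintro rfl
    exact h2.not_adj hs m12.symm p32.symm p21 m32 (hw.adj hp).2.2.symm
  have d1 : 5 ≤ deg K a₁ := five_le_deg (h2.t2.adj hp).2.1.symm (h2.t3.adj hp).2.2
    (hw.adj hp).1 (h2.t2.adj hp).2.2.symm (hw.adj hp).2.1
    (nodup_five ⟨n23, m22, m23, hw2.symm⟩ ⟨m32.symm, m33.symm, hw3.symm⟩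
      ⟨p32.symm, wn.2.2, hwa3.symm⟩)
  have d2 : 5 ≤ deg K a₂ := five_le_deg (h1.t2.adj hp).2.1.symm (h1.t3.adj hp).2.2
    (hw.adj hp).1.symm (h1.t2.adj hp).2.2.symm (hw.adj hp).2.2
    (nodup_five ⟨n13, m11, m13, hw1.symm⟩ ⟨m31.symm, m33.symm, hw3.symm⟩
      ⟨p31.symm, wn.2.1, hwa3.symm⟩)
  -- Replacing `a₁a₂` by `v₃w` raises `v₃` to degree 5; then `v₁a₂` is contracted, with `v₃` and
  -- `a₃` opposite to it.
  have hf := hK.flipCond h3.t2.rot.swap.swap' hw hw3.symm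
    (h3.not_adj hs hw1 wn.2.2.symm wn.2.1.symm hw2)
  have hL := hK.flip hf d1 d2
  refine hK.reducible_of_flip hf d1 d2 ?_
  have e1 := hf.deg_b
  rw [h3.deg_eq hs] at e1
  have e2 := hf.deg_other p31 m33 p32 hwa3.symm
  rcases (h1.flip hf m11 n13 m12 hw1.symm).symm.contract_inner hL (fun hh =>
    h2.not_adj hs m12.symm p32.symm p21 m32 (hf.adj_of_ne hh.symm n23 hw2.symm))
    (fun hh => ha2 (hf.bdryVertex_flip.1 hh)) with e | e | e
  · omega
  · omega
  · exact e

/-! ### Two adjacent 4-valent vertices, one of them inner. -/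

/-- The 4-valent face `bcx` is the center of an octahedron around `d, y, a`. Either the link of `x`
closes up through the face `xyd`, giving `Oct`, or `xy` and `xd` are boundary edges, giving `OneB`.
-/
theorem reducible_of_inner_triple {a b c d x y : V} (hK : InF4 K) (hd : ¬ IsDisk K)
    (hb : Cyc K b a c x y) (hc : Cyc K c a b x d) (hyd : y ≠ d) (dx : deg K x = 4) :
    Reducible K := by
  have hs := hK.surf
  have hp := hK.pure
  obtain ⟨ba, bc, bx, bY, ac, ax, ay, cx, cy, xy⟩ := hb.ne hs
  obtain ⟨-, -, -, cd, -, -, ad, -, bd, xd⟩ := hc.ne hs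
  have hcy : ¬ Adj K c y := hc.not_adj hs ay.symm bY.symm xy.symm hyd
  have hbd : ¬ Adj K b d := hb.not_adj hs ad.symm cd.symm xd.symm hyd.symm
  have hne : Distinct b c x d y a := ⟨⟨bc, bx, bd, bY, ba⟩, ⟨cx, cd, cy, ac.symm⟩,
    ⟨xd, xy, ax.symm⟩, hyd.symm, ad.symm, ay.symm⟩
  by_cases ht : Tri K x y d
  · exact Oct.reducible ⟨hne, hb.t2, hc.t3, hb.t3.swap, hb.t1.swap', hb.t4, hc.t4.swap',
      ht.swap'⟩ hK hd
  have nb : ∀ {z}, Adj K x z → z = b ∨ z = c ∨ z = y ∨ z = d := fun hz =>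
    nbr_of_deg_four dx (hb.t2.adj hp).2.1.symm (hb.t2.adj hp).2.2.symm (hb.t3.adj hp).2.2
      (hc.t3.adj hp).2.2 (nodup_four ⟨bc, bY, bd⟩ ⟨cy, cd, hyd⟩) hz
  have bxy : BdryEdge K x y := by
    refine (bdryEdge_iff hp).2 ⟨b, hb.t3.rot, fun z hz => ?_⟩
    rcases nb (hz.adj hp).2.1 with rfl | rfl | rfl | rfl
    exacts [rfl, absurd (hz.adj hp).2.2.symm hcy, absurd rfl (hz.adj hp).2.2.1, absurd hz ht]
  have bxd : BdryEdge K x d := by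
    refine (bdryEdge_iff hp).2 ⟨c, hc.t3.rot, fun z hz => ?_⟩
    rcases nb (hz.adj hp).2.1 with rfl | rfl | rfl | rfl
    exacts [absurd (hz.adj hp).2.2.symm hbd, rfl, absurd hz.swap' ht, absurd rfl (hz.adj hp).2.2.1]
  exact OneB.reducible ⟨hne, hb.t2, hc.t3, hb.t3.swap, hb.t1.swap', hb.t4, hc.t4.swap',
    bxd, bxy⟩ hK hd

/-- One contracts `bc` itself. Only a third 4-valent vertex opposite to `bc` prevents this, and that
is the preceding configuration, up to reflection. -/
theorem reducible_of_inner_pair {b c : V} (hK : InF4 K) (hd : ¬ IsDisk K) (hb : deg K b = 4)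
    (hbi : ¬ BdryVertex K b) (hc : deg K c = 4) (hci : ¬ BdryVertex K c) (hbc : Adj K b c) :
    Reducible K := by
  have hs := hK.surf
  have hp := hK.pure
  obtain ⟨a, ha⟩ := (adj_iff hp).1 hbc
  obtain ⟨x, y, Hb⟩ := hs.exists_cyc hb hbi ha.swap'
  obtain ⟨x', d, Hc⟩ := hs.exists_cyc hc hci ha.rot
  obtain rfl : x' = x := by
    rcases Hb.rot.third hs Hc.t2.swap with e | e
    exacts [e, absurd e Hc.ax.symm]
  obtain ⟨ba, bc, bx, bY, ac, ax, ay, cx, cy, xy⟩ := Hb.ne hs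
  have hyd : y ≠ d := by
    rintro rfl
    have h3 := hs.deg_le_three (v := a) Hb.t1.swap Hc.t4.rot.rot Hb.t4.rot.rot
    have h4 := hK.deg_ge (ha.adj hp).2.1.symm
    omega
  rcases Hb.rot.contract hK (Hc.not_adj hs ay.symm bY.symm xy.symm hyd) with e | e | e
  · exact reducible_of_inner_triple hK hd Hb Hc hyd e
  · exact reducible_of_inner_triple hK hd Hb.rot.rot.refl Hc.rot.rot.refl hyd e
  · exact e

/-- Again `bc` is contracted unless `x` or `a` is 4-valent. A 4-valent `x` gives `OneB` with `c` as
boundary vertex. A 4-valent `a` has a path link `c, b, y, e`: for `e = d` the boundary is a 3-cycle,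
and otherwise `cd` can be contracted unless `x` is 4-valent. -/
theorem reducible_of_bdry_pair_aux {a b c d x y : V} (hK : InF4 K) (hd : ¬ IsDisk K)
    (hb : Cyc K b a c x y) (hc : Pth K c a b x d) : Reducible K := by
  have hs := hK.surf
  have hp := hK.pure
  obtain ⟨ba, bc, bx, bY, ac, ax, ay, cx, cy, xy⟩ := hb.ne hs
  obtain ⟨-, -, -, cd, -, -, ad, -, bd, xd⟩ := hc.ne hs
  have hyd : y ≠ d := by
    rintro rfl
    have h3 := hs.deg_le_three (v := x) hb.t2.rot.rot hc.t3.swap hb.t3.swap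
    have h4 := hK.deg_ge (hc.t3.adj hp).2.2
    omega
  have hcy : ¬ Adj K c y := hc.not_adj hs ay.symm bY.symm xy.symm hyd
  have hbd : ¬ Adj K b d := hb.not_adj hs ad.symm cd.symm xd.symm hyd.symm
  have nb : deg K x = 4 → ∀ {z}, Adj K x z → z = b ∨ z = c ∨ z = y ∨ z = d := fun dx _ hz =>
    nbr_of_deg_four dx (hb.t2.adj hp).2.1.symm (hb.t2.adj hp).2.2.symm (hb.t3.adj hp).2.2
      (hc.t3.adj hp).2.2 (nodup_four ⟨bc, bY, bd⟩ ⟨cy, cd, hyd⟩) hz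
  have key : deg K x = 4 → Reducible K := by
    intro dx
    by_cases ht : Tri K x y d
    · exact OneB.reducible (v₁ := b) (v₂ := x) (v₃ := c) (a₁ := d) (a₂ := a) (a₃ := y)
        ⟨⟨⟨bx, bc, bd, ba, bY⟩, ⟨cx.symm, xd, ax.symm, xy⟩, ⟨cd, ac.symm, cy⟩, ad.symm, hyd.symm,
        ay⟩, hb.t2.swap', hc.t3.swap, hb.t1.rot.rot, hb.t3, hb.t4.swap', ht, hc.bq, hc.bp⟩ hK hd
    · have bxd : BdryEdge K d x := by
        refine ((bdryEdge_iff hp).2 ⟨c, hc.t3.rot, fun z hz => ?_⟩ : BdryEdge K x d).symm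
        rcases nb dx (hz.adj hp).2.1 with rfl | rfl | rfl | rfl
        exacts [absurd (hz.adj hp).2.2.symm hbd, rfl, absurd hz.swap' ht,
          absurd rfl (hz.adj hp).2.2.1]
      have h3 := hs.deg_le_two hc.bq.symm bxd hc.t3.rot.rot
      have h4 := hK.deg_ge bxd.adj
      omega
  rcases hb.rot.contract hK hcy with e | e | e
  · exact key e
  · obtain ⟨y', e, ha⟩ := hs.exists_pth e hc.bp.symm hb.t1.rot
    obtain rfl : y' = y := by
      rcases hb.third hs ha.t2.swap with h | h
      exacts [absurd h.symm ha.pc, h]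
    by_cases hed : e = d
    · subst hed
      exact reducible_of_two_bdry hK hd ha hc hb
    rcases hc.symm.contract_end hK (fun h => hbd h.symm) (fun h =>
      ha.not_adj hs cd.symm bd.symm hyd.symm (Ne.symm hed) h.symm) with h | h
    · exact key h
    exact h
  · exact e

/-- In the remaining case analysis this settles every 4-valent inner vertex that has a 4-valent
neighbour. -/
theorem reducible_of_pair {b c : V} (hK : InF4 K) (hd : ¬ IsDisk K) (hb : deg K b = 4)
    (hbi : ¬ BdryVertex K b) (hc : deg K c = 4) (hbc : Adj K b c) : Reducible K := by
  have hs := hK.surf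
  by_cases hci : BdryVertex K c
  · obtain ⟨a, x, d, Hc⟩ := hs.exists_pth_mid hc hci hbc.symm fun h => hbi h.right
    obtain ⟨x', y, Hb⟩ := hs.exists_cyc hb hbi (a := a) (c := c) Hc.t1.rot.rot.swap'
    obtain rfl : x' = x := by
      rcases Hb.rot.third hs Hc.t2.swap with e | e
      exacts [e.symm, absurd e.symm Hc.pc]
    exact reducible_of_bdry_pair_aux hK hd Hb Hc
  · exact reducible_of_inner_pair hK hd hb hbi hc hci hbc

/-! ### A contractible edge opposite to a 4-valent vertex. -/

/-- A contractible edge in a face with an inner vertex of degree `4`. -/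
theorem reducible_of_inner_third {a b c : V} (hK : InF4 K) (hd : ¬ IsDisk K)
    (hac : LinkCond K a c) (ht : Tri K a c b) (hb : deg K b = 4) (hbi : ¬ BdryVertex K b) :
    Reducible K := by
  have hs := hK.surf
  have hp := hK.pure
  obtain ⟨x, y, h⟩ := hs.exists_cyc hb hbi ht.rot.rot
  obtain ⟨ba, bc, bx, bY, ac, ax, ay, cx, cy, xy⟩ := h.ne hs
  have pair : ∀ {z}, deg K z = 4 → Adj K b z → Reducible K := fun h1 h2 =>
    reducible_of_pair hK hd hb hbi h1 h2
  by_cases hax : Adj K a x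
  -- If both `ax` and `cy` were edges, the contractible edge `ac` would lie in the three faces
  -- through `b`, `x` and `y`. So one of the two diagonals is missing, and `ba` or `bc` satisfies
  -- the link condition.
  · have hcy : ¬ Adj K c y := fun hcy => by
      rcases hs.two_thirds ht (hac.common x hax (h.t2.adj hp).2.2)
        (hac.common y (h.t4.adj hp).2.2.symm hcy) with e | e | e
      exacts [bx e, bY e, xy e]
    rcases h.rot.contract hK hcy with e | e | e
    exacts [pair e (h.t2.adj hp).2.1, pair e (h.t1.adj hp).1, e]
  · rcases h.contract hK hax with e | e | e
    exacts [pair e (h.t1.adj hp).2.1, pair e (h.t3.adj hp).2.1, e]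

theorem FlipCond.not_bdryVertex {a b c d u : V} (h : FlipCond K a b c d)
    (hu : ¬ BdryVertex K u) : ¬ BdryVertex (flip K a b c d) u := fun hh =>
  hu (h.bdryVertex_flip.1 hh)

theorem Pth.third {v p a c q r : V} (h : Pth K v p a c q) (hK : IsSurface K)
    (ht : Tri K v a r) : r = p ∨ r = c := by
  rcases hK.two_thirds h.t1.swap' h.t2 ht with e | e | e
  exacts [absurd e h.pc, Or.inl e.symm, Or.inr e.symm]

/-- A contractible edge `ac` in a face with a boundary edge `ab` at the 4-valent vertex `b`. -/
theorem reducible_of_end_third {a b c p q : V} (hK : InF4 K) (hd : ¬ IsDisk K)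
    (hac : LinkCond K a c) (hbd : BdryEdge K a c ∨ ¬ BdryVertex K a ∨ ¬ BdryVertex K c)
    (hb : Pth K b a c p q) : Reducible K := by
  have hs := hK.surf
  have hp := hK.pure
  obtain ⟨ba, bc, bP, bq, ac, ap, aq, cp, cq, pq⟩ := hb.ne hs
  have db := hb.deg_eq hs
  have hc : ¬ BdryVertex K c := by
    rcases hbd with h | h | h
    · have h3 := hs.deg_le_two hb.bp.symm h hb.t1.swap
      have h4 := hK.deg_ge h.adj
      omega
    · exact absurd hb.bp.right h
    · exact h
  by_cases hc4 : deg K c = 4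
  · exact reducible_of_pair hK hd hc4 hc db (hb.t1.adj hp).2.1.symm
  have hc5 := hK.deg_ge (hb.t1.adj hp).2.1.symm
  have hcpq : ¬ Tri K q p c := fun h => by
    have h3 := hs.deg_le_three hb.t2.rot.rot h.rot hb.t3.swap
    have h4 := hK.deg_ge (hb.t3.adj hp).2.2
    omega
  have hap : ¬ Adj K a p := fun h => by
    have h3 := hs.deg_le_three hb.t1.rot.rot
      (hac.common p h (hb.t2.adj hp).2.2).swap hb.t2.swap
    omega
  -- If `a` and `q` are not adjacent, the boundary edge `ba` can be contracted, as its only opposite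
  -- vertex `c` has degree at least 5.
  by_cases haq : Adj K a q
  swap
  · rcases hb.contract_end hK hap haq with e | e
    exacts [absurd e hc4, e]
  by_cases hbq : BdryEdge K a q
  · have hv : ∀ {v}, BdryVertex K v → v = a ∨ v = b ∨ v = q := fun hv =>
      hK.1.bdry_of_triangle hb.bp.symm hb.bq hbq hv
    have hpi : ¬ BdryVertex K p := fun h => by
      rcases hv h with e | e | e
      exacts [ap e.symm, bP e.symm, pq e]
    by_cases hp4 : deg K p = 4
    · exact reducible_of_pair hK hd hp4 hpi db (hb.t2.adj hp).2.1.symm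
    rcases hb.symm.contract_inner hK (fun h => hap h.symm) hpi with hq4 | e | e
    rotate_left
    · exact absurd e hc4
    · exact e
    -- The boundary is `abq`, and contracting `bp` failed only because `q` is 4-valent. Next `bc` is
    -- tried; it fails only if `a` is 4-valent as well, and then all three boundary vertices are.
    obtain ⟨s, e, hq⟩ := hs.exists_pth hq4 hb.bq.symm hb.t3.rot.rot
    obtain rfl : e = a := by
      rcases hs.bdry_three hb.bq.symm hbq.symm hq.bq with h | h | h
      exacts [absurd h ba, absurd h (hq.ne hs).2.2.2.2.2.2.1, h.symm]
    obtain ⟨-, -, qs, -, -, bs, -, ps, -, -⟩ := hq.ne hs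
    have hcs : c ≠ s := by
      rintro rfl
      exact hcpq hq.t2
    have hcq : ¬ Adj K c q := fun h => hq.not_adj hs bc.symm cp hcs ac.symm h.symm
    rcases hb.contract_inner hK hcq hc with e1 | e1 | e1
    · obtain ⟨s', e', ha⟩ := hs.exists_pth e1 hb.bp.symm hb.t1.swap
      obtain rfl : e' = q := by
        rcases hs.bdry_three hb.bp.symm hbq ha.bq with h | h | h
        exacts [absurd h bq, absurd h (ha.ne hs).2.2.2.2.2.2.1, h.symm]
      obtain rfl : s' = s := hbq.unique hp ha.t3.swap' hq.t3.rot.rot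
      exact reducible_of_three_bdry hK hd hb ha hq
    · exact absurd e1 hp4
    · exact e1
  -- The path link of a 4-valent boundary vertex `p` would contain `c, b, q` in this order, so `c`
  -- or `q` would be an end of it. But `c` is inner, and a boundary edge `pq` would leave `q` with
  -- degree 2.
  · have hpm : BdryVertex K p → deg K p ≠ 4 := by
      intro hpb hp4
      obtain ⟨p₁, m, p₂, h⟩ := hs.exists_pth_mid hp4 hpb (hb.t2.adj hp).2.1.symm
        (not_bdryEdge hp hb.t2.rot.rot hb.t3.swap cq)
      rcases h.third hs hb.t2.rot.rot with e | e
      · exact hc (e ▸ h.bp.right)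
      · rcases h.third hs hb.t3.swap with e' | e'
        · subst e'
          have h3 := hs.deg_le_two hb.bq.symm h.bp.symm hb.t3.rot.rot
          have h4 := hK.deg_ge hb.bq.adj.symm
          omega
        · exact cq (e.trans e'.symm)
    by_cases hcq : Adj K c q
    swap
    · rcases hb.contract_inner hK hcq hc with e | e | e
      · obtain ⟨s, t, ha⟩ := hs.exists_pth e hb.bp.symm hb.t1.swap
        rcases ha.nbr hs haq with h | h | h | h
        · exact absurd h.symm bq
        · exact absurd h.symm cq
        · subst h
          exact absurd (ha.t2.adj hp).2.2 hcq
        · subst h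
          exact absurd ha.bq hbq
      · by_cases hpb : BdryVertex K p
        · exact absurd e (hpm hpb)
        · exact reducible_of_pair hK hd e hpb db (hb.t2.adj hp).2.1.symm
      · exact e
    have hacq := hac.common q haq hcq
    have hq5 : 5 ≤ deg K q := by
      by_contra hcon
      have h4 := hK.deg_ge hcq.symm
      obtain ⟨m, e, hq⟩ := hs.exists_pth (show deg K q = 4 by omega) hb.bq.symm hb.t3.rot.rot
      rcases hq.nbr hs haq.symm with h | h | h | h
      · exact ba h.symm
      · exact ap h
      · subst h
        exact hap (hq.t2.adj hp).2.2.symm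
      · subst h
        rcases hq.nbr hs hcq.symm with h | h | h | h
        · exact bc h.symm
        · exact cp h
        · subst h
          exact hcpq hq.t2
        · exact ac h.symm
    by_cases hpb : BdryVertex K p
    swap
    · rcases hb.symm.contract_inner hK (fun h => hap h.symm) hpb with e | e | e
      · omega
      · exact absurd e hc4
      · exact e
    have hp5 : 5 ≤ deg K p := by
      have h4 := hK.deg_ge (hb.t3.adj hp).2.2
      have := hpm hpb
      omega
    obtain ⟨s, hs', hsb⟩ := exists_other hp hb.t2.rot fun h => hc h.left
    have sn := hs'.ne hp
    have sa : s ≠ a := by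
      rintro rfl
      exact hap (hs'.adj hp).2.2.symm
    have sq : s ≠ q := by
      rintro rfl
      exact hcpq hs'.rot.rot.swap'
    -- No edge at `b` helps here, so `b` itself is raised to degree 5 by replacing `cp` with `bs`.
    -- Then `ac` can be contracted, its opposite vertices being `b` and `q`.
    have hf := hK.flipCond hb.t2.rot.swap' hs' hsb.symm
      (hb.not_adj hs sa sn.2.1.symm sn.2.2.symm sq)
    have hc5' : 5 ≤ deg K c := by omega
    have hL := hK.flip hf hc5' hp5
    refine hK.reducible_of_flip hf hc5' hp5 ?_
    have e1 := hf.deg_b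
    have e2 := hf.deg_other cq.symm bq.symm pq.symm sq.symm
    have ta : ∀ {z z'}, Tri (flip K c b p s) a z z' ↔ Tri K a z z' :=
      hf.tri_away ac ba.symm ap sa.symm
    refine hL.reducible_of_contract (ta.2 hb.t1.swap.swap' |>.adj hL.pure).1
      (Or.inr (Or.inr (hf.not_bdryVertex hc))) fun z h1 h2 => ?_
    have hz := hac.common z (hf.adj_of_ne h1 ba.symm sa.symm)
      (hf.adj_of_ne h2 bc.symm sn.2.1)
    rcases hs.two_thirds hb.t1.swap.swap' hacq hz with h | h | h
    · exact absurd h bq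
    · subst h
      exact ⟨ta.2 hz, by omega⟩
    · subst h
      exact ⟨ta.2 hz, by omega⟩

/-- Contraction of two boundary edges in two faces with a common edge. -/
theorem reducible_of_double {a b c p q : V} (hK : InF4 K) (hac : LinkCond K a c)
    (bac : BdryEdge K a c) (hb : Pth K b p a c q) (hpc : ¬ Adj K p c) (hpq : ¬ Adj K p q) :
    Reducible K := by
  have hs := hK.surf
  have hp := hK.pure
  obtain ⟨bP, ba, bc, bq, pa, pc, pq, ac, aq, cq⟩ := hb.ne hs
  have hbp : ∀ z, Adj K b z → Adj K p z → z = a := by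
    intro z h1 h2
    rcases hb.nbr hs h1 with h | h | h | h
    · exact absurd h.symm h2.1
    · exact h
    · exact absurd (h ▸ h2) hpc
    · exact absurd (h ▸ h2) hpq
  have hcbp : ∀ z, Adj K b z → Adj K p z → Tri K b p z := fun z h1 h2 => by
    rw [hbp z h1 h2]
    exact hb.t1
  have c1 : Contractible K a c := ⟨bac.adj, hac.common, hac.sameSurface (Or.inl bac)⟩
  have c2 : Contractible K b p := hK.contractible hb.bp.adj (Or.inl hb.bp) hcbp
  have hs1 := hac.sameSurface (Or.inl bac)
  have sM := hs1.2.1.toIsSurface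
  have tM : Tri (SurfTri.contract K a c) a b p :=
    (hac.tri_left ba bc pa pc).2 (Or.inl hb.t1.rot.rot)
  have bM : BdryEdge (SurfTri.contract K a c) b p := (hac.bdryEdge_old ba bc pa pc).2 hb.bp
  have dMa : 5 ≤ deg (SurfTri.contract K a c) a := by
    have h1 := hac.deg_left
    rw [(hs.card_thirds bac.adj).1 bac] at h1
    have h2 := hK.deg_ge bac.adj
    have h3 := hK.deg_ge bac.adj.symm
    omega
  have tb : ∀ {v}, Tri K a c v → v = b := fun ht => bac.unique hp ht hb.t2.rot
  have dMb := hac.deg_of_tri hb.t2.rot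
  rw [hb.deg_eq hs] at dMb
  have dM : ∀ v ∈ verts (SurfTri.contract K a c), v ≠ b → 4 ≤ deg (SurfTri.contract K a c) v := by
    intro v hv hvb
    rw [hac.verts_contract, Finset.mem_erase] at hv
    by_cases hva : v = a
    · subst hva
      omega
    · rw [hac.deg_of_not_tri hva hv.1 fun ht => hvb (tb ht)]
      exact hK.2 v hv.2
  have dMp : 4 ≤ deg (SurfTri.contract K a c) p := dM p bM.adj.mem_verts_right bP.symm
  -- After the first contraction `b` has degree 3, so the intermediate complex leaves the family;
  -- this is why `LinkCond` asks only for degree 3 and for one end of degree 4. Merging `b` with `p`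
  -- then gives degree at least 3 + 4 − 2 − 1 = 4, and `a`, of degree at least 5, can afford to lose
  -- one.
  have hl : LinkCond (SurfTri.contract K a c) b p :=
    { punctured := hs1.2.1
      adj := bM.adj
      common := by
        intro z h1 h2
        have zc := (hac.adj_ne h1).2
        by_cases za : z = a
        · subst za
          exact tM.rot
        · exact absurd (hbp z ((hac.adj_old ba bc za zc).1 h1) ((hac.adj_old pa pc za zc).1 h2)) za
      deg_ge := by
        intro v hv
        by_cases hvb : v = b
        · subst hvb
          omega
        · exact (dM v hv hvb).trans' (by norm_num)
      deg_end := Or.inr dMp }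
  have hs2 := hl.sameSurface (Or.inl bM)
  have hss : SameSurface K (SurfTri.contract (SurfTri.contract K a c) b p) :=
    ⟨hK.1, hs2.2.1, hs1.2.2.1.trans hs2.2.2.1, hs1.2.2.2.trans hs2.2.2.2⟩
  have k1 := hac.card_verts
  have k2 := hl.card_verts
  refine ⟨K, _, .refl, ⟨hK, ⟨hs2.2.1, ?_⟩, hss, Or.inr (Or.inr (Or.inr (Or.inr (Or.inr
    ⟨a, c, b, p, pc.symm, hb.t2.swap, hb.t1.rot.rot, c1, c2,
      Or.inl bac, Or.inl ⟨bac, hb.bp⟩, rfl⟩))))⟩, by omega⟩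
  intro v hv
  rw [hl.verts_contract, Finset.mem_erase] at hv
  by_cases hvb : v = b
  · subst hvb
    have h1 := hl.deg_left
    rw [(sM.card_thirds bM.adj).1 bM] at h1
    omega
  by_cases hva : v = a
  · subst hva
    have h1 := hl.deg_of_tri tM.rot
    omega
  · rw [hl.deg_of_not_tri hvb hv.1 fun ht => hva (bM.unique sM.pure ht tM.rot)]
    exact dM v hv.2 hvb

/-- A contractible inner edge `ac` in a face with a 4-valent boundary vertex `b`, the end `c` being
an inner vertex. -/
theorem reducible_of_mid_third_inner {a b c p q : V} (hK : InF4 K) (hd : ¬ IsDisk K)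
    (hbac : ¬ BdryEdge K a c) (hc : ¬ BdryVertex K c) (hb : Pth K b p a c q)
    (hpc : ¬ Adj K p c) (haq : ¬ Adj K a q) : Reducible K := by
  have hs := hK.surf
  have hp := hK.pure
  obtain ⟨bP, ba, bc, bq, pa, pc, pq, ac, aq, cq⟩ := hb.ne hs
  have db := hb.deg_eq hs
  by_cases hc4 : deg K c = 4
  · exact reducible_of_pair hK hd hc4 hc db (hb.t2.adj hp).2.1.symm
  by_cases ha : BdryVertex K a
  -- In a path link of a 4-valent `a`, one of the neighbours `p`, `c` of `b` would be an end. For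
  -- `c` this contradicts that `ac` is inner, and for `p` it would leave `p` with degree 2.
  · have ha4 : deg K a ≠ 4 := by
      intro ha4
      obtain ⟨x, y, z, h⟩ := hs.exists_pth_mid ha4 ha (hb.t2.adj hp).1.symm
        (not_bdryEdge hp hb.t2.swap hb.t1.rot.rot pc.symm)
      rcases h.third hs hb.t2.swap with e | e
      · exact hbac (e ▸ h.bp)
      · rcases h.third hs hb.t1.rot.rot with e' | e'
        · subst e'
          have h3 := hs.deg_le_two hb.bp.symm h.bp.symm hb.t1.swap
          have h4 := hK.deg_ge hb.bp.adj.symm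
          omega
        · exact pc (e'.trans e.symm)
    rcases hb.symm.contract_inner hK (fun h => hpc h.symm) hc with hq | e | e
    rotate_left
    · exact absurd e ha4
    · exact e
    by_cases hpq : Adj K q p
    · obtain ⟨m, e, h⟩ := hs.exists_pth hq hb.bq.symm hb.t3.rot.rot
      rcases h.nbr hs hpq with h' | h' | h' | h'
      · exact absurd h'.symm bP
      · exact absurd h' pc
      · subst h'
        exact absurd (h.t2.adj hp).2.2.symm hpc
      · subst h'
        rcases hK.1.bdry_of_triangle hb.bp h.bq.symm hb.bq ha with e | e | e
        exacts [absurd e ba.symm, absurd e pa.symm, absurd e aq]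
    · rcases hb.symm.contract_end hK (fun h => haq h.symm) hpq with e | e
      exacts [absurd e hc4, e]
  · by_cases ha4 : deg K a = 4
    · exact reducible_of_pair hK hd ha4 ha db (hb.t2.adj hp).1.symm
    rcases hb.symm.contract_inner hK (fun h => hpc h.symm) hc with hq4 | e | e
    rotate_left
    · exact absurd e ha4
    · exact e
    rcases hb.contract_inner hK haq ha with hp4 | e | e
    rotate_left
    · exact absurd e hc4
    · exact e
    -- Contracting `bc` and `ba` failed because `q` and `p` are 4-valent. If `p` and `q` are
    -- adjacent, `bpq` is a boundary 3-cycle of 4-valent vertices; if not, the boundary edge `bp`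
    -- can be contracted.
    by_cases hpq : Adj K p q
    · obtain ⟨r, e, h⟩ := hs.exists_pth hp4 hb.bp.symm hb.t1.swap
      rcases h.nbr hs hpq with h' | h' | h' | h'
      · exact absurd h'.symm bq
      · exact absurd h'.symm aq
      · subst h'
        exact absurd (h.t2.adj hp).2.2 haq
      subst h'
      obtain ⟨m, t, hq⟩ := hs.exists_pth hq4 hb.bq.symm hb.t3.rot.rot
      obtain rfl : t = p := by
        rcases hs.bdry_three hb.bq.symm h.bq.symm hq.bq with e | e | e
        exacts [absurd e bP, absurd e (hq.ne hs).2.2.2.2.2.2.1, e.symm]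
      obtain rfl : m = r := h.bq.unique hp hq.t3.rot.rot h.t3.swap'
      exact reducible_of_three_bdry hK hd h hb hq.symm
    · rcases hb.contract_end hK hpc hpq with e | e
      exacts [absurd e ha4, e]

/-- A contractible boundary edge `ac` in a face with a 4-valent boundary vertex `b`. -/
theorem reducible_of_mid_third_bdry {a b c p q : V} (hK : InF4 K)
    (hac : LinkCond K a c) (bac : BdryEdge K a c) (hb : Pth K b p a c q)
    (hpc : ¬ Adj K p c) (haq : ¬ Adj K a q) : Reducible K := by
  have hs := hK.surf
  have hp := hK.pure
  obtain ⟨bP, ba, bc, bq, pa, pc, pq, ac, aq, cq⟩ := hb.ne hs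
  have db := hb.deg_eq hs
  -- If `p` and `q` are not adjacent, `ac` and `bp` are boundary edges in the two faces at `ab`, and
  -- both are contracted at once. This is the only use of a double contraction.
  by_cases hpq : Adj K p q
  swap
  · exact reducible_of_double hK hac bac hb hpc hpq
  have hp5 : 5 ≤ deg K p := by
    by_contra hcon
    have h4 := hK.deg_ge hpq
    obtain ⟨m, e, h⟩ := hs.exists_pth (show deg K p = 4 by omega) hb.bp.symm hb.t1.swap
    rcases h.nbr hs hpq with h' | h' | h' | h'
    · exact bq h'.symm
    · exact aq h'.symm
    · subst h'
      exact haq (h.t2.adj hp).2.2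
    · subst h'
      rcases hK.1.bdry_of_triangle hb.bp h.bq hb.bq bac.left with e | e | e
      exacts [ba e.symm, pa e.symm, aq e]
  have ha4 := hK.deg_ge bac.adj
  -- For a 4-valent `a` with link `c, b, p, s`, the other boundary edge `as` at `a` is contracted;
  -- its opposite vertex `p` has degree at least 5.
  by_cases ha : deg K a = 4
  · obtain ⟨m, s, h⟩ := hs.exists_pth ha bac hb.t2.rot
    obtain rfl : p = m := by
      rcases h.third hs hb.t1.rot.rot with e | e
      exacts [absurd e pc, e]
    have hns := h.ne hs
    have hsb : ¬ Adj K s b := fun hh => by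
      rcases hb.nbr hs hh.symm with e | e | e | e
      · exact hns.2.2.2.2.2.2.2.2.2 e.symm
      · exact hns.2.2.2.1 e.symm
      · exact hns.2.2.2.2.2.2.1 e.symm
      · subst e
        exact haq h.bq.adj
    rcases h.symm.contract_end hK hsb fun hh => hns.2.2.2.2.2.2.2.2.1
      (bac.unique hp hb.t2.rot (hac.common s h.bq.adj hh.symm)) with e | e
    · omega
    · exact e
  have hbap : ¬ BdryEdge K a p := fun h => by
    have h3 := hs.deg_le_three_of_bdry h bac hb.t1.rot.swap hb.t2.swap pc
    omega
  obtain ⟨s, hs', hsb⟩ := exists_other hp hb.t1.rot.swap hbap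
  have sn := hs'.ne hp
  have sc : s ≠ c := by
    rintro rfl
    exact hpc (hs'.adj hp).2.2
  have sq : s ≠ q := by
    rintro rfl
    exact haq (hs'.adj hp).2.1
  -- Replacing `ap` by `bs` raises `b`, the only vertex opposite to the boundary edge `ac`, to
  -- degree 5.
  have hf := hK.flipCond hb.t1.rot.swap.swap' hs' hsb.symm
    (hb.not_adj hs sn.2.2.symm sn.2.1.symm sc sq)
  have ha5 : 5 ≤ deg K a := by omega
  have hL := hK.flip hf ha5 hp5
  refine hK.reducible_of_flip hf ha5 hp5 ?_
  have e1 := hf.deg_b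
  have bL := hf.bdryEdge_flip.2 bac
  refine hL.reducible_of_contract bL.adj (Or.inl bL) fun z h1 h2 => ?_
  have hz := hac.common z (hf.adj_of_ne h1 ba.symm sn.2.1) (hf.adj_of_ne h2 bc.symm sc.symm)
  obtain rfl := bac.unique hp hz hb.t2.rot
  refine ⟨?_, by omega⟩
  exact ((hf.tri_away ac.symm bc.symm pc.symm sc.symm).2 hz.swap).swap

/-- A contractible edge `ac` in a face with a 4-valent boundary vertex `b` opposite to it. -/
theorem reducible_of_mid_third {a b c p q : V} (hK : InF4 K) (hd : ¬ IsDisk K)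
    (hac : LinkCond K a c) (hbd : BdryEdge K a c ∨ ¬ BdryVertex K a ∨ ¬ BdryVertex K c)
    (hb : Pth K b p a c q) : Reducible K := by
  have hs := hK.surf
  have hp := hK.pure
  -- Otherwise `acp` would be a face by the link condition, and `p, b, c` would be a triangle in the
  -- link of `a`.
  have key : ∀ {a c p q}, LinkCond K a c → Pth K b p a c q → ¬ Adj K p c := by
    intro a c p q hac hb h
    have h3 := hs.deg_le_three hb.t1.rot.rot (hac.common p (hb.t1.adj hp).2.2.symm h.symm).swap' hb.t2.swap
    have h4 := hK.deg_ge hac.adj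
    omega
  have hpc := key hac hb
  have haq : ¬ Adj K a q := fun h => key hac.symm hb.symm h.symm
  by_cases bac : BdryEdge K a c
  · exact reducible_of_mid_third_bdry hK hac bac hb hpc haq
  rcases hbd with h | h | h
  · exact absurd h bac
  · exact reducible_of_mid_third_inner hK hd (fun h => bac h.symm) h hb.symm (fun h => haq h.symm)
      fun h => hpc h.symm
  · exact reducible_of_mid_third_inner hK hd bac h hb hpc haq

/-- A triangulation with a contractible edge is reducible. -/
theorem reducible_of_contractible {a c : V} (hK : InF4 K) (hd : ¬ IsDisk K)
    (h : Contractible K a c) : Reducible K := by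
  have hs := hK.surf
  have hp := hK.pure
  have hac := hK.linkCond_of_contractible h
  have hbd := hac.bdry_of_isSurface h.2.2.2.1.toIsSurface
  -- The only obstacle to contracting `ac` is an opposite vertex `b` of degree 4. The cases are: `b`
  -- inner; `b` on the boundary with `ba` or `bc` a boundary edge; or `a` and `c` in the middle of
  -- the path link of `b`.
  by_cases hall : ∀ b, Tri K a c b → 5 ≤ deg K b
  · exact hK.reducible_of_contract h.1 hbd fun b h1 h2 =>
      ⟨h.2.1 b h1 h2, hall b (h.2.1 b h1 h2)⟩
  push Not at hall
  obtain ⟨b, ht, hb⟩ := hall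
  have h4 := hK.deg_ge (ht.adj hp).2.1.symm
  have hb4 : deg K b = 4 := by omega
  by_cases hbi : BdryVertex K b
  swap
  · exact reducible_of_inner_third hK hd hac ht hb4 hbi
  by_cases hba : BdryEdge K b a
  · obtain ⟨p, q, hb⟩ := hs.exists_pth hb4 hba ht.rot.rot
    exact reducible_of_end_third hK hd hac hbd hb
  by_cases hbc : BdryEdge K b c
  · obtain ⟨p, q, hb⟩ := hs.exists_pth hb4 hbc ht.rot.rot.swap'
    exact reducible_of_end_third hK hd hac.symm
      (hbd.imp BdryEdge.symm Or.symm) hb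
  obtain ⟨p, m, q, hb⟩ := hs.exists_pth_mid hb4 hbi (ht.adj hp).2.1.symm hba
  rcases hb.third hs ht.rot.rot with e | e
  · exact absurd (e ▸ hb.bp) hbc
  · subst e
    exact reducible_of_mid_third hK hd hac hbd hb

/-! ### Octahedra contain contractible edges -/

/-- An inner edge has two third vertices, which are common neighbours of its ends. If there are at
most two candidates for common neighbours, the faces account for all of them. -/
theorem InF4.contractible_of_common (hK : InF4 K) {u v p q : V} (huv : Adj K u v)
    (he : ¬ BdryEdge K u v) (hb : ¬ BdryVertex K u ∨ ¬ BdryVertex K v)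
    (hc : ∀ c, Adj K u c → Adj K v c → c = p ∨ c = q) : Contractible K u v := by
  have hp := hK.pure
  obtain ⟨x, hx⟩ := (adj_iff hp).1 huv
  obtain ⟨y, hy, hyx⟩ := exists_other hp hx he
  have h1 := hc x (hx.adj hp).2.1 (hx.adj hp).2.2
  have h2 := hc y (hy.adj hp).2.1 (hy.adj hp).2.2
  refine hK.contractible huv (Or.inr hb) fun c hc1 hc2 => ?_
  rcases hc c hc1 hc2 with rfl | rfl <;> rcases h1 with rfl | rfl <;> rcases h2 with rfl | rfl <;>
    first | assumption | exact absurd rfl hyx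

namespace Hexad

variable {v₁ v₂ v₃ a₁ a₂ a₃ : V}

theorem distinct (h : Hexad K v₁ v₂ v₃ a₁ a₂ a₃) : Distinct v₁ v₂ v₃ a₁ a₂ a₃ := by
  have := h.nodup
  simp only [List.nodup_cons, List.mem_cons, List.not_mem_nil, or_false, not_or, not_false_eq_true,
    List.nodup_nil, and_true] at this
  obtain ⟨h1, h2, h3, h4, h5⟩ := this
  exact ⟨h1, h2, h3, h4.1, h4.2, h5⟩

theorem rot (h : Hexad K v₁ v₂ v₃ a₁ a₂ a₃) : Hexad K v₂ v₃ v₁ a₂ a₃ a₁ := by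
  obtain ⟨⟨n12, n13, m11, m12, m13⟩, ⟨n23, m21, m22, m23⟩, ⟨m31, m32, m33⟩, p12, p13, p23⟩ :=
    h.distinct
  refine ⟨?_, ⟨h.deg_v.2.1, h.deg_v.2.2, h.deg_v.1⟩,
    ⟨h.cycle_v.2.1, h.cycle_v.2.2.symm, h.cycle_v.1.symm⟩, h.adj_a₂.symm, h.adj_a₃.symm, h.adj_a₁⟩
  simp [n12.symm, n13.symm, m11, m12, m13, n23, m21, m22, m23, m31, m32, m33, p12.symm, p13.symm,
    p23]

theorem nbr (h : Hexad K v₁ v₂ v₃ a₁ a₂ a₃) {w : V} (hw : Adj K v₁ w) :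
    w = v₂ ∨ w = v₃ ∨ w = a₂ ∨ w = a₃ := by
  obtain ⟨⟨n12, n13, m11, m12, m13⟩, ⟨n23, m21, m22, m23⟩, ⟨m31, m32, m33⟩, p12, p13, p23⟩ :=
    h.distinct
  exact nbr_of_deg_four h.deg_v.1 h.cycle_v.1 h.cycle_v.2.2 h.adj_a₂.1.symm h.adj_a₃.1.symm
    (nodup_four ⟨n23, m22, m23⟩ ⟨m32, m33, p23⟩) hw

/-- Among the four neighbours of `v₁`, the vertex `a₂` is not adjacent to `v₂`, so `v₁` and `v₂`
share at most `v₃` and `a₃`. -/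
theorem contractible_of_inner (h : Hexad K v₁ v₂ v₃ a₁ a₂ a₃) (hK : InF4 K)
    (hv : ¬ BdryVertex K v₁) : Contractible K v₁ v₂ := by
  obtain ⟨⟨n12, n13, m11, m12, m13⟩, ⟨n23, m21, m22, m23⟩, ⟨m31, m32, m33⟩, p12, p13, p23⟩ :=
    h.distinct
  refine hK.contractible_of_common (p := v₃) (q := a₃) h.cycle_v.1 (fun hb => hv hb.left)
    (Or.inl hv) fun c h1 h2 => ?_
  rcases h.nbr h1 with e | e | e | e
  · exact absurd e.symm h2.1
  · exact Or.inl e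
  · subst e
    rcases h.rot.nbr h2 with e | e | e | e
    exacts [absurd e m32.symm, absurd e m12.symm, absurd e p23, absurd e p12.symm]
  · exact Or.inr e

end Hexad

theorem IsOctahedron.exists_contractible {v₁ v₂ v₃ a₁ a₂ a₃ : V}
    (h : IsOctahedron K v₁ v₂ v₃ a₁ a₂ a₃) (hK : InF4 K) : ∃ u v, Contractible K u v := by
  obtain ⟨hx, -, h⟩ := h
  rcases h with h | h | h | h
  · exact ⟨_, _, hx.contractible_of_inner hK h.1⟩
  · exact ⟨_, _, hx.rot.contractible_of_inner hK h.2.1⟩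
  · exact ⟨_, _, hx.rot.rot.contractible_of_inner hK h.2.2.1⟩
  · obtain ⟨⟨n12, n13, m11, m12, m13⟩, ⟨n23, m21, m22, m23⟩, ⟨m31, m32, m33⟩, p12, p13, p23⟩ :=
      hx.distinct
    -- With the whole center on the boundary no central edge is available, but the boundary is just
    -- `v₁v₂v₃`. So `a₃` is inner and `v₁a₃` is contractible.
    have ha : ¬ BdryVertex K a₃ := by
      rintro ⟨w, hw⟩
      have := ((h.2.2.2 _ _).1 hw).2.1
      simp only [Finset.mem_insert, Finset.mem_singleton] at this
      rcases this with e | e | e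
      exacts [m13 e.symm, m23 e.symm, m33 e.symm]
    refine ⟨v₁, a₃, hK.contractible_of_common (p := v₂) (q := a₂) hx.adj_a₃.1.symm
      (fun hb => ha hb.right) (Or.inr ha) fun c h1 h2 => ?_⟩
    rcases hx.nbr h1 with e | e | e | e
    · exact Or.inl e
    · subst e
      rcases hx.rot.rot.nbr h2.symm with e | e | e | e
      exacts [absurd e m13.symm, absurd e m23.symm, absurd e p13.symm, absurd e p23.symm]
    · exact Or.inr e
    · exact absurd e.symm h2.1

theorem IsQuasiOctahedron.exists_contractible {v₁ v₂ v₃ a₁ a₂ a₃ : V}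
    (h : IsQuasiOctahedron K v₁ v₂ v₃ a₁ a₂ a₃) (hK : InF4 K) : ∃ u v, Contractible K u v := by
  obtain ⟨hx, -, h23, -, h⟩ := h
  refine ⟨_, _, hx.contractible_of_inner hK ?_⟩
  rcases h with h | ⟨-, h⟩
  · exact h.2.2.1
  · have hd := hx.distinct
    -- As every 3-cycle on the six vertices is a face, the link of `v₁` is a closed 4-cycle, so `v₁`
    -- is inner.
    have hc : Cyc K v₁ v₂ v₃ a₂ a₃ :=
      ⟨h _ (by simp) _ (by simp) _ (by simp) hx.cycle_v.1 hx.cycle_v.2.1 hx.cycle_v.2.2,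
        h _ (by simp) _ (by simp) _ (by simp) hx.cycle_v.2.2 hx.adj_a₂.2.symm hx.adj_a₂.1.symm,
        h _ (by simp) _ (by simp) _ (by simp) hx.adj_a₂.1.symm h23 hx.adj_a₃.1.symm,
        h _ (by simp) _ (by simp) _ (by simp) hx.adj_a₃.1.symm hx.adj_a₃.2 hx.cycle_v.1,
        hd.2.1.2.2.1, hd.2.2.1.2.2⟩
    exact hc.inner hK.surf

/-- Every 4-reduction requires a contractible edge. -/
theorem IsIrreducible.fourMinimal (hi : IsIrreducible K) : FourMinimal K := by
  rintro L ⟨hK, -, -, h⟩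
  have hno : ¬ ∃ u v, Contractible K u v := fun ⟨u, v, h⟩ => hi u v h
  rcases h with ⟨a, b, h, -⟩ | h | h | h | h | h
  · exact hi a b h
  · obtain ⟨v₁, v₂, v₃, a₁, a₂, a₃, h | h | h⟩ := h
    exacts [hno (h.1.exists_contractible hK), hno (h.1.exists_contractible hK),
      hno (h.1.1.exists_contractible hK)]
  · obtain ⟨v₁, v₂, v₃, a₁, a₂, a₃, w, h, -⟩ := h
    exact hno (h.1.exists_contractible hK)
  · obtain ⟨v₁, v₂, v₃, a₁, a₂, a₃, h, -⟩ := h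
    exact hno (h.exists_contractible hK)
  · obtain ⟨v₁, v₂, v₃, a₁, a₂, a₃, v, h, -⟩ := h
    exact hno (h.exists_contractible hK)
  · obtain ⟨x, y, z, v, -, -, -, h, -⟩ := h
    exact hi x y h

theorem SameSurface.trans {M : Finset (Finset V)} (h : SameSurface K L) (h' : SameSurface L M) :
    SameSurface K M :=
  ⟨h.1, h'.2.1, h.2.2.1.trans h'.2.2.1, h.2.2.2.trans h'.2.2.2⟩

theorem InF4.sameSurface_of_flips (hK : InF4 K) (h : Relation.ReflTransGen DiagonalFlip K L) :
    SameSurface K L := by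
  induction h with
  | refl => exact ⟨hK.1, hK.1, rfl, Iff.rfl⟩
  | tail _ h2 ih => exact ih.trans h2.2.2.1

/-- Every triangulation of a punctured surface other than the disk with minimum degree at least `4`
can be transformed into an irreducible one. -/
theorem InF4.exists_irreducible (n : ℕ) : ∀ K : Finset (Finset V), (verts K).card = n → InF4 K →
    ¬ IsDisk K → ∃ K', Relation.ReflTransGen AdmissibleOp K K' ∧ InF4 K' ∧ SameSurface K K' ∧
      IsIrreducible K' := by
  induction n using Nat.strong_induction_on with
  | _ n ih =>
    intro K hn hK hd
    by_cases hi : IsIrreducible K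
    · exact ⟨K, .refl, hK, ⟨hK.1, hK.1, rfl, Iff.rfl⟩, hi⟩
    · simp only [IsIrreducible, not_forall, not_not] at hi
      obtain ⟨a, b, hab⟩ := hi
      obtain ⟨L, L', h1, h2, h3⟩ := reducible_of_contractible hK hd hab
      have hs := (hK.sameSurface_of_flips h1).trans h2.2.2.1
      -- Flips keep the number of vertices and the chosen 4-reduction lowers it. The smaller
      -- triangulation is not a disk, since its Euler characteristic is that of `K`.
      obtain ⟨K', k1, k2, k3, k4⟩ := ih _ (hn ▸ h3) L' rfl h2.2.1
        fun h => hd ⟨hK.1, hs.2.2.1.trans h.2⟩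
      exact ⟨K', ((Relation.ReflTransGen.mono (fun _ _ h => Or.inr h) _ _ h1).tail
        (Or.inl h2)).trans k1, k2, hs.trans k3, k4⟩

end SurfTri


theorem theorem5 {V : Type*} [DecidableEq V] (G : Finset (Finset V))
    (hG : SurfTri.InF4 G) (hdisk : ¬ SurfTri.IsDisk G) :
    (SurfTri.FourMinimalWithFlips G → SurfTri.IsIrreducible G) ∧
    (SurfTri.IsIrreducible G → SurfTri.FourMinimal G) ∧
    (∃ G', Relation.ReflTransGen SurfTri.AdmissibleOp G G' ∧ SurfTri.InF4 G' ∧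
      SurfTri.SameSurface G G' ∧ SurfTri.IsIrreducible G') := by
  refine ⟨fun hm a b hab => ?_, fun hi => hi.fourMinimal,
    SurfTri.InF4.exists_irreducible _ G rfl hG hdisk⟩
  obtain ⟨L, L', h1, h2, -⟩ := SurfTri.reducible_of_contractible hG hdisk hab
  exact hm L h1 L' h2
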